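/- Let $n \ge 2$. There is an LCL problem $\Pi$ on $\mathbb{Z}^n$ such that $\Pi \notin \mathtt{FIID}(\mathbb{Z}^n)$, $\Pi \in \mathtt{BaireSHIFT}(\mathbb{Z}^n)$ and $\Pi \in \mathtt{COMPUTABLE}(\mathbb{Z}^n)$. Consequently, $\mathtt{COMPUTABLE}(\mathbb{Z}^n) \not\subseteq \mathtt{MEASURE}(\mathbb{Z}^n)$. Here, for a finitely generated group $\Gamma$, an LCL problem on $\Gamma$ is a triple $\Pi = (W, \Lambda, \mathcal{A})$ of a finite set $W \subseteq \Gamma$, a finite set $\Lambda$ of labels, and a set $\mathcal{A} \subseteq \Lambda^W$. A solution to $\Pi$ on an action of $\Gamma$ on $X$ is a map $f \colon X \to \Lambda$ such that for every $x \in X$ the map $W \to \Lambda$, $w \mapsto f(w \cdot x)$, is in $\mathcal{A}$. An action is free if $\gamma \cdot x \ne x$ for all $x \in X$ and all $\gamma \ne \mathbf{1}$. For a set $Y$, $\Gamma$ acts on $Y^\Gamma$ by $(\gamma \cdot x)(\delta) = x(\delta\gamma)$, and $\mathcal{F}(Y,\Gamma)$ is the invariant set of those $x \in Y^\Gamma$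 with $\gamma \cdot x \neq x$ for all $\gamma \neq \mathbf{1}$. The classes are: - $\Pi \in \mathtt{FIID}(\Gamma)$ iff $\Pi$ has a solution $f$ on $\mathcal{F}([0,1],\Gamma)$ such that every $f^{-1}(\lambda)$, $\lambda \in \Lambda$, is measurable with respect to the completion of the product measure $\mathcal{L}^\Gamma$, where $\mathcal{L}$ is Lebesgue measure on $[0,1]$; - $\Pi \in \mathtt{BaireSHIFT}(\Gamma)$ iff $\Pi$ has a solution $f$ on $\mathcal{F}(\{0,1\},\Gamma)$ (with the topology inherited from the product of discrete spaces) such that every $f^{-1}(\lambda)$ has the Baire property; - $\Pi \in \mathtt{COMPUTABLE}(\Gamma)$ iff for every computable set $X \subseteq \mathbb{N}$ and every free action of $\Gamma$ on $X$ for which each map $x \mapsto \gamma \cdot x$, $\gamma \in \Gamma$, is computable, $\Pi$ has a computable solution $f \colon X \to \Lambda$; - $\Pi \in \mathtt{MEASURE}(\Gamma)$ iff for every standard Borel space $X$ with a Borel probability measure $\mu$ and every free Borel (not necessarily measure-preserving) action of $\Gamma$ on $X$, $\Pi$ has a solution $f$ on $X$ such that every $f^{-1}(\lambda)$ is $\mu$-measurable.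 -/

import Mathlib

open MeasureTheory

/-! Groups are written additively: the results concern `ℤⁿ`. -/

/-- A locally checkable labeling problem `(W, Λ, 𝒜)` on a group `Γ`: a finite window `W ⊆ Γ`,
a finite set `Λ` of labels and a family `𝒜` of allowed configurations `W → Λ`. -/
structure LCL (Γ : Type) : Type 1 where
  window : Finset Γ
  Label : Type
  [labelFinite : Finite Label]
  allowed : Set (window → Label)

namespace LCL

/-- `f` is a solution to `P` on the `Γ`-action `X`: for every `x`, the map `w ↦ f (w · x)` is an
allowed configuration. -/
def IsSolution {Γ : Type} [AddGroup Γ] (P : LCL Γ) {X : Type} [AddAction Γ X]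
    (f : X → P.Label) : Prop :=
  ∀ x : X, (fun w : P.window => f ((w : Γ) +ᵥ x)) ∈ P.allowed

end LCL

/-- An action is free if no nonidentity element has a fixed point. -/
def IsFreeAction (Γ X : Type) [AddGroup Γ] [AddAction Γ X] : Prop :=
  ∀ γ : Γ, γ ≠ 0 → ∀ x : X, γ +ᵥ x ≠ x

/-- The shift action on `Γ → X`, `(γ · x) δ = x (δ γ)`. -/
def shift {X Γ : Type} [AddGroup Γ] (γ : Γ) (x : Γ → X) : Γ → X :=
  fun δ => x (δ + γ)

/-- The free part `ℱ(X, Γ)` of the shift action. -/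
def FreePart (X Γ : Type) [AddGroup Γ] : Set (Γ → X) :=
  {x | ∀ γ : Γ, γ ≠ 0 → shift γ x ≠ x}

theorem shift_zero {X Γ : Type} [AddGroup Γ] (x : Γ → X) : shift 0 x = x := by
  funext δ; simp [shift]

theorem shift_add {X Γ : Type} [AddGroup Γ] (γ γ' : Γ) (x : Γ → X) :
    shift (γ + γ') x = shift γ (shift γ' x) := by
  funext δ; simp [shift, add_assoc]

theorem shift_mem_freePart {X Γ : Type} [AddGroup Γ] (γ : Γ) {x : Γ → X}
    (hx : x ∈ FreePart X Γ) : shift γ x ∈ FreePart X Γ := by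
  intro δ hδ h
  refine hx (-γ + δ + γ) (fun h0 => hδ ?_) ?_
  · have h1 : -γ + (δ + γ) = 0 := by rw [← add_assoc]; exact h0
    have h2 : δ + γ = γ := (neg_add_eq_zero.mp h1).symm
    exact add_eq_right.mp h2
  · rw [shift_add, shift_add, h, ← shift_add, neg_add_cancel, shift_zero]

/-- The shift action of `Γ` on the free part `ℱ(X, Γ)`. -/
instance FreePart.instAddAction (X Γ : Type) [AddGroup Γ] : AddAction Γ (FreePart X Γ) where
  vadd γ x := ⟨shift γ x.1, shift_mem_freePart γ x.2⟩
  zero_vadd x := Subtype.ext (shift_zero x.1)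
  add_vadd γ γ' x := Subtype.ext (shift_add γ γ' x.1)

/-- The power of Lebesgue measure on `[0,1]`, as a measure on the free part `ℱ([0,1], Γ)`. -/
noncomputable def iidMeasure (Γ : Type) [AddGroup Γ] : Measure (FreePart unitInterval Γ) :=
  (Measure.infinitePi (fun _ : Γ => (volume : Measure unitInterval))).comap Subtype.val

/-- A map to a finite discrete set is `μ`-measurable if the preimage of every label is measurable
with respect to the completion of `μ`. -/
def IsMeasurableLabeling {X Λ : Type} [MeasurableSpace X] (μ : Measure X) (f : X → Λ) : Prop :=
  ∀ l : Λ, NullMeasurableSet (f ⁻¹' {l}) μ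

/-- A map to a finite discrete set is Baire-measurable if the preimage of every label has the Baire
property. -/
def IsBaireMeasurableLabeling {X Λ : Type} [TopologicalSpace X] (f : X → Λ) : Prop :=
  ∀ l : Λ, BaireMeasurableSet (f ⁻¹' {l})

/-- A map from a computable set `X ⊆ ℕ` to a finite set `Λ` is computable if it is so after the
elements of `Λ` are coded by natural numbers. Which coding is used is immaterial, since `Λ` is
finite; and as `X` is computable, a computable map on `X` is the restriction of a total one. -/
def IsComputableLabeling {X : Set ℕ} {Λ : Type} (f : X → Λ) : Prop :=
  ∃ (e : Λ ↪ ℕ) (g : ℕ → ℕ), Computable g ∧ ∀ x : X, g x = e (f x)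

/-- An action of `Γ` on `X ⊆ ℕ` is computable if every group element acts by a computable map. -/
def IsComputableAction (Γ : Type) [AddGroup Γ] (X : Set ℕ) [AddAction Γ X] : Prop :=
  ∀ γ : Γ, ∃ g : ℕ → ℕ, Computable g ∧ ∀ x : X, g x = ((γ +ᵥ x : X) : ℕ)

/-- The class of problems with a `μ`-measurable solution on every free Borel action on a standard
probability space `(X, μ)`; the action need not preserve `μ`. -/
def MEASURE (Γ : Type) [AddGroup Γ] : Set (LCL Γ) :=
  {P | ∀ (X : Type) [MeasurableSpace X] [StandardBorelSpace X] (μ : Measure X)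
      [IsProbabilityMeasure μ] [AddAction Γ X],
      (∀ γ : Γ, Measurable fun x : X => γ +ᵥ x) → IsFreeAction Γ X →
      ∃ f : X → P.Label, IsMeasurableLabeling μ f ∧ P.IsSolution f}

/-- The class of problems with a measurable solution on `ℱ([0,1], Γ)`. -/
def FIID (Γ : Type) [AddGroup Γ] : Set (LCL Γ) :=
  {P | ∃ f : FreePart unitInterval Γ → P.Label,
      IsMeasurableLabeling (iidMeasure Γ) f ∧ P.IsSolution f}

/-- The class of problems with a Baire-measurable solution on `ℱ(2, Γ)`. -/
def BaireSHIFT (Γ : Type) [AddGroup Γ] : Set (LCL Γ) :=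
  {P | ∃ f : FreePart (Fin 2) Γ → P.Label, IsBaireMeasurableLabeling f ∧ P.IsSolution f}

/-- The class of problems with a computable solution on every free computable action on a
computable set `X ⊆ ℕ`. -/
def COMPUTABLE (Γ : Type) [AddGroup Γ] : Set (LCL Γ) :=
  {P | ∀ (X : Set ℕ) [AddAction Γ X], ComputablePred (fun m : ℕ => m ∈ X) →
      IsComputableAction Γ X → IsFreeAction Γ X →
      ∃ f : X → P.Label, IsComputableLabeling f ∧ P.IsSolution f}

/-! The problem decorates the orbits of a copy of `ℤ²` in the group with framed squares and two
colours. Colours alternate along rows except between the left or right side of a square and the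
point next to it inside. They also alternate along the left, top and right sides, so a frame carries
the parity of the outer chessboard around the square and leaves the parity inside free.

No measurable solution on the i.i.d. shift: ergodicity excludes infinite sides and diagonals, so
almost surely every corner starts a genuine frame (`exists_isTriangle`,
`right_bottom_of_isTriangle`). The regions above the diagonals of distinct squares are disjoint.
Hence the probabilities that the origin lies above or on the diagonal of a given square sum to at
most 1. Translation invariance bounds the sum for the lower halves as well, and by Borel–Cantelli
almost every point lies in only finitely many squares (`ae_finite_inSquare`). Each row then has
points outside all squares, and these follow one chessboard (`colour_of_isOuter`). Its parity is a
measurable set exchanged with its complement by `(1, 0)`, against ergodicity of `(2, 0)`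
(`not_ae_isTilingAt`). The i.i.d. shift is itself a free Borel action with a probability measure, so
the problem is not in `MEASURE` either.

Solutions exist once points may lie in infinitely many squares, since then no parity need be global.
Separated finished squares can be placed below the diagonal of a larger one, whatever the parities
(`exists_valid_extension`), and any family of pairwise equal, separated or nested squares defines
labels (`exists_labelling`). In a computable action, unbounded search finds ever larger finite
families that swallow the earlier ones and the points one by one (`exists_computable_tiling`). In
the shift, such families are built by treating the basic open sets in turn, each time around a point
of finite support, whose orbit meets only finitely many earlier squares (`IsTame.exists_extension`).
They cover a dense open set. On the invariant meagre set that remains, a chessboard obtained by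
choice suffices. -/

namespace FramedSquares

/-! ### Labels, local rules and the problem itself -/

/-- The shapes of the labels. A framed square consists of its four corners `lb`, `lt`, `rt`, `rb`,
its four sides `left`, `top`, `right`, `bottom`, its diagonal `diag` and the region `upper` above
the diagonal. All other points are `plain`. -/
inductive Tile : Type
  | plain | lb | left | lt | top | rt | right | rb | bottom | diag | upper
  deriving DecidableEq

instance : Fintype Tile where
  elems := {.plain, .lb, .left, .lt, .top, .rt, .right, .rb, .bottom, .diag, .upper}
  complete t := by cases t <;> decide

/-- A label is a shape together with a colour. -/
abbrev Lab : Type := Tile × Bool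

open Tile

/-- The constraint between a point and its right neighbour. The colours alternate, except when
a framed square is entered through its left side or left through its right side. -/
def HRel (α β : Lab) : Prop :=
  (α.1 = lb → β.1 = bottom) ∧ (α.1 = bottom → β.1 = bottom ∨ β.1 = rb) ∧
  (β.1 = bottom → α.1 = bottom ∨ α.1 = lb) ∧ (β.1 = rb → α.1 = bottom) ∧
  (α.1 = left → β.1 = upper ∨ β.1 = diag) ∧ (α.1 = upper → β.1 = upper ∨ β.1 = diag) ∧
  (α.1 = lt → β.1 = top) ∧ (α.1 = top → β.1 = top ∨ β.1 = rt) ∧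
  (β.1 = right → α.1 ≠ right) ∧ (α.1 = left ∨ β.1 = right ∨ α.2 ≠ β.2)

/-- The constraint between a point and its upper neighbour. -/
def VRel (α β : Lab) : Prop :=
  (α.1 = lb → β.1 = left) ∧ (α.1 = left → β.1 = left ∨ β.1 = lt) ∧
  (β.1 = left → α.1 = left ∨ α.1 = lb) ∧ (α.1 = upper → β.1 = upper ∨ β.1 = top) ∧
  (α.1 = diag → β.1 = upper ∨ β.1 = top) ∧ (α.1 = rb → β.1 = right) ∧
  (α.1 = right → β.1 = right ∨ β.1 = rt) ∧ (β.1 = right → α.1 = right ∨ α.1 = rb) ∧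
  (β.1 = rt → α.1 = right) ∧ (α.1 = left ∨ α.1 = right → α.2 ≠ β.2)

/-- The constraint between a point and its upper right neighbour. -/
def DRel (α β : Lab) : Prop :=
  (α.1 = lb → β.1 = diag) ∧ (α.1 = diag → β.1 = diag ∨ β.1 = rt) ∧
  (β.1 = diag → α.1 = diag ∨ α.1 = lb) ∧ (β.1 = rt → α.1 = diag)

/-- The local constraints at a point of a `ℤ²`-action. -/
def IsTilingAt {X : Type} [AddAction (ℤ × ℤ) X] (f : X → Lab) (x : X) : Prop :=
  HRel (f x) (f (((1, 0) : ℤ × ℤ) +ᵥ x)) ∧ VRel (f x) (f (((0, 1) : ℤ × ℤ) +ᵥ x)) ∧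
    DRel (f x) (f (((1, 1) : ℤ × ℤ) +ᵥ x))

variable {Γ : Type} [AddGroup Γ]

open Classical in
/-- The problem of tiling by framed squares the planes given by a copy of `ℤ²` in `Γ`. -/
noncomputable def tilingLCL (e : ℤ × ℤ →+ Γ) : LCL Γ where
  window := {0, e (1, 0), e (0, 1), e (1, 1)}
  Label := Lab
  labelFinite := inferInstance
  allowed := {g | HRel (g ⟨0, by simp⟩) (g ⟨e (1, 0), by simp⟩) ∧
    VRel (g ⟨0, by simp⟩) (g ⟨e (0, 1), by simp⟩) ∧
    DRel (g ⟨0, by simp⟩) (g ⟨e (1, 1), by simp⟩)}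

theorem isSolution_tilingLCL_iff (e : ℤ × ℤ →+ Γ) {X : Type} [AddAction Γ X] (f : X → Lab) :
    (tilingLCL e).IsSolution f ↔
      ∀ x, HRel (f x) (f (e (1, 0) +ᵥ x)) ∧ VRel (f x) (f (e (0, 1) +ᵥ x)) ∧
        DRel (f x) (f (e (1, 1) +ᵥ x)) := by
  refine forall_congr' fun x => ?_
  change HRel (f ((0 : Γ) +ᵥ x)) _ ∧ VRel (f ((0 : Γ) +ᵥ x)) _ ∧ DRel (f ((0 : Γ) +ᵥ x)) _ ↔ _
  rw [zero_vadd]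

/-- The embedding of `ℤ²` into `ℤⁿ` by the first two coordinates. -/
def planeHom {n : ℕ} (hn : 2 ≤ n) : ℤ × ℤ →+ (Fin n → ℤ) where
  toFun z := Pi.single (⟨0, by lia⟩ : Fin n) z.1 + Pi.single (⟨1, by lia⟩ : Fin n) z.2
  map_zero' := by simp
  map_add' z w := by
    simp only [Prod.fst_add, Prod.snd_add, Pi.single_add]
    exact add_add_add_comm _ _ _ _

theorem planeHom_apply_zero {n : ℕ} (hn : 2 ≤ n) (z : ℤ × ℤ) :
    planeHom hn z ⟨0, by lia⟩ = z.1 := by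
  simp [planeHom]

theorem planeHom_apply_one {n : ℕ} (hn : 2 ≤ n) (z : ℤ × ℤ) :
    planeHom hn z ⟨1, by lia⟩ = z.2 := by
  simp [planeHom]

theorem planeHom_injective {n : ℕ} (hn : 2 ≤ n) : Function.Injective (planeHom hn) := by
  intro z w h
  ext
  · rw [← planeHom_apply_zero hn z, h, planeHom_apply_zero]
  · rw [← planeHom_apply_one hn z, h, planeHom_apply_one]

end FramedSquares

/-! ### Geometry of a single tiling of the plane -/

namespace FramedSquares

open Tile

/-- A tiling of the plane. -/
structure IsPlaneTiling (ω : ℤ → ℤ → Lab) : Prop where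
  hor : ∀ i j, HRel (ω i j) (ω (i + 1) j)
  ver : ∀ i j, VRel (ω i j) (ω i (j + 1))
  dia : ∀ i j, DRel (ω i j) (ω (i + 1) (j + 1))

/-- The left and right sides and the diagonals in `ω` are finite. -/
structure HasFiniteLines (ω : ℤ → ℤ → Lab) : Prop where
  left_up : ∀ i j : ℤ, ∃ m : ℕ, (ω i (j + m)).1 ≠ left
  left_down : ∀ i j : ℤ, ∃ m : ℕ, (ω i (j - m)).1 ≠ left
  diag_down : ∀ i j : ℤ, ∃ m : ℕ, (ω (i - m) (j - m)).1 ≠ diag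
  right_up : ∀ i j : ℤ, ∃ m : ℕ, (ω i (j + m)).1 ≠ right

/-- The left side, the top side, the diagonal and the region between them of a framed square
with lower left corner `(a, b)` and side length `k`. -/
structure IsTriangle (ω : ℤ → ℤ → Lab) (a b k : ℤ) : Prop where
  two_le : 2 ≤ k
  lb : (ω a b).1 = lb
  lt : (ω a (b + k)).1 = lt
  rt : (ω (a + k) (b + k)).1 = rt
  left : ∀ j, b < j → j < b + k → (ω a j).1 = left
  top : ∀ i, a < i → i < a + k → (ω i (b + k)).1 = top
  diag : ∀ i j, i - a = j - b → a < i → i < a + k → (ω i j).1 = diag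
  upper : ∀ i j, a < i → i - a < j - b → j < b + k → (ω i j).1 = upper

theorem IsTriangle.size_unique {ω : ℤ → ℤ → Lab} {a b k k' : ℤ} (h : IsTriangle ω a b k)
    (h' : IsTriangle ω a b k') : k = k' := by
  rcases lt_trichotomy k k' with hlt | heq | hlt
  · have h1 := h'.left (b + k) (by have := h.two_le; lia) (by lia)
    rw [h.lt] at h1; cases h1
  · exact heq
  · have h1 := h.left (b + k') (by have := h'.two_le; lia) (by lia)
    rw [h'.lt] at h1; cases h1

section

variable {ω : ℤ → ℤ → Lab} (hω : IsPlaneTiling ω) (hf : HasFiniteLines ω)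
include hω

theorem IsPlaneTiling.hor' {i i' j : ℤ} (h : i' = i + 1) : HRel (ω i j) (ω i' j) := h ▸ hω.hor i j

theorem IsPlaneTiling.ver' {i j j' : ℤ} (h : j' = j + 1) : VRel (ω i j) (ω i j') := h ▸ hω.ver i j

theorem IsPlaneTiling.dia' {i i' j j' : ℤ} (h : i' = i + 1) (h' : j' = j + 1) :
    DRel (ω i j) (ω i' j') := h ▸ h' ▸ hω.dia i j

include hf

/-- A left side can only end in `lt`, which fixes the height. The rows up to there are then forced
from left to right, and the diagonal makes the width equal to the height. Nothing is forced below
the diagonal, which is where smaller squares may sit. -/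
theorem exists_isTriangle {a b : ℤ} (hlb : (ω a b).1 = lb) : ∃ k, IsTriangle ω a b k := by
  classical
  have hex := hf.left_up a (b + 1)
  set K := Nat.find hex with hK
  have hKne : (ω a (b + 1 + K)).1 ≠ left := Nat.find_spec hex
  have hleft : ∀ m : ℕ, m < K → (ω a (b + 1 + m)).1 = left := fun m hm => by
    by_contra h; exact Nat.find_min hex hm h
  have hK0 : K ≠ 0 := by
    intro h0; rw [h0] at hKne
    exact hKne (by simpa using (hω.ver a b).1 hlb)
  have hlt : (ω a (b + 1 + K)).1 = lt := by
    have h1 := hleft (K - 1) (by lia)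
    have h2 := (hω.ver' (i := a) (j := b + 1 + (K - 1 : ℕ)) (j' := b + 1 + K) (by lia)).2.1 h1
    exact h2.resolve_left hKne
  -- Induction on rows. The left neighbour allows `upper` or `diag`, while an `upper` or `diag`
  -- point below allows `upper` or `top`, so only `upper` survives. At the end of the row the
  -- diagonal rule allows `diag` or `rt`, and the left neighbour excludes `rt`.
  have hrow : ∀ m : ℕ, m < K → (ω (a + 1 + m) (b + 1 + m)).1 = diag ∧
      ∀ i : ℕ, i < m → (ω (a + 1 + i) (b + 1 + m)).1 = upper := by
    intro m
    induction m with
    | zero =>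
      intro _
      refine ⟨?_, fun i hi => absurd hi (by lia)⟩
      simpa using (hω.dia a b).1 hlb
    | succ m ih =>
      intro hm
      obtain ⟨hd, hu⟩ := ih (by lia)
      have hup : ∀ i : ℕ, i < m + 1 → (ω (a + 1 + i) (b + 1 + (m + 1 : ℕ))).1 = upper := by
        intro i
        induction i with
        | zero =>
          intro _
          have h1 := (hω.hor' (i := a) (i' := a + 1 + (0 : ℕ)) (j := b + 1 + (m + 1 : ℕ))
            (by lia)).2.2.2.2.1 (hleft _ hm)
          have h2 := hω.ver' (i := a + 1 + (0 : ℕ)) (j := b + 1 + m) (j' := b + 1 + (m + 1 : ℕ))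
            (by lia)
          rcases Nat.eq_zero_or_pos m with h0 | h0
          · subst h0
            have h3 := h2.2.2.2.2.1 (by simpa using hd)
            grind
          · have h3 := h2.2.2.2.1 (hu 0 h0)
            grind
        | succ i ihi =>
          intro hi
          have h1 := (hω.hor' (i := a + 1 + i) (i' := a + 1 + (i + 1 : ℕ))
            (j := b + 1 + (m + 1 : ℕ)) (by lia)).2.2.2.2.2.1 (ihi (by lia))
          have h2 := hω.ver' (i := a + 1 + (i + 1 : ℕ)) (j := b + 1 + m)
            (j' := b + 1 + (m + 1 : ℕ)) (by lia)
          rcases (show i + 1 ≤ m by lia).eq_or_lt with h0 | h0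
          · have h3 := h2.2.2.2.2.1 (by rw [h0]; exact hd)
            grind
          · have h3 := h2.2.2.2.1 (hu (i + 1) h0)
            grind
      refine ⟨?_, hup⟩
      have h1 := (hω.dia' (i := a + 1 + m) (i' := a + 1 + (m + 1 : ℕ)) (j := b + 1 + m)
            (j' := b + 1 + (m + 1 : ℕ)) (by lia) (by lia)).2.1 hd
      have h2 := (hω.hor' (i := a + 1 + m) (i' := a + 1 + (m + 1 : ℕ))
            (j := b + 1 + (m + 1 : ℕ)) (by lia)).2.2.2.2.2.1 (hup m (by lia))
      grind
  have htop : ∀ i : ℕ, i < K → (ω (a + 1 + i) (b + 1 + K)).1 = top := by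
    intro i
    induction i with
    | zero =>
      intro _
      exact (hω.hor' (i := a) (i' := a + 1 + (0 : ℕ)) (by lia)).2.2.2.2.2.2.1 hlt
    | succ i ihi =>
      intro hi
      have h1 := (hω.hor' (i := a + 1 + i) (i' := a + 1 + (i + 1 : ℕ))
        (j := b + 1 + K) (by lia)).2.2.2.2.2.2.2.1 (ihi (by lia))
      have h2 := hω.ver' (i := a + 1 + (i + 1 : ℕ)) (j := b + 1 + (K - 1 : ℕ))
        (j' := b + 1 + K) (by lia)
      rcases (show i + 1 ≤ K - 1 by lia).eq_or_lt with h0 | h0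
      · have h3 := h2.2.2.2.2.1 (by rw [h0]; exact (hrow (K - 1) (by lia)).1)
        grind
      · have h3 := h2.2.2.2.1 ((hrow (K - 1) (by lia)).2 (i + 1) h0)
        grind
  refine ⟨K + 1, by lia, hlb, ?_, ?_, ?_, ?_, ?_, ?_⟩
  · rw [← hlt]; congr 2; ring
  · have h1 := (hω.dia' (i := a + 1 + (K - 1 : ℕ)) (i' := a + (K + 1)) (j := b + 1 + (K - 1 : ℕ))
      (j' := b + (K + 1)) (by lia) (by lia)).2.1 (hrow (K - 1) (by lia)).1
    have h2 := (hω.hor' (i := a + 1 + (K - 1 : ℕ)) (i' := a + (K + 1))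
      (j := b + (K + 1)) (by lia)).2.2.2.2.2.2.2.1
      (by rw [← htop (K - 1) (by lia)]; congr 2; ring)
    grind
  · intro j h1 h2
    have := hleft (j - b - 1).toNat (by lia)
    rwa [show b + 1 + ((j - b - 1).toNat : ℤ) = j by lia] at this
  · intro i h1 h2
    have := htop (i - a - 1).toNat (by lia)
    rwa [show a + 1 + ((i - a - 1).toNat : ℤ) = i by lia,
      show b + 1 + (K : ℤ) = b + (K + 1) by ring] at this
  · intro i j h0 h1 h2
    have := (hrow (i - a - 1).toNat (by lia)).1
    rwa [show a + 1 + ((i - a - 1).toNat : ℤ) = i by lia,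
      show b + 1 + ((i - a - 1).toNat : ℤ) = j by lia] at this
  · intro i j h0 h1 h2
    have := (hrow (j - b - 1).toNat (by lia)).2 (i - a - 1).toNat (by lia)
    rwa [show a + 1 + ((i - a - 1).toNat : ℤ) = i by lia,
      show b + 1 + ((j - b - 1).toNat : ℤ) = j by lia] at this

/-- Walking down from a `left` tile, the first other tile must be `lb`. The walk meets no `lt`, so
the starting point is below the top corner of the square found there. -/
theorem exists_isTriangle_of_left {i j : ℤ} (h : (ω i j).1 = left) :
    ∃ b k, IsTriangle ω i b k ∧ b < j ∧ j < b + k := by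
  classical
  have hex := hf.left_down i j
  set m := Nat.find hex with hm
  have hne : (ω i (j - m)).1 ≠ left := Nat.find_spec hex
  have hleft : ∀ l : ℕ, l < m → (ω i (j - l)).1 = left := fun l hl => by
    by_contra h; exact Nat.find_min hex hl h
  have hm0 : m ≠ 0 := by
    intro h0; rw [h0] at hne
    exact hne (by simpa using h)
  have hlb : (ω i (j - m)).1 = lb :=
    ((hω.ver' (i := i) (j := j - m) (j' := j - (m - 1 : ℕ)) (by lia)).2.2.1
      (hleft _ (by lia))).resolve_left hne
  obtain ⟨k, hk⟩ := exists_isTriangle hω hf hlb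
  refine ⟨j - m, k, hk, by lia, ?_⟩
  by_contra hlt
  have h1 := hleft (m - k).toNat (by have := hk.two_le; lia)
  rw [show j - ((m - k).toNat : ℤ) = j - m + k by lia, hk.lt] at h1
  cases h1

/-- Descending the diagonal from `rt` must end in `lb`. The diagonal of the square starting there
has its first `rt` at the original point, so the two sizes agree. -/
theorem exists_isTriangle_of_rt {i j : ℤ} (h : (ω i j).1 = rt) :
    ∃ k, IsTriangle ω (i - k) (j - k) k := by
  classical
  have hex := hf.diag_down (i - 1) (j - 1)
  set m := Nat.find hex with hm
  have hne : (ω (i - 1 - m) (j - 1 - m)).1 ≠ diag := Nat.find_spec hex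
  have hdiag : ∀ l : ℕ, l < m → (ω (i - 1 - l) (j - 1 - l)).1 = diag := fun l hl => by
    by_contra h; exact Nat.find_min hex hl h
  have hm0 : m ≠ 0 := by
    intro h0; rw [h0] at hne
    exact hne (by simpa using
      (hω.dia' (i := i - 1) (j := j - 1) (i' := i) (j' := j) (by lia) (by lia)).2.2.2 h)
  have hlb : (ω (i - 1 - m) (j - 1 - m)).1 = lb :=
    ((hω.dia' (i := i - 1 - m) (j := j - 1 - m) (i' := i - 1 - (m - 1 : ℕ))
      (j' := j - 1 - (m - 1 : ℕ)) (by lia) (by lia)).2.2.1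
      (hdiag _ (by lia))).resolve_left hne
  obtain ⟨k, hk⟩ := exists_isTriangle hω hf hlb
  have hkm : k = m + 1 := by
    rcases lt_trichotomy k (m + 1) with hlt | heq | hlt
    · have h1 := hdiag (m - k).toNat (by have := hk.two_le; lia)
      rw [show i - 1 - ((m - k).toNat : ℤ) = i - 1 - m + k by lia,
        show j - 1 - ((m - k).toNat : ℤ) = j - 1 - m + k by lia, hk.rt] at h1
      cases h1
    · exact heq
    · have h1 := hk.diag i j (by lia) (by lia) (by lia)
      rw [h] at h1; cases h1
  refine ⟨k, ?_⟩
  rwa [show i - k = i - 1 - m by lia, show j - k = j - 1 - m by lia]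

/-- The right and the bottom side of a framed square fit its left and top side. -/
theorem right_bottom_of_isTriangle {a b k : ℤ} (hk : IsTriangle ω a b k) :
    (∀ j, b < j → j < b + k → (ω (a + k) j).1 = right) ∧ (ω (a + k) b).1 = rb ∧
      (∀ i, a < i → i < a + k → (ω i b).1 = bottom) := by
  -- Induction on the side length: a side that ends too early produces a smaller square in the lower
  -- half, whose right and bottom sides are already known.
  induction hn : k.toNat using Nat.strong_induction_on generalizing a b k with
  | _ n ih =>
  have h2 := hk.two_le
  have IH : ∀ {a' b' k' : ℤ}, k' < k → IsTriangle ω a' b' k' →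
      (∀ j, b' < j → j < b' + k' → (ω (a' + k') j).1 = right) ∧ (ω (a' + k') b').1 = rb ∧
      (∀ i, a' < i → i < a' + k' → (ω i b').1 = bottom) := fun hlt h' =>
    ih _ (by have := h'.two_le; lia) h' rfl
  have hright : ∀ m : ℕ, (m : ℤ) + 1 < k → (ω (a + k) (b + k - 1 - m)).1 = right := by
    intro m
    induction m using Nat.strong_induction_on with
    | _ m ihm =>
    intro hm
    have hor : (ω (a + k) (b + k - 1 - m)).1 = right ∨ (ω (a + k) (b + k - 1 - m)).1 = rb := by
      rcases Nat.eq_zero_or_pos m with h0 | h0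
      · subst h0
        left
        exact (hω.ver' (i := a + k) (j := b + k - 1 - (0 : ℕ)) (j' := b + k)
          (by lia)).2.2.2.2.2.2.2.2.1 hk.rt
      · exact (hω.ver' (i := a + k) (j := b + k - 1 - m) (j' := b + k - 1 - (m - 1 : ℕ))
          (by lia)).2.2.2.2.2.2.2.1 (ihm (m - 1) (by lia) (by lia))
    refine hor.resolve_right fun hrb => ?_
    -- Suppose the right side, followed down from `rt`, meets `rb` in row `s`. Following `bottom`
    -- tiles to the left from there, one must reach `lb` before the diagonal. If the square starting
    -- at that corner is too narrow, its `rb` falls on the `bottom` run. If it fits exactly, its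
    -- `rt` falls on the right side. If it is too wide, its diagonal crosses the right side.
    set s := b + k - 1 - m with hs
    have hd := hk.diag (a + (s - b)) s (by lia) (by lia) (by lia)
    have hR : ∀ y, s < y → y < b + k → (ω (a + k) y).1 = right := fun y h1 h2 => by
      have := ihm (b + k - 1 - y).toNat (by lia) (by lia)
      rwa [show b + k - 1 - ((b + k - 1 - y).toNat : ℤ) = y by lia] at this
    have hex : ∃ l : ℕ, (ω (a + k - 1 - l) s).1 ≠ bottom := by
      refine ⟨(k - 1 - (s - b)).toNat, ?_⟩
      rw [show a + k - 1 - ((k - 1 - (s - b)).toNat : ℤ) = a + (s - b) by lia, hd]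
      decide
    set l := Nat.find hex with hl
    have hne : (ω (a + k - 1 - l) s).1 ≠ bottom := Nat.find_spec hex
    have hB : ∀ x, a + k - 1 - l < x → x < a + k → (ω x s).1 = bottom := fun x h1 h2 => by
      by_contra h
      refine Nat.find_min hex (m := (a + k - 1 - x).toNat) (by lia) ?_
      rwa [show a + k - 1 - ((a + k - 1 - x).toNat : ℤ) = x by lia]
    have hb1 := (hω.hor' (i := a + k - 1) (i' := a + k) (j := s) (by lia)).2.2.2.1 hrb
    have hl0 : l ≠ 0 := by
      intro h0; rw [h0] at hne
      exact hne (by simpa using hb1)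
    have hlb : (ω (a + k - 1 - l) s).1 = lb :=
      ((hω.hor' (i := a + k - 1 - l) (i' := a + k - 1 - l + 1) (j := s) (by lia)).2.2.1
        (hB _ (by lia) (by lia))).resolve_left hne
    have hq : a + (s - b) < a + k - 1 - l := by
      by_contra hcon
      rcases (not_lt.mp hcon).eq_or_lt with h | h
      · rw [h, hd] at hlb; cases hlb
      · rw [hB _ h (by lia)] at hd; cases hd
    obtain ⟨k', hk'⟩ := exists_isTriangle hω hf hlb
    have h2' := hk'.two_le
    rcases lt_trichotomy (a + k - 1 - l + k') (a + k) with hlt | heq | hlt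
    · have h3 := (IH (by lia) hk').2.1
      rw [hB _ (by lia) hlt] at h3; cases h3
    · have h3 := hk'.rt
      rw [heq, hR _ (by lia) (by lia)] at h3; cases h3
    · have h3 := hk'.diag (a + k) (s + 1 + l) (by lia) (by lia) (by lia)
      rw [hR _ (by lia) (by lia)] at h3; cases h3
  have hR : ∀ j, b < j → j < b + k → (ω (a + k) j).1 = right := fun y h1 h2 => by
    have := hright (b + k - 1 - y).toNat (by lia)
    rwa [show b + k - 1 - ((b + k - 1 - y).toNat : ℤ) = y by lia] at this
  have hbot : ∀ m : ℕ, (m : ℤ) + 1 < k → (ω (a + 1 + m) b).1 = bottom := by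
    intro m
    induction m using Nat.strong_induction_on with
    | _ m ihm =>
    intro hm
    have hor : (ω (a + 1 + m) b).1 = bottom ∨ (ω (a + 1 + m) b).1 = rb := by
      rcases Nat.eq_zero_or_pos m with h0 | h0
      · subst h0
        left
        exact (hω.hor' (i := a) (i' := a + 1 + (0 : ℕ)) (by lia)).1 hk.lb
      · exact (hω.hor' (i := a + 1 + (m - 1 : ℕ)) (i' := a + 1 + m) (by lia)).2.1
          (ihm (m - 1) (by lia) (by lia))
    refine hor.resolve_right fun hrb => ?_
    -- The same argument with the axes exchanged: above a premature `rb` there is a run of `right`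
    -- tiles ending in `rt` below the diagonal, and the square of that `rt` is too small, exact or
    -- too large.
    have hB : ∀ x, a < x → x < a + 1 + m → (ω x b).1 = bottom := fun x h1 h2 => by
      have := ihm (x - a - 1).toNat (by lia) (by lia)
      rwa [show a + 1 + ((x - a - 1).toNat : ℤ) = x by lia] at this
    have hd := hk.diag (a + 1 + m) (b + 1 + m) (by lia) (by lia) (by lia)
    have hex : ∃ l : ℕ, (ω (a + 1 + m) (b + 1 + l)).1 ≠ right :=
      ⟨m, by rw [hd]; decide⟩
    set l := Nat.find hex with hl
    have hne : (ω (a + 1 + m) (b + 1 + l)).1 ≠ right := Nat.find_spec hex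
    have hlm : l ≤ m := Nat.find_min' hex (by rw [hd]; decide)
    have hR' : ∀ y, b < y → y < b + 1 + l → (ω (a + 1 + m) y).1 = right := fun y h1 h2 => by
      by_contra h
      refine Nat.find_min hex (m := (y - b - 1).toNat) (by lia) ?_
      rwa [show b + 1 + ((y - b - 1).toNat : ℤ) = y by lia]
    have hr1 := (hω.ver' (i := a + 1 + m) (j := b) (j' := b + 1) rfl).2.2.2.2.2.1 hrb
    have hl0 : l ≠ 0 := by
      intro h0; rw [h0] at hne
      exact hne (by simpa using hr1)
    have hrt : (ω (a + 1 + m) (b + 1 + l)).1 = rt :=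
      ((hω.ver' (i := a + 1 + m) (j := b + l) (j' := b + 1 + l) (by lia)).2.2.2.2.2.2.1
        (hR' _ (by lia) (by lia))).resolve_left hne
    have hlm' : l < m := lt_of_le_of_ne hlm fun h => by
      rw [h, hd] at hrt; cases hrt
    obtain ⟨k', hk'⟩ := exists_isTriangle_of_rt hω hf hrt
    have h2' := hk'.two_le
    rcases lt_trichotomy k' (1 + l) with hlt | heq | hlt
    · have h3 := (IH (by lia) hk').2.1
      rw [show a + 1 + m - k' + k' = a + 1 + m by lia, hR' _ (by lia) (by lia)] at h3
      cases h3
    · have h3 := hk'.lb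
      rw [show b + 1 + l - k' = b by lia, hB _ (by lia) (by lia)] at h3; cases h3
    · have h3 := hk'.diag (a + m - l) b (by lia) (by lia) (by lia)
      rw [hB _ (by lia) (by lia)] at h3; cases h3
  have hB : ∀ i, a < i → i < a + k → (ω i b).1 = bottom := fun x h1 h2 => by
    have := hbot (x - a - 1).toNat (by lia)
    rwa [show a + 1 + ((x - a - 1).toNat : ℤ) = x by lia] at this
  refine ⟨hR, ?_, hB⟩
  have h3 := (hω.hor' (i := a + k - 1) (i' := a + k) (j := b) (by lia)).2.1
    (hB _ (by lia) (by lia))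
  have h4 := (hω.ver' (i := a + k) (j := b) (j' := b + 1) (by lia)).2.2.2.2.2.2.2.1
    (hR _ (by lia) (by lia))
  grind

/-- Walking up leads to `rt` and so to a square. Its `rb` corner cannot lie on the `right` tiles
just passed, hence it is below the starting point. -/
theorem exists_isTriangle_of_right {i j : ℤ} (h : (ω i j).1 = right) :
    ∃ b k, IsTriangle ω (i - k) b k ∧ b < j ∧ j < b + k := by
  classical
  have hex := hf.right_up i j
  set m := Nat.find hex with hm
  have hne : (ω i (j + m)).1 ≠ right := Nat.find_spec hex
  have hright : ∀ y, j ≤ y → y < j + m → (ω i y).1 = right := fun y h1 h2 => by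
    by_contra h
    refine Nat.find_min hex (m := (y - j).toNat) (by lia) ?_
    rwa [show j + ((y - j).toNat : ℤ) = y by lia]
  have hm0 : m ≠ 0 := by
    intro h0; rw [h0] at hne
    exact hne (by simpa using h)
  have hrt : (ω i (j + m)).1 = rt :=
    ((hω.ver' (i := i) (j := j + m - 1) (j' := j + m) (by lia)).2.2.2.2.2.2.1
      (hright _ (by lia) (by lia))).resolve_left hne
  obtain ⟨k, hk⟩ := exists_isTriangle_of_rt hω hf hrt
  refine ⟨j + m - k, k, hk, ?_, by lia⟩
  by_contra hlt
  have h1 := (right_bottom_of_isTriangle hω hf hk).2.1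
  rw [show i - k + k = i by lia, hright _ (by lia) (by have := hk.two_le; lia)] at h1
  cases h1

end

/-- `(i, j)` lies in the interior of the framed square with lower left corner `(a, b)` and
side length `k`. -/
def InSquare (ω : ℤ → ℤ → Lab) (i j a b k : ℤ) : Prop :=
  IsTriangle ω a b k ∧ a < i ∧ i < a + k ∧ b < j ∧ j < b + k

/-- `(i, j)` does not lie in the interior of a framed square. -/
def IsOuter (ω : ℤ → ℤ → Lab) (i j : ℤ) : Prop :=
  ∀ a b k, ¬ InSquare ω i j a b k

theorem eq_iff_even_succ {x y z : Bool} {n : ℕ} (h : x ≠ y) (ih : x = z ↔ Even n) :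
    y = z ↔ Even (n + 1) := by
  rw [Nat.even_add_one, ← ih]
  revert h; cases x <;> cases y <;> cases z <;> simp

theorem eq_iff_of_eq_iff {w x y z : Bool} {p q : Prop} (h1 : y = w ↔ p) (h2 : z = x ↔ p)
    (h3 : z = y ↔ q) : x = w ↔ q := by
  rw [← h3]
  have := h1.trans h2.symm
  revert this; cases w <;> cases x <;> cases y <;> cases z <;> simp

section

variable {ω : ℤ → ℤ → Lab} (hω : IsPlaneTiling ω) (hf : HasFiniteLines ω)
include hω hf

/-- Frames do not cross. The top of the second square cannot cross the right side of the first, so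
it passes above it. Then the left side of the second cannot cross the top of the first. -/
theorem InSquare.of_right {a b k j a' b' k' : ℤ} (hk : IsTriangle ω a b k) (h1 : b < j)
    (h2 : j < b + k) (h : InSquare ω (a + k) j a' b' k') : a' < a := by
  obtain ⟨hk', h3, h4, h5, h6⟩ := h
  have hR := (right_bottom_of_isTriangle hω hf hk).1
  have htop : b + k < b' + k' := by
    by_contra hcon
    have h7 := hk'.top (a + k) h3 h4
    rcases (not_lt.mp hcon).eq_or_lt with h | h
    · rw [h, hk.rt] at h7; cases h7
    · rw [hR _ (by lia) h] at h7; cases h7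
  by_contra hcon
  have h7 := hk'.left (b + k) (by lia) htop
  rcases (not_lt.mp hcon).eq_or_lt with h | h
  · rw [← h, hk.lt] at h7; cases h7
  · rw [hk.top _ h h3] at h7; cases h7

/-- If finitely many framed squares contain `(i, j)`, there is an outer point to the right. -/
theorem exists_isOuter {i j : ℤ}
    (hfin : {s : ℤ × ℤ × ℤ | InSquare ω i j s.1 s.2.1 s.2.2}.Finite) :
    ∃ m : ℕ, IsOuter ω (i + m) j := by
  by_cases h0 : IsOuter ω i j
  · exact ⟨0, by simpa using h0⟩
  obtain ⟨a, b, k, h⟩ : ∃ a b k, InSquare ω i j a b k := by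
    simpa [IsOuter] using h0
  -- Leave the largest square through its right side. A square around the exit point starts further
  -- left by `InSquare.of_right`, so it is larger and also contains `(i, j)`.
  obtain ⟨⟨a, b, k⟩, h, hmax⟩ := hfin.exists_maximalFor (fun s => s.2.2) _ ⟨(a, b, k), h⟩
  obtain ⟨hk, h1, h2, h3, h4⟩ := h
  refine ⟨(a + k - i).toNat, fun a' b' k' h' => ?_⟩
  rw [show i + ((a + k - i).toNat : ℤ) = a + k by lia] at h'
  have ha := InSquare.of_right hω hf hk h3 h4 h'
  have := hmax (j := (a', b', k'))
    ⟨h'.1, by lia, by have := h'.2.2.1; lia, h'.2.2.2.1, h'.2.2.2.2⟩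
  have h5 := h'.2.2.1
  have h6 := hk.two_le
  simp only at this
  lia

/-- The colours of consecutive outer points of a row are those of a chessboard. -/
theorem colour_of_isOuter {i j : ℤ} (h0 : IsOuter ω i j) {m : ℕ}
    (hm : IsOuter ω (i + 1 + m) j) (hmin : ∀ l : ℕ, l < m → ¬ IsOuter ω (i + 1 + l) j) :
    ((ω (i + 1 + m) j).2 = (ω i j).2) ↔ Odd m := by
  by_cases h1 : IsOuter ω (i + 1) j
  · have : m = 0 := by
      by_contra h
      exact hmin 0 (by lia) (by simpa using h1)
    subst this
    have h2 := (hω.hor i j).2.2.2.2.2.2.2.2.2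
    have h3 : (ω i j).1 ≠ left := fun h => by
      obtain ⟨b, k, hk, h3, h4⟩ := exists_isTriangle_of_left hω hf h
      exact h1 i b k ⟨hk, by lia, by have := hk.two_le; lia, h3, h4⟩
    have h4 : (ω (i + 1) j).1 ≠ right := fun h => by
      obtain ⟨b, k, hk, h3, h4⟩ := exists_isTriangle_of_right hω hf h
      exact h0 _ b k ⟨hk, by have := hk.two_le; lia, by lia, h3, h4⟩
    have h5 := (h2.resolve_left h3).resolve_left h4
    simpa using h5.symm
  -- Otherwise `(i, j)` is on the left side of a square, and the next outer point of the row is on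
  -- its right side.
  · obtain ⟨a, b, k, hk, h2, h3, h4, h5⟩ : ∃ a b k, InSquare ω (i + 1) j a b k := by
      simpa [IsOuter] using h1
    have hia : i = a := by
      by_contra h
      exact h0 a b k ⟨hk, by lia, by lia, h4, h5⟩
    subst hia
    have hout : IsOuter ω (i + k) j := fun a' b' k' h' => by
      have ha := InSquare.of_right hω hf hk h4 h5 h'
      exact h0 a' b' k' ⟨h'.1, ha, by have := h'.2.2.1; have := hk.two_le; lia,
        h'.2.2.2.1, h'.2.2.2.2⟩
    have hmk : (m : ℤ) + 1 = k := by
      rcases lt_trichotomy ((m : ℤ) + 1) k with h | h | h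
      · exact absurd ⟨hk, by lia, by lia, h4, h5⟩ (hm i b k)
      · exact h
      · refine absurd hout ?_
        have := hmin (k - 1).toNat (by have := hk.two_le; lia)
        rwa [show i + 1 + ((k - 1).toNat : ℤ) = i + k by have := hk.two_le; lia] at this
    have hR := (right_bottom_of_isTriangle hω hf hk).1
    -- The colours are compared around the frame: up the left side, along the top, down the right
    -- side. The two vertical stretches have equal length and cancel, which leaves the parity of
    -- `k`, that is of `m + 1`.
    have hleft : ∀ l : ℕ, j + l ≤ b + k → ((ω i (j + l)).2 = (ω i j).2 ↔ Even l) := by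
      intro l
      induction l with
      | zero => simp
      | succ l ih =>
        intro hl
        have h6 := (hω.ver' (i := i) (j := j + l) (j' := j + (l + 1 : ℕ)) (by lia)).2.2.2.2.2.2.2.2.2
          (Or.inl (hk.left _ (by lia) (by lia)))
        exact eq_iff_even_succ h6 (ih (by lia))
    have hright : ∀ l : ℕ, j + l ≤ b + k →
        ((ω (i + k) (j + l)).2 = (ω (i + k) j).2 ↔ Even l) := by
      intro l
      induction l with
      | zero => simp
      | succ l ih =>
        intro hl
        have h6 := (hω.ver' (i := i + k) (j := j + l) (j' := j + (l + 1 : ℕ))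
          (by lia)).2.2.2.2.2.2.2.2.2 (Or.inr (hR _ (by lia) (by lia)))
        exact eq_iff_even_succ h6 (ih (by lia))
    have htop : ∀ l : ℕ, l ≤ k → ((ω (i + l) (b + k)).2 = (ω i (b + k)).2 ↔ Even l) := by
      intro l
      induction l with
      | zero => simp
      | succ l ih =>
        intro hl
        have h6 := (hω.hor' (i := i + l) (i' := i + (l + 1 : ℕ)) (j := b + k)
          (by lia)).2.2.2.2.2.2.2.2.2
        have h7 : (ω (i + l) (b + k)).1 ≠ left := by
          rcases Nat.eq_zero_or_pos l with h | h
          · subst h; simp [hk.lt]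
          · rw [hk.top _ (by lia) (by lia)]; decide
        have h8 : (ω (i + (l + 1 : ℕ)) (b + k)).1 ≠ right := by
          rcases hl.eq_or_lt with h | h
          · rw [h, hk.rt]; decide
          · rw [hk.top _ (by lia) (by lia)]; decide
        exact eq_iff_even_succ ((h6.resolve_left h7).resolve_left h8) (ih (by lia))
    have e1 := hleft (b + k - j).toNat (by lia)
    have e2 := hright (b + k - j).toNat (by lia)
    have e3 := htop k.toNat (by lia)
    rw [show j + ((b + k - j).toNat : ℤ) = b + k by lia] at e1 e2
    rw [show i + (k.toNat : ℤ) = i + k by lia] at e3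
    rw [show i + 1 + (m : ℤ) = i + k by lia]
    have e4 : Even k.toNat ↔ Odd m := by
      rw [show k.toNat = m + 1 by lia, Nat.even_add_one, Nat.not_even_iff_odd]
    rw [← e4]
    exact eq_iff_of_eq_iff e1 e2 e3

end

end FramedSquares

/-! ### Measurable tilings of ergodic actions -/

namespace FramedSquares

open Tile

/-- The plane through a point of a `ℤ²`-action. -/
def plane {X : Type} [AddAction (ℤ × ℤ) X] (g : X → Lab) (x : X) (i j : ℤ) : Lab :=
  g (((i, j) : ℤ × ℤ) +ᵥ x)

section plane

variable {X : Type} [AddAction (ℤ × ℤ) X] (g : X → Lab)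

theorem plane_vadd (z : ℤ × ℤ) (x : X) (i j : ℤ) :
    plane g (z +ᵥ x) i j = plane g x (i + z.1) (j + z.2) := by
  simp only [plane, vadd_vadd, ← Prod.mk_add_mk]

theorem isTriangle_plane_vadd (z : ℤ × ℤ) (x : X) (a b k : ℤ) :
    IsTriangle (plane g (z +ᵥ x)) a b k ↔ IsTriangle (plane g x) (a + z.1) (b + z.2) k := by
  constructor
  · intro h
    obtain ⟨h1, h2, h3, h4, h5, h6, h7, h8⟩ := h
    simp only [plane_vadd] at h2 h3 h4 h5 h6 h7 h8
    refine ⟨h1, h2, ?_, ?_, fun j hj hj' => ?_, fun i hi hi' => ?_, fun i j h h' h'' => ?_,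
      fun i j h h' h'' => ?_⟩
    · rw [← h3]; congr 2; ring
    · rw [← h4]; congr 2 <;> ring
    · simpa using h5 (j - z.2) (by lia) (by lia)
    · simpa [add_right_comm] using h6 (i - z.1) (by lia) (by lia)
    · simpa using h7 (i - z.1) (j - z.2) (by lia) (by lia) (by lia)
    · simpa using h8 (i - z.1) (j - z.2) (by lia) (by lia) (by lia)
  · intro h
    obtain ⟨h1, h2, h3, h4, h5, h6, h7, h8⟩ := h
    refine ⟨h1, ?_, ?_, ?_, fun j hj hj' => ?_, fun i hi hi' => ?_, fun i j h h' h'' => ?_,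
      fun i j h h' h'' => ?_⟩ <;> simp only [plane_vadd]
    · exact h2
    · rw [← h3]; congr 2; ring
    · rw [← h4]; congr 2 <;> ring
    · exact h5 _ (by lia) (by lia)
    · rw [← h6 (i + z.1) (by lia) (by lia)]; congr 2; ring
    · exact h7 _ _ (by lia) (by lia) (by lia)
    · exact h8 _ _ (by lia) (by lia) (by lia)

theorem inSquare_plane_vadd (z : ℤ × ℤ) (x : X) (i j a b k : ℤ) :
    InSquare (plane g (z +ᵥ x)) i j a b k ↔
      InSquare (plane g x) (i + z.1) (j + z.2) (a + z.1) (b + z.2) k := by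
  simp only [InSquare, isTriangle_plane_vadd]
  refine and_congr_right fun _ => ?_
  constructor <;> rintro ⟨h1, h2, h3, h4⟩ <;> exact ⟨by lia, by lia, by lia, by lia⟩

theorem isOuter_plane_vadd (z : ℤ × ℤ) (x : X) (i j : ℤ) :
    IsOuter (plane g (z +ᵥ x)) i j ↔ IsOuter (plane g x) (i + z.1) (j + z.2) := by
  simp only [IsOuter, inSquare_plane_vadd]
  refine ⟨fun h a b k => ?_, fun h a b k => h _ _ _⟩
  simpa using h (a - z.1) (b - z.2) k

end plane

theorem measurable_iff_prop {X : Type} [MeasurableSpace X] {p q : X → Prop} (hp : Measurable p)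
    (hq : Measurable q) : Measurable fun x => (p x ↔ q x) := by
  simp only [iff_iff_implies_and_implies]
  exact (hp.imp hq).and (hq.imp hp)

section measure

variable {X : Type} [MeasurableSpace X] [AddAction (ℤ × ℤ) X] {g : X → Lab}

theorem measurable_tile_eq (hg : ∀ l, MeasurableSet (g ⁻¹' {l}))
    (hm : ∀ z : ℤ × ℤ, Measurable fun x : X => z +ᵥ x) (z : ℤ × ℤ) (t : Tile) :
    Measurable fun x => ((g (z +ᵥ x)).1 = t) := by
  refine measurableSet_setOfPred.mp (hm z ((?_ : MeasurableSet {x | (g x).1 = t})))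
  have : {x | (g x).1 = t} = g ⁻¹' {(t, true)} ∪ g ⁻¹' {(t, false)} := by
    ext x
    simp only [Set.mem_union, Set.mem_preimage, Set.mem_singleton_iff, Prod.ext_iff]
    change (g x).1 = t ↔ _
    cases (g x).2 <;> simp
  rw [this]
  exact (hg _).union (hg _)

theorem measurable_colour (hg : ∀ l, MeasurableSet (g ⁻¹' {l}))
    (hm : ∀ z : ℤ × ℤ, Measurable fun x : X => z +ᵥ x) (z : ℤ × ℤ) :
    Measurable fun x => ((g (z +ᵥ x)).2 = true) := by
  refine measurableSet_setOfPred.mp (hm z ((?_ : MeasurableSet {x | (g x).2 = true})))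
  have : {x | (g x).2 = true} = ⋃ t : Tile, g ⁻¹' {(t, true)} := by
    ext x
    simp only [Set.mem_iUnion, Set.mem_preimage, Set.mem_singleton_iff, Prod.ext_iff]
    change (g x).2 = true ↔ _
    simp
  rw [this]
  exact MeasurableSet.iUnion fun _ => hg _

theorem measurable_isTriangle (hg : ∀ l, MeasurableSet (g ⁻¹' {l}))
    (hm : ∀ z : ℤ × ℤ, Measurable fun x : X => z +ᵥ x) (a b k : ℤ) :
    Measurable fun x => IsTriangle (plane g x) a b k := by
  have h : ∀ i j t, Measurable fun x => ((plane g x i j).1 = t) := fun i j t =>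
    measurable_tile_eq hg hm _ t
  have : (fun x => IsTriangle (plane g x) a b k) = fun x => (2 ≤ k ∧ (plane g x a b).1 = lb ∧
      (plane g x a (b + k)).1 = lt ∧ (plane g x (a + k) (b + k)).1 = rt ∧
      (∀ j, b < j → j < b + k → (plane g x a j).1 = left) ∧
      (∀ i, a < i → i < a + k → (plane g x i (b + k)).1 = top) ∧
      (∀ i j, i - a = j - b → a < i → i < a + k → (plane g x i j).1 = diag) ∧
      (∀ i j, a < i → i - a < j - b → j < b + k → (plane g x i j).1 = upper)) := by
    funext x
    refine propext ⟨fun h => ⟨h.1, h.2, h.3, h.4, h.5, h.6, h.7, h.8⟩, fun h => ?_⟩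
    exact ⟨h.1, h.2.1, h.2.2.1, h.2.2.2.1, h.2.2.2.2.1, h.2.2.2.2.2.1, h.2.2.2.2.2.2.1,
      h.2.2.2.2.2.2.2⟩
  rw [this]
  refine measurable_const.and ((h _ _ _).and ((h _ _ _).and ((h _ _ _).and
    (Measurable.and ?_ (Measurable.and ?_ (Measurable.and ?_ ?_))))))
  · exact Measurable.forall fun j => measurable_const.imp (measurable_const.imp (h _ _ _))
  · exact Measurable.forall fun j => measurable_const.imp (measurable_const.imp (h _ _ _))
  · exact Measurable.forall fun i => Measurable.forall fun j => measurable_const.imp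
      (measurable_const.imp (measurable_const.imp (h _ _ _)))
  · exact Measurable.forall fun i => Measurable.forall fun j => measurable_const.imp
      (measurable_const.imp (measurable_const.imp (h _ _ _)))

theorem measurable_isOuter (hg : ∀ l, MeasurableSet (g ⁻¹' {l}))
    (hm : ∀ z : ℤ × ℤ, Measurable fun x : X => z +ᵥ x) :
    Measurable fun x => IsOuter (plane g x) 0 0 := by
  unfold IsOuter InSquare
  exact Measurable.forall fun a => Measurable.forall fun b => Measurable.forall fun k =>
    ((measurable_isTriangle hg hm a b k).and measurable_const).not

variable {μ : Measure X}

theorem ae_isPlaneTiling (hmp : ∀ z : ℤ × ℤ, MeasurePreserving (fun x : X => z +ᵥ x) μ μ)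
    (hrule : ∀ᵐ x ∂μ, IsTilingAt g x) : ∀ᵐ x ∂μ, IsPlaneTiling (plane g x) := by
  have h : ∀ᵐ x ∂μ, ∀ z : ℤ × ℤ, IsTilingAt g (z +ᵥ x) :=
    ae_all_iff.mpr fun z => (hmp z).quasiMeasurePreserving.ae hrule
  filter_upwards [h] with x hx
  refine ⟨fun i j => ?_, fun i j => ?_, fun i j => ?_⟩
  · simpa [plane, vadd_vadd, add_comm] using (hx (i, j)).1
  · simpa [plane, vadd_vadd, add_comm] using (hx (i, j)).2.1
  · simpa [plane, vadd_vadd, add_comm] using (hx (i, j)).2.2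

/-- By ergodicity there are no infinite lines with constant labels. -/
theorem ae_exists_tile_ne [IsProbabilityMeasure μ] (hg : ∀ l, MeasurableSet (g ⁻¹' {l}))
    (hmp : ∀ z : ℤ × ℤ, MeasurePreserving (fun x : X => z +ᵥ x) μ μ)
    (hrule : ∀ᵐ x ∂μ, IsTilingAt g x) {z : ℤ × ℤ} (hz : Ergodic (fun x : X => z +ᵥ x) μ)
    {t : Tile} (ht : t = left ∨ t = diag ∨ t = right) :
    ∀ᵐ x ∂μ, ∃ m : ℕ, (g ((m • z) +ᵥ x)).1 ≠ t := by
  set A : Set X := {x | ∀ m : ℕ, (g ((m • z) +ᵥ x)).1 = t} with hA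
  have hAm : MeasurableSet A := measurableSet_setOfPred.mpr
    (Measurable.forall fun m => measurable_tile_eq hg (fun z => (hmp z).measurable) _ t)
  -- An infinite ray stays infinite when its first point is dropped, so ergodicity makes `A` null or
  -- conull.
  have hsub : A ⊆ (fun x : X => z +ᵥ x) ⁻¹' A := fun x hx m => by
    have := hx (m + 1)
    rwa [succ_nsmul, ← vadd_vadd] at this
  rcases hz.ae_empty_or_univ_of_ae_le_preimage hAm.nullMeasurableSet hsub.eventuallyLE
    with h | h
  · have h0 : ∀ᵐ x ∂μ, x ∉ A := measure_eq_zero_iff_ae_notMem.mp (by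
      rw [measure_congr h, measure_empty])
    filter_upwards [h0] with x hx
    by_contra hcon
    exact hx fun m => by_contra fun h => hcon ⟨m, h⟩
  · exfalso
    have h0 : ∀ᵐ x ∂μ, (g x).1 = t := by
      filter_upwards [h] with x hx
      have hx' : x ∈ A := by
        have : A x = (Set.univ : Set X) x := hx
        exact this.mpr trivial
      simpa using hx' 0
    have h1 := (hmp (1, 0)).quasiMeasurePreserving.ae h0
    have h2 := (hmp (0, 1)).quasiMeasurePreserving.ae h0
    obtain ⟨x, hx, hx0, hx1, hx2⟩ := (hrule.and (h0.and (h1.and h2))).exists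
    -- In the conull case almost all points carry the tile `t`. But `left` beside `left`, `diag`
    -- above `diag` and `right` beside `right` are all forbidden.
    obtain ⟨⟨-, -, -, -, r1, -, -, -, r2, -⟩, ⟨-, -, -, -, r3, -⟩, -⟩ := hx
    rcases ht with rfl | rfl | rfl
    · have := r1 hx0; rw [hx1] at this; simp at this
    · have := r3 hx0; rw [hx2] at this; simp at this
    · exact r2 hx1 hx0

theorem ae_hasFiniteLines [IsProbabilityMeasure μ] (hg : ∀ l, MeasurableSet (g ⁻¹' {l}))
    (herg : ∀ z : ℤ × ℤ, z ≠ 0 → Ergodic (fun x : X => z +ᵥ x) μ)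
    (hmp : ∀ z : ℤ × ℤ, MeasurePreserving (fun x : X => z +ᵥ x) μ μ)
    (hrule : ∀ᵐ x ∂μ, IsTilingAt g x) : ∀ᵐ x ∂μ, HasFiniteLines (plane g x) := by
  have key : ∀ (z : ℤ × ℤ) (t : Tile), z ≠ 0 → (t = left ∨ t = diag ∨ t = right) →
      ∀ᵐ x ∂μ, ∀ w : ℤ × ℤ, ∃ m : ℕ, (g ((m • z) +ᵥ (w +ᵥ x))).1 ≠ t := fun z t hz ht =>
    ae_all_iff.mpr fun w => (hmp w).quasiMeasurePreserving.ae
      (ae_exists_tile_ne hg hmp hrule (herg z hz) ht)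
  filter_upwards [key (0, 1) left (by simp) (by simp), key (0, -1) left (by simp) (by simp),
    key (-1, -1) diag (by simp) (by simp), key (0, 1) right (by simp) (by simp)] with x h1 h2 h3 h4
  refine ⟨fun i j => ?_, fun i j => ?_, fun i j => ?_, fun i j => ?_⟩
  · simpa [plane, vadd_vadd, add_comm] using h1 (i, j)
  · simpa [plane, vadd_vadd, add_comm, sub_eq_add_neg] using h2 (i, j)
  · simpa [plane, vadd_vadd, add_comm, sub_eq_add_neg] using h3 (i, j)
  · simpa [plane, vadd_vadd, add_comm] using h4 (i, j)

end measure

/-- The regions above the diagonals of different framed squares are disjoint. -/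
theorem IsTriangle.eq_of_upper {ω : ℤ → ℤ → Lab} {a b k a' b' k' : ℤ} (h : IsTriangle ω a b k)
    (h' : IsTriangle ω a' b' k') (h1 : a < 0) (h2 : -a ≤ -b) (h3 : 0 < b + k)
    (h1' : a' < 0) (h2' : -a' ≤ -b') (h3' : 0 < b' + k') : a = a' ∧ b = b' ∧ k = k' := by
  -- If the second square began further right, its left side would meet row `0` inside the region
  -- above the diagonal of the first.
  have aux : ∀ {a b k a' b' k' : ℤ}, IsTriangle ω a b k → IsTriangle ω a' b' k' → -a ≤ -b →
      0 < b + k → a' < 0 → -a' ≤ -b' → 0 < b' + k' → ¬ a < a' := by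
    intro a b k a' b' k' h h' h2 h3 h1' h2' h3' hlt
    have e := h'.left 0 (by lia) h3'
    rw [h.upper a' 0 hlt (by lia) h3] at e
    cases e
  have ha : a = a' := by
    rcases lt_trichotomy a a' with hlt | heq | hlt
    · exact absurd hlt (aux h h' h2 h3 h1' h2' h3')
    · exact heq
    · exact absurd hlt (aux h' h h2' h3' h1 h2 h3)
  subst ha
  have hb : b = b' := by
    rcases lt_trichotomy b b' with hlt | heq | hlt
    · have e := h.left b' hlt (by lia)
      rw [h'.lb] at e; cases e
    · exact heq
    · have e := h'.left b hlt (by lia)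
      rw [h.lb] at e; cases e
  subst hb
  exact ⟨rfl, rfl, h.size_unique h'⟩

section measure

variable {X : Type} [MeasurableSpace X] [AddAction (ℤ × ℤ) X] {g : X → Lab}
variable {μ : Measure X} [IsProbabilityMeasure μ]

/-- Almost every point lies in only finitely many framed squares. -/
theorem ae_finite_inSquare (hg : ∀ l, MeasurableSet (g ⁻¹' {l}))
    (hmp : ∀ z : ℤ × ℤ, MeasurePreserving (fun x : X => z +ᵥ x) μ μ) :
    ∀ᵐ x ∂μ, {s : ℤ × ℤ × ℤ | InSquare (plane g x) 0 0 s.1 s.2.1 s.2.2}.Finite := by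
  have hm := measurable_isTriangle hg fun z => (hmp z).measurable
  -- `W s`: the origin is above or on the diagonal of the square `s`. `W' s`: the mirror image of
  -- this condition on the position, for the half below or on the diagonal.
  set W : ℤ × ℤ × ℤ → Set X := fun s =>
    {x | IsTriangle (plane g x) s.1 s.2.1 s.2.2 ∧ s.1 < 0 ∧ -s.1 ≤ -s.2.1 ∧ 0 < s.2.1 + s.2.2}
    with hW
  set W' : ℤ × ℤ × ℤ → Set X := fun s =>
    {x | IsTriangle (plane g x) s.1 s.2.1 s.2.2 ∧ s.2.1 < 0 ∧ -s.2.1 ≤ -s.1 ∧ 0 < s.1 + s.2.2}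
    with hW'
  have hWm : ∀ s, MeasurableSet (W s) := fun s =>
    measurableSet_setOfPred.mpr ((hm _ _ _).and measurable_const)
  have hsum : ∑' s, μ (W s) ≤ 1 := by
    rw [← measure_univ (μ := μ)]
    refine tsum_measure_le_measure_univ (fun s => (hWm s).nullMeasurableSet) fun s s' hs => ?_
    refine Disjoint.aedisjoint (Set.disjoint_left.mpr fun x hx hx' => hs ?_)
    obtain ⟨h, h1, h2, h3⟩ := hx
    obtain ⟨h', h1', h2', h3'⟩ := hx'
    obtain ⟨e1, e2, e3⟩ := h.eq_of_upper h' h1 h2 h3 h1' h2' h3'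
    exact Prod.ext e1 (Prod.ext e2 e3)
  have hmeas : ∀ a b k a' b', μ {x | IsTriangle (plane g x) a b k} =
      μ {x | IsTriangle (plane g x) a' b' k} := by
    intro a b k a' b'
    rw [← (hmp (a - a', b - b')).measure_preimage
      (measurableSet_setOfPred.mpr (hm a' b' k)).nullMeasurableSet]
    congr 1
    ext x
    change _ ↔ IsTriangle (plane g (_ +ᵥ x)) a' b' k
    rw [isTriangle_plane_vadd]
    simp
  -- The sets `W' s` may overlap, as lower halves contain further squares. However, the probability
  -- of a square at a given place depends only on its size, so exchanging the coordinates of the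
  -- corner turns this sum into the previous one.
  have hsum' : ∑' s, μ (W' s) ≤ 1 := by
    let e : ℤ × ℤ × ℤ ≃ ℤ × ℤ × ℤ :=
      ⟨fun s => (s.2.1, s.1, s.2.2), fun s => (s.2.1, s.1, s.2.2), fun _ => rfl, fun _ => rfl⟩
    refine le_trans (le_of_eq ?_) hsum
    rw [← e.tsum_eq fun s => μ (W s)]
    refine tsum_congr fun s => ?_
    by_cases hs : s.2.1 < 0 ∧ -s.2.1 ≤ -s.1 ∧ 0 < s.1 + s.2.2
    · have h1 : W' s = {x | IsTriangle (plane g x) s.1 s.2.1 s.2.2} := by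
        ext x; exact and_iff_left hs
      have h2 : W (e s) = {x | IsTriangle (plane g x) s.2.1 s.1 s.2.2} := by
        ext x; exact and_iff_left hs
      rw [h1, h2]; exact hmeas _ _ _ _ _
    · have h1 : W' s = ∅ := Set.eq_empty_of_forall_notMem fun x hx => hs hx.2
      have h2 : W (e s) = ∅ := Set.eq_empty_of_forall_notMem fun x hx => hs hx.2
      rw [h1, h2]
  filter_upwards [ae_finite_setOfPred_mem (ne_top_of_le_ne_top ENNReal.one_ne_top hsum),
    ae_finite_setOfPred_mem (ne_top_of_le_ne_top ENNReal.one_ne_top hsum')] with x h1 h2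
  refine (h1.union h2).subset ?_
  rintro ⟨a, b, k⟩ ⟨h, h3, h4, h5, h6⟩
  rcases le_total (-a) (-b) with hab | hab
  · exact Or.inl ⟨h, h3, hab, h6⟩
  · exact Or.inr ⟨h, h5, hab, h4⟩

/-- There is no measurable tiling of a probability measure preserving `ℤ²`-action all of whose
nonzero elements act ergodically. -/
theorem not_ae_isTilingAt (hg : ∀ l, MeasurableSet (g ⁻¹' {l}))
    (herg : ∀ z : ℤ × ℤ, z ≠ 0 → Ergodic (fun x : X => z +ᵥ x) μ)
    (hmp : ∀ z : ℤ × ℤ, MeasurePreserving (fun x : X => z +ᵥ x) μ μ)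
    (hrule : ∀ᵐ x ∂μ, IsTilingAt g x) : False := by
  have hmeas : ∀ z : ℤ × ℤ, Measurable fun x : X => z +ᵥ x := fun z => (hmp z).measurable
  -- `D m x` says that `m` is the distance to the first outer point to the right, `x` itself
  -- included. `A` then records the parity of the chessboard of outer points as seen from `x`.
  set D : ℕ → X → Prop := fun m x => IsOuter (plane g x) m 0 ∧
    ∀ l : ℕ, l < m → ¬ IsOuter (plane g x) l 0 with hD
  set A : Set X := {x | ∃ m : ℕ, D m x ∧ ((plane g x m 0).2 = true ↔ Even m)} with hA
  have hout : ∀ m : ℕ, Measurable fun x => IsOuter (plane g x) m 0 := fun m => by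
    have := (measurable_isOuter hg hmeas).comp (hmeas ((m : ℤ), 0))
    have h2 : (fun x => IsOuter (plane g x) m 0) =
        (fun x => IsOuter (plane g x) 0 0) ∘ fun x => ((m : ℤ), (0 : ℤ)) +ᵥ x := by
      funext x; simp [Function.comp, isOuter_plane_vadd]
    rwa [h2]
  have hAm : MeasurableSet A := measurableSet_setOfPred.mpr <| Measurable.exists fun m =>
    ((hout m).and (Measurable.forall fun l => measurable_const.imp (hout l).not)).and
      (measurable_iff_prop (measurable_colour hg hmeas _) measurable_const)
  have hgood := (ae_isPlaneTiling hmp hrule).and ((ae_hasFiniteLines hg herg hmp hrule).and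
    (ae_finite_inSquare hg hmp))
  have hflip : ∀ᵐ x ∂μ, (((1, 0) : ℤ × ℤ) +ᵥ x ∈ A ↔ x ∉ A) := by
    filter_upwards [hgood, (hmp (1, 0)).quasiMeasurePreserving.ae hgood]
      with x ⟨hx1, hx2, hx3⟩ ⟨hy1, hy2, hy3⟩
    classical
    obtain ⟨m, hm⟩ : ∃ m, D m (((1, 0) : ℤ × ℤ) +ᵥ x) := by
      have hex := exists_isOuter hy1 hy2 hy3
      simp only [zero_add] at hex
      exact ⟨Nat.find hex, Nat.find_spec hex, fun l hl => Nat.find_min hex hl⟩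
    have hA' : ∀ {m : ℕ} {y : X}, D m y → (y ∈ A ↔ ((plane g y m 0).2 = true ↔ Even m)) := by
      intro m y hm
      refine ⟨fun ⟨m', h1, h2⟩ => ?_, fun h => ⟨m, hm, h⟩⟩
      have : m = m' := by
        rcases lt_trichotomy m m' with h | h | h
        · exact absurd hm.1 (h1.2 _ h)
        · exact h
        · exact absurd h1.1 (hm.2 _ h)
      rwa [this]
    have hmx : IsOuter (plane g x) (0 + 1 + m) 0 ∧
        ∀ l : ℕ, l < m → ¬ IsOuter (plane g x) (0 + 1 + l) 0 := by
      obtain ⟨h1, h2⟩ := hm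
      simp only [isOuter_plane_vadd] at h1 h2
      refine ⟨by simpa [add_comm] using h1, fun l hl => by simpa [add_comm] using h2 l hl⟩
    rw [hA' hm, plane_vadd]
    simp only [add_zero]
    rw [show ((m : ℤ) + 1) = 0 + 1 + m by ring]
    -- If `x` is outer, the next outer point continues its chessboard. If not, `x` and its right
    -- neighbour use the same outer point, at distances that differ by one.
    by_cases h0 : IsOuter (plane g x) 0 0
    · have hc := colour_of_isOuter hx1 hx2 h0 hmx.1 hmx.2
      have hD0 : D 0 x := ⟨by simpa using h0, fun l hl => absurd hl (by lia)⟩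
      rw [hA' hD0]
      simp only [Nat.cast_zero, Even.zero, iff_true]
      rw [← Nat.not_even_iff_odd] at hc
      revert hc
      by_cases he : Even m <;> simp only [he] <;>
        cases (plane g x (0 + 1 + m) 0).2 <;> cases (plane g x 0 0).2 <;> simp
    · have hD0 : D (m + 1) x := by
        refine ⟨by simpa [add_comm] using hmx.1, fun l hl => ?_⟩
        rcases Nat.eq_zero_or_pos l with h | h
        · subst h; simpa using h0
        · have := hmx.2 (l - 1) (by lia)
          rwa [show (0 : ℤ) + 1 + ((l - 1 : ℕ) : ℤ) = l by lia] at this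
      rw [hA' hD0, Nat.even_add_one, show ((m + 1 : ℕ) : ℤ) = 0 + 1 + m by lia]
      tauto
  have h2 : (fun x : X => ((2, 0) : ℤ × ℤ) +ᵥ x) ⁻¹' A ≤ᵐ[μ] A := by
    filter_upwards [hflip, (hmp (1, 0)).quasiMeasurePreserving.ae hflip] with x h1 h2 h3
    have h4 : ((2, 0) : ℤ × ℤ) +ᵥ x ∈ A := h3
    rw [vadd_vadd] at h2
    have h5 := h2.mp h4
    by_contra h6
    exact h5 (h1.mpr h6)
  -- This gives `A` measure one half, although it is invariant under `(2, 0)`.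
  have h3 : μ A = μ Aᶜ := by
    rw [← (hmp (1, 0)).measure_preimage hAm.nullMeasurableSet]
    refine measure_congr ?_
    filter_upwards [hflip] with x hx
    exact propext hx
  rcases (herg (2, 0) (by simp)).ae_empty_or_univ_of_preimage_ae_le hAm.nullMeasurableSet h2
    with h | h
  · have h4 : μ A = 0 := by rw [measure_congr h, measure_empty]
    have h5 := prob_compl_eq_one_sub (μ := μ) hAm
    rw [← h3, h4] at h5
    simp at h5
  · have h4 : μ A = 1 := by rw [measure_congr h, measure_univ]
    have h5 := prob_compl_eq_one_sub (μ := μ) hAm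
    rw [← h3, h4] at h5
    simp at h5

end measure

end FramedSquares

/-! ### Ergodicity of the i.i.d. shift, and failure in `FIID` and `MEASURE` -/

namespace FramedSquares

section shift

variable {Γ I : Type} [AddGroup Γ]

theorem shift_nsmul (γ : Γ) (m : ℕ) : (shift (m • γ) : (Γ → I) → Γ → I) = (shift γ)^[m] := by
  induction m with
  | zero => funext x; simp [shift_zero]
  | succ m ih => funext x; rw [Function.iterate_succ_apply', ← ih, succ_nsmul', shift_add]

variable [MeasurableSpace I]

theorem measurable_shift (γ : Γ) : Measurable (shift γ : (Γ → I) → Γ → I) :=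
  measurable_pi_lambda _ fun δ => measurable_pi_apply (δ + γ)

variable (ν : Measure I) [IsProbabilityMeasure ν]

theorem measurePreserving_shift (γ : Γ) : MeasurePreserving (shift γ)
    (Measure.infinitePi fun _ : Γ => ν) (Measure.infinitePi fun _ : Γ => ν) :=
  ⟨measurable_shift γ, Measure.map_infinitePi_infinitePi_of_inj (P := fun _ : Γ => ν)
    (f := fun δ => δ + γ) (add_left_injective γ)⟩

/-- A cylinder set is independent of its translates by large multiples of an element of infinite
order. -/
theorem exists_measure_inter_shift_eq {γ : Γ} (hγ : ∀ m : ℕ, m ≠ 0 → m • γ ≠ 0)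
    {C : Set (Γ → I)} (hC : C ∈ measurableCylinders fun _ : Γ => I) :
    ∃ m : ℕ, (Measure.infinitePi fun _ : Γ => ν) (C ∩ shift (m • γ) ⁻¹' C) =
      (Measure.infinitePi fun _ : Γ => ν) C * (Measure.infinitePi fun _ : Γ => ν) C := by
  classical
  obtain ⟨F, B, hB, rfl⟩ := (mem_measurableCylinders C).mp hC
  -- Pigeonhole: each bad `m` gives a pair in `F × F`, and two values of `m` with the same pair
  -- would make a nonzero multiple of `γ` vanish.
  obtain ⟨m, hm⟩ : ∃ m : ℕ, Disjoint F (F.image fun δ => δ + m • γ) := by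
    by_contra hcon
    push Not at hcon
    have h : ∀ m : ℕ, ∃ p : F × F, (p.1 : Γ) = p.2 + m • γ := fun m => by
      obtain ⟨a, ha, ha'⟩ := Finset.not_disjoint_iff.mp (hcon m)
      obtain ⟨b, hb, rfl⟩ := Finset.mem_image.mp ha'
      exact ⟨(⟨_, ha⟩, ⟨b, hb⟩), rfl⟩
    choose p hp using h
    refine not_injective_infinite_finite p fun k l hkl => ?_
    have h1 : k • γ = l • γ := by
      have := hp k
      rw [hkl, hp l] at this
      exact (add_left_cancel this).symm
    by_contra hne
    rcases lt_or_gt_of_ne hne with hlt | hlt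
    · refine hγ (l - k) (by lia) ?_
      have : (l - k) • γ + k • γ = 0 + k • γ := by
        rw [← add_nsmul, Nat.sub_add_cancel hlt.le, zero_add, h1]
      exact add_right_cancel this
    · refine hγ (k - l) (by lia) ?_
      have : (k - l) • γ + l • γ = 0 + l • γ := by
        rw [← add_nsmul, Nat.sub_add_cancel hlt.le, zero_add, h1]
      exact add_right_cancel this
  refine ⟨m, ?_⟩
  have hind : ProbabilityTheory.iIndepFun (fun i (ω : Γ → I) => ω i)
      (Measure.infinitePi fun _ : Γ => ν) :=
    ProbabilityTheory.iIndepFun_infinitePi (X := fun _ ω => ω) fun _ => measurable_id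
  have hind2 := hind.indepFun_finset F (F.image fun δ => δ + m • γ) hm
    fun i => measurable_pi_apply i
  let φ : ((F.image fun δ => δ + m • γ : Finset Γ) → I) → F → I := fun y δ =>
    y ⟨δ + m • γ, Finset.mem_image_of_mem _ δ.2⟩
  have hφ : Measurable φ := measurable_pi_lambda _ fun δ => measurable_pi_apply _
  have h := hind2.measure_inter_preimage_eq_mul B (φ ⁻¹' B) hB (hφ hB)
  have e1 : (fun (a : Γ → I) (i : F) => a i) ⁻¹' B = cylinder F B := rfl
  have e2 : (fun (a : Γ → I) (i : (F.image fun δ => δ + m • γ : Finset Γ)) => a i) ⁻¹' (φ ⁻¹' B) =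
      shift (m • γ) ⁻¹' (cylinder F B) := rfl
  rw [e1, e2, (measurePreserving_shift ν (m • γ)).measure_preimage hB.cylinder.nullMeasurableSet]
    at h
  exact h

/-- The mixing argument: a cylinder `C` close to `A` is independent of some translate of itself,
while invariance makes the translate close to `A` too. In the limit the measure of `A` equals its
own square. -/
theorem measure_zero_or_one_of_shift_invariant {γ : Γ} (hγ : ∀ m : ℕ, m ≠ 0 → m • γ ≠ 0)
    {A : Set (Γ → I)} (hA : MeasurableSet A) (hinv : shift γ ⁻¹' A = A) :
    (Measure.infinitePi fun _ : Γ => ν) A = 0 ∨ (Measure.infinitePi fun _ : Γ => ν) A = 1 := by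
  set μ := Measure.infinitePi fun _ : Γ => ν with hμ
  have hinv' : ∀ m : ℕ, shift (m • γ) ⁻¹' A = A := fun m => by
    rw [shift_nsmul]
    induction m with
    | zero => rfl
    | succ m ih => rw [Function.iterate_succ', Set.preimage_comp, hinv, ih]
  -- Passing from `A` to the intersection of `C` with its translate costs `2 * ε`; replacing the
  -- squared measure of `C` by that of `A` costs another `2 * ε`.
  have key : ∀ ε : ℝ, 0 < ε → |μ.real A - μ.real A * μ.real A| ≤ 4 * ε := by
    intro ε hε
    obtain ⟨C, hC, hlt⟩ := exists_measure_symmDiff_lt_of_generateFrom_isSetRing (μ := μ)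
      isSetRing_measurableCylinders ⟨{Set.univ}, Set.countable_singleton _, by
        simpa using univ_mem_measurableCylinders (fun _ : Γ => I), by simp⟩
      generateFrom_measurableCylinders.symm hA (ε := ENNReal.ofReal ε) (by simpa using hε)
    obtain ⟨m, hm⟩ := exists_measure_inter_shift_eq ν hγ hC
    have hCm : MeasurableSet C := MeasurableSet.of_mem_measurableCylinders hC
    have hlt' : μ.real (symmDiff C A) ≤ ε := ENNReal.toReal_le_of_le_ofReal hε.le hlt.le
    have h1 : |μ.real C - μ.real A| ≤ ε :=
      (abs_measureReal_sub_le_measureReal_symmDiff hCm.nullMeasurableSet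
        hA.nullMeasurableSet).trans hlt'
    have hm' : μ.real (C ∩ shift (m • γ) ⁻¹' C) = μ.real C * μ.real C := by
      simp only [Measure.real, ← ENNReal.toReal_mul]
      exact congrArg _ hm
    have hsub : symmDiff (C ∩ shift (m • γ) ⁻¹' C) A ⊆
        symmDiff C A ∪ shift (m • γ) ⁻¹' (symmDiff C A) := by
      intro x hx
      have h2 : x ∈ A ↔ shift (m • γ) x ∈ A := by
        conv_lhs => rw [← hinv' m]
        rfl
      simp only [Set.mem_symmDiff, Set.mem_inter_iff, Set.mem_preimage, Set.mem_union] at hx ⊢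
      tauto
    have h2 : μ.real (symmDiff (C ∩ shift (m • γ) ⁻¹' C) A) ≤ ε + ε := by
      refine (measureReal_mono hsub).trans ((measureReal_union_le _ _).trans ?_)
      refine add_le_add hlt' (le_of_eq_of_le ?_ hlt')
      simp only [Measure.real]
      rw [(measurePreserving_shift ν (m • γ)).measure_preimage
        (hCm.symmDiff hA).nullMeasurableSet]
    have h3 := (abs_measureReal_sub_le_measureReal_symmDiff (μ := μ)
      (hCm.inter (measurable_shift _ hCm)).nullMeasurableSet hA.nullMeasurableSet).trans h2
    rw [hm'] at h3
    have hA1 : μ.real A ≤ 1 := measureReal_le_one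
    have hC1 : μ.real C ≤ 1 := measureReal_le_one
    have hA0 : 0 ≤ μ.real A := measureReal_nonneg
    have hC0 : 0 ≤ μ.real C := measureReal_nonneg
    rw [abs_le] at h1 h3 ⊢
    constructor <;> nlinarith
  have h0 : μ.real A - μ.real A * μ.real A = 0 := by
    refine abs_eq_zero.mp (le_antisymm (le_of_forall_pos_le_add fun ε hε => ?_) (abs_nonneg _))
    have := key (ε / 4) (by positivity)
    linarith
  have h1 : μ.real A * (1 - μ.real A) = 0 := by linarith
  rcases mul_eq_zero.mp h1 with h | h
  · left
    exact (measureReal_eq_zero_iff (measure_ne_top _ _)).mp h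
  · right
    rw [← ENNReal.toReal_eq_one_iff]
    exact (sub_eq_zero.mp h).symm

end shift

section vadd

variable {Γ : Type} [AddGroup Γ]

theorem image_val_preimage_vadd (γ : Γ) (s : Set (FreePart unitInterval Γ)) :
    (Subtype.val '' ((fun x => γ +ᵥ x) ⁻¹' s) : Set (Γ → unitInterval)) =
      shift γ ⁻¹' (Subtype.val '' s) := by
  ext x
  constructor
  · rintro ⟨y, hy, rfl⟩
    exact ⟨γ +ᵥ y, hy, rfl⟩
  · rintro ⟨y, hy, hyx⟩
    refine ⟨-γ +ᵥ y, ?_, ?_⟩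
    · change γ +ᵥ (-γ +ᵥ y) ∈ s
      rwa [vadd_neg_vadd]
    · change shift (-γ) y.1 = x
      rw [hyx, ← shift_add, neg_add_cancel, shift_zero]

theorem measurable_vadd_freePart (γ : Γ) :
    Measurable fun x : FreePart unitInterval Γ => γ +ᵥ x :=
  ((measurable_shift γ).comp measurable_subtype_coe).subtype_mk

end vadd

section iid

variable {Γ : Type} [AddGroup Γ] [Countable Γ]

theorem measurableSet_freePart : MeasurableSet (FreePart unitInterval Γ) := by
  have : FreePart unitInterval Γ = ⋂ γ : Γ, {x | γ ≠ 0 → shift γ x ≠ x} := by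
    ext x
    simp only [Set.mem_iInter]
    rfl
  rw [this]
  refine MeasurableSet.iInter fun γ => measurableSet_setOfPred.mpr (measurable_const.imp ?_)
  exact (measurableSet_setOfPred.mp (measurableSet_eq_fun (measurable_shift γ) measurable_id)).not

theorem volume_unitInterval_singleton (a : unitInterval) :
    (volume : Measure unitInterval) {a} = 0 := by
  rw [unitInterval.volume_apply]
  simp

/-- A point with a period `γ ≠ 0` has equal values at `γ` and `0`. These are independent coordinates
with an atomless law, and there are only countably many `γ`. -/
theorem measure_compl_freePart : (Measure.infinitePi fun _ : Γ => (volume : Measure unitInterval))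
    (FreePart unitInterval Γ)ᶜ = 0 := by
  have hsub : (FreePart unitInterval Γ)ᶜ ⊆
      ⋃ γ : {γ : Γ // γ ≠ 0}, (fun x : Γ → unitInterval => (x γ, x 0)) ⁻¹' {p | p.1 = p.2} := by
    intro x hx
    have hx' : ¬ ∀ γ : Γ, γ ≠ 0 → shift γ x ≠ x := hx
    push Not at hx'
    obtain ⟨γ, h0, h⟩ := hx'
    refine Set.mem_iUnion.mpr ⟨⟨γ, h0⟩, ?_⟩
    change x γ = x 0
    have := congrFun h 0
    rwa [shift, zero_add] at this
  refine measure_mono_null hsub (measure_iUnion_null fun γ => ?_)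
  have hd : MeasurableSet {p : unitInterval × unitInterval | p.1 = p.2} :=
    measurableSet_eq_fun measurable_fst measurable_snd
  rw [← Measure.map_apply (by fun_prop) hd,
    Measure.infinitePi_map_eval_prod (P := fun _ : Γ => (volume : Measure unitInterval)) γ.2,
    Measure.measure_prod_null hd]
  refine Filter.Eventually.of_forall fun a => ?_
  refine measure_mono_null (fun b hb => ?_) (volume_unitInterval_singleton a)
  exact Eq.symm hb

theorem measurableEmbedding_freePart :
    MeasurableEmbedding (Subtype.val : FreePart unitInterval Γ → Γ → unitInterval) :=
  MeasurableEmbedding.subtype_coe measurableSet_freePart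

theorem iidMeasure_apply (s : Set (FreePart unitInterval Γ)) : iidMeasure Γ s =
    (Measure.infinitePi fun _ : Γ => (volume : Measure unitInterval)) (Subtype.val '' s) :=
  measurableEmbedding_freePart.comap_apply _ s

instance : IsProbabilityMeasure (iidMeasure Γ) := by
  constructor
  rw [iidMeasure_apply, Set.image_univ, Subtype.range_coe]
  have h := prob_compl_eq_zero_iff (μ := Measure.infinitePi fun _ : Γ =>
    (volume : Measure unitInterval)) (measurableSet_freePart (Γ := Γ))
  exact h.mp measure_compl_freePart

theorem measurePreserving_vadd_freePart (γ : Γ) :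
    MeasurePreserving (fun x : FreePart unitInterval Γ => γ +ᵥ x) (iidMeasure Γ) (iidMeasure Γ) := by
  refine ⟨measurable_vadd_freePart γ, ?_⟩
  ext s hs
  rw [Measure.map_apply (measurable_vadd_freePart γ) hs, iidMeasure_apply, iidMeasure_apply,
    image_val_preimage_vadd, (measurePreserving_shift _ γ).measure_preimage
      (measurableEmbedding_freePart.measurableSet_image.mpr hs).nullMeasurableSet]

theorem ergodic_vadd_freePart {γ : Γ} (hγ : ∀ m : ℕ, m ≠ 0 → m • γ ≠ 0) :
    Ergodic (fun x : FreePart unitInterval Γ => γ +ᵥ x) (iidMeasure Γ) := by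
  refine ⟨measurePreserving_vadd_freePart γ, ⟨fun s hs hinv => ?_⟩⟩
  have h := measure_zero_or_one_of_shift_invariant volume hγ
    (measurableEmbedding_freePart.measurableSet_image.mpr hs)
    (by rw [← image_val_preimage_vadd, hinv])
  rw [← iidMeasure_apply] at h
  rw [Filter.eventuallyConst_set']
  rcases h with h | h
  · left
    exact ae_eq_empty.mpr h
  · right
    exact ae_eq_univ.mpr ((prob_compl_eq_zero_iff hs).mpr h)

/-- The Borel modification obeys the local rules only almost everywhere, which is why the
impossibility result is stated for almost every point. -/
theorem exists_measurable_ae_eq {X : Type} [MeasurableSpace X] {μ : Measure X} {f : X → Lab}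
    (hf : IsMeasurableLabeling μ f) :
    ∃ g : X → Lab, (∀ l, MeasurableSet (g ⁻¹' {l})) ∧ f =ᵐ[μ] g := by
  let _ : MeasurableSpace Lab := ⊤
  have hn : NullMeasurable f μ := fun s _ => by
    have : f ⁻¹' s = ⋃ l ∈ s, f ⁻¹' {l} := by
      rw [← Set.preimage_iUnion₂]; simp
    rw [this]
    exact NullMeasurableSet.biUnion (Set.to_countable _) fun l _ => hf l
  obtain ⟨g, hg, hfg⟩ := hn.aemeasurable
  exact ⟨g, fun l => hg trivial, hfg⟩

variable {e : ℤ × ℤ →+ Γ}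

theorem tilingLCL_notMem_FIID (he : Function.Injective e) : tilingLCL e ∉ FIID Γ := by
  rintro ⟨f, hf, hsol⟩
  change FreePart unitInterval Γ → Lab at f
  replace hsol := (isSolution_tilingLCL_iff e f).mp hsol
  obtain ⟨g, hg, hfg⟩ := exists_measurable_ae_eq hf
  let _ : AddAction (ℤ × ℤ) (FreePart unitInterval Γ) := AddAction.compHom _ e
  have hmp : ∀ z : ℤ × ℤ, MeasurePreserving (fun x : FreePart unitInterval Γ => z +ᵥ x)
      (iidMeasure Γ) (iidMeasure Γ) := fun z => measurePreserving_vadd_freePart (e z)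
  refine not_ae_isTilingAt (μ := iidMeasure Γ) hg (fun z hz => ?_) hmp ?_
  · refine ergodic_vadd_freePart (γ := e z) fun m hm h0 => ?_
    rw [← map_nsmul, map_eq_zero_iff e he, smul_eq_zero] at h0
    exact h0.elim hm hz
  · filter_upwards [hfg, (hmp (1, 0)).quasiMeasurePreserving.ae hfg,
      (hmp (0, 1)).quasiMeasurePreserving.ae hfg, (hmp (1, 1)).quasiMeasurePreserving.ae hfg]
      with x h1 h2 h3 h4
    have := hsol x
    unfold IsTilingAt
    rw [← h1, ← h2, ← h3, ← h4]
    exact this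

theorem notMem_MEASURE_of_notMem_FIID {P : LCL Γ} (hP : P ∉ FIID Γ) : P ∉ MEASURE Γ := by
  intro h
  have : StandardBorelSpace (FreePart unitInterval Γ) := measurableSet_freePart.standardBorel
  obtain ⟨f, hf⟩ := h (FreePart unitInterval Γ) (iidMeasure Γ) measurable_vadd_freePart
    fun γ hγ x hx => x.2 γ hγ (congrArg Subtype.val hx)
  exact hP ⟨f, hf⟩

end iid

end FramedSquares

/-! ### Filling a framed square in the plane -/

namespace FramedSquares

open Tile

/-- The colour of a chessboard. -/
def chess (p i j : ℕ) : Bool := decide ((i + j + p) % 2 = 0)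

theorem chess_ne_right (p i j : ℕ) : chess p i j ≠ chess p (i + 1) j := by
  unfold chess
  rcases Nat.mod_two_eq_zero_or_one (i + j + p) with h | h
  · rw [h, show (i + 1 + j + p) % 2 = 1 by lia]; decide
  · rw [h, show (i + 1 + j + p) % 2 = 0 by lia]; decide

theorem chess_ne_up (p i j : ℕ) : chess p i j ≠ chess p i (j + 1) := by
  have := chess_ne_right p i j
  unfold chess at *
  rwa [show i + (j + 1) + p = i + 1 + j + p by ring]

/-- The shape of the boundary points of the square `[1, m]²`. -/
def frameTile (m i j : ℕ) : Tile :=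
  if i = 1 then (if j = 1 then lb else if j = m then lt else left)
  else if i = m then (if j = 1 then rb else if j = m then rt else right)
  else if j = 1 then bottom else top

/-- The plane with a framed square at `[1, m]²` whose interior is filled by `u`, and plain
chessboard labels of parity `p` outside. -/
def square (m : ℕ) (u : ℕ → ℕ → Lab) (p i j : ℕ) : Lab :=
  if i < 1 ∨ j < 1 ∨ m < i ∨ m < j then (plain, chess p i j)
  else if i = 1 ∨ j = 1 ∨ i = m ∨ j = m then (frameTile m i j, chess p i j)
  else u i j

/-- All local constraints at the point `(i, j)`. -/
def RelAt (u : ℕ → ℕ → Lab) (i j : ℕ) : Prop :=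
  HRel (u i j) (u (i + 1) j) ∧ VRel (u i j) (u i (j + 1)) ∧ DRel (u i j) (u (i + 1) (j + 1))

/-- `u` is an admissible filling of the framed square at `[1, m]²`. -/
def Valid (m : ℕ) (u : ℕ → ℕ → Lab) : Prop :=
  3 ≤ m ∧ ∀ p < 2, ∀ i < m + 1, ∀ j < m + 1, RelAt (square m u p) i j

theorem chess_mod (p i j : ℕ) : chess (p % 2) i j = chess p i j := by
  unfold chess
  congr 2
  lia

theorem square_mod (m : ℕ) (u : ℕ → ℕ → Lab) (p : ℕ) : square m u (p % 2) = square m u p := by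
  funext i j
  simp only [square, chess_mod]

theorem hRel_plain {c d : Bool} (h : c ≠ d) : HRel (plain, c) (plain, d) := by
  simp [HRel, h]

theorem vRel_plain {c d : Bool} : VRel (plain, c) (plain, d) := by
  simp [VRel]

theorem dRel_plain {c d : Bool} : DRel (plain, c) (plain, d) := by
  simp [DRel]

/-- `Valid` is a finite check. It suffices because only the parity of `p` matters and all
constraints beyond row or column `m` concern plain chessboard points. -/
theorem Valid.relAt {m : ℕ} {u : ℕ → ℕ → Lab} (h : Valid m u) (p i j : ℕ) :
    RelAt (square m u p) i j := by
  by_cases hij : i < m + 1 ∧ j < m + 1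
  · rw [← square_mod]
    exact h.2 _ (Nat.mod_lt _ (by lia)) i hij.1 j hij.2
  · have h1 : ∀ i' j', m < i' ∨ m < j' → square m u p i' j' = (plain, chess p i' j') :=
      fun i' j' h' => if_pos (by lia)
    refine ⟨?_, ?_, ?_⟩
    · rw [h1 _ _ (by lia), h1 _ _ (by lia)]
      exact hRel_plain (chess_ne_right _ _ _)
    · rw [h1 _ _ (by lia), h1 _ _ (by lia)]
      exact vRel_plain
    · rw [h1 _ _ (by lia), h1 _ _ (by lia)]
      exact dRel_plain

/-- The filling of a framed square without inner squares. -/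
def emptyFilling (i j : ℕ) : Lab :=
  (if i = j then diag else if i < j then upper else plain, chess 0 i j)

theorem square_emptyFilling_fst (m p i j : ℕ) : (square m emptyFilling p i j).1 =
    if i < 1 ∨ j < 1 ∨ m < i ∨ m < j then plain
    else if i = 1 ∨ j = 1 ∨ i = m ∨ j = m then frameTile m i j
    else if i = j then diag else if i < j then upper else plain := by
  unfold square emptyFilling
  split_ifs <;> rfl

theorem square_emptyFilling_snd (m p i j : ℕ) : (square m emptyFilling p i j).2 =
    if (1 < i ∧ 1 < j ∧ i < m ∧ j < m) then chess 0 i j else chess p i j := by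
  unfold square emptyFilling
  split_ifs <;> first | rfl | lia

/-- Turns the shape rules for the empty square into linear arithmetic on coordinates. -/
theorem square_emptyFilling_fst_eq_iff {m : ℕ} (hm : 3 ≤ m) (p i j : ℕ) :
    ((square m emptyFilling p i j).1 = lb ↔ i = 1 ∧ j = 1) ∧
    ((square m emptyFilling p i j).1 = left ↔ i = 1 ∧ 1 < j ∧ j < m) ∧
    ((square m emptyFilling p i j).1 = lt ↔ i = 1 ∧ j = m) ∧
    ((square m emptyFilling p i j).1 = top ↔ 1 < i ∧ i < m ∧ j = m) ∧
    ((square m emptyFilling p i j).1 = rt ↔ i = m ∧ j = m) ∧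
    ((square m emptyFilling p i j).1 = right ↔ i = m ∧ 1 < j ∧ j < m) ∧
    ((square m emptyFilling p i j).1 = rb ↔ i = m ∧ j = 1) ∧
    ((square m emptyFilling p i j).1 = bottom ↔ 1 < i ∧ i < m ∧ j = 1) ∧
    ((square m emptyFilling p i j).1 = diag ↔ i = j ∧ 1 < i ∧ i < m) ∧
    ((square m emptyFilling p i j).1 = upper ↔ i < j ∧ 1 < i ∧ j < m) := by
  rw [square_emptyFilling_fst, frameTile]
  split_ifs <;> simp only [false_iff, true_iff] <;>
    refine ⟨?_, ?_, ?_, ?_, ?_, ?_, ?_, ?_, ?_, ?_⟩ <;> omega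

theorem hRel_emptyFilling {m : ℕ} (hm : 3 ≤ m) (p i j : ℕ) :
    HRel (square m emptyFilling p i j) (square m emptyFilling p (i + 1) j) := by
  obtain ⟨h1, h2, h3, h4, h5, h6, h7, h8, h9, h10⟩ := square_emptyFilling_fst_eq_iff hm p i j
  obtain ⟨k1, k2, k3, k4, k5, k6, k7, k8, k9, k10⟩ := square_emptyFilling_fst_eq_iff hm p (i + 1) j
  unfold HRel
  simp only [ne_eq, *]
  refine ⟨by lia, by lia, by lia, by lia, by lia, by lia, by lia, by lia, by lia, ?_⟩
  -- A horizontal step passes between parity `p` on the frame and parity `0` inside only at these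
  -- two sides, exactly where alternation is waived.
  by_cases h : (i = 1 ∧ 1 < j ∧ j < m) ∨ (i + 1 = m ∧ 1 < j ∧ j < m)
  · exact h.elim Or.inl fun h => Or.inr (Or.inl h)
  · refine Or.inr (Or.inr ?_)
    rw [square_emptyFilling_snd, square_emptyFilling_snd]
    by_cases h' : 1 < i ∧ 1 < j ∧ i < m ∧ j < m
    · rw [if_pos h', if_pos (by lia)]
      exact chess_ne_right _ _ _
    · rw [if_neg h', if_neg (by lia)]
      exact chess_ne_right _ _ _

theorem vRel_emptyFilling {m : ℕ} (hm : 3 ≤ m) (p i j : ℕ) :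
    VRel (square m emptyFilling p i j) (square m emptyFilling p i (j + 1)) := by
  obtain ⟨h1, h2, h3, h4, h5, h6, h7, h8, h9, h10⟩ := square_emptyFilling_fst_eq_iff hm p i j
  obtain ⟨k1, k2, k3, k4, k5, k6, k7, k8, k9, k10⟩ := square_emptyFilling_fst_eq_iff hm p i (j + 1)
  unfold VRel
  simp only [*]
  refine ⟨by lia, by lia, by lia, by lia, by lia, by lia, by lia, by lia, by lia, fun h => ?_⟩
  rw [square_emptyFilling_snd, square_emptyFilling_snd, if_neg (by lia), if_neg (by lia)]
  exact chess_ne_up _ _ _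

theorem dRel_emptyFilling {m : ℕ} (hm : 3 ≤ m) (p i j : ℕ) :
    DRel (square m emptyFilling p i j) (square m emptyFilling p (i + 1) (j + 1)) := by
  obtain ⟨h1, h2, h3, h4, h5, h6, h7, h8, h9, h10⟩ := square_emptyFilling_fst_eq_iff hm p i j
  obtain ⟨k1, k2, k3, k4, k5, k6, k7, k8, k9, k10⟩ :=
    square_emptyFilling_fst_eq_iff hm p (i + 1) (j + 1)
  unfold DRel
  simp only [*]
  refine ⟨by lia, by lia, by lia, by lia⟩

theorem valid_emptyFilling {m : ℕ} (hm : 3 ≤ m) : Valid m emptyFilling :=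
  ⟨hm, fun _ _ _ _ _ _ => ⟨hRel_emptyFilling hm _ _ _, vRel_emptyFilling hm _ _ _,
    dRel_emptyFilling hm _ _ _⟩⟩

/-- `(x, y)` lies in the square `[1, m]²` translated by `(a, b)`, or next to it. -/
def InMargin (m a b x y : ℕ) : Prop := a ≤ x ∧ x ≤ a + m + 1 ∧ b ≤ y ∧ y ≤ b + m + 1

/-- `(x, y)` lies in the square `[1, m]²` translated by `(a, b)`. -/
def InClosed (m a b x y : ℕ) : Prop := a + 1 ≤ x ∧ x ≤ a + m ∧ b + 1 ≤ y ∧ y ≤ b + m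

section merge

variable {ι : Type} (a b m : ι → ℕ) (u : ι → ℕ → ℕ → Lab)

open Classical in
/-- The filling of a framed square by smaller framed squares. -/
noncomputable def mergeFilling (x y : ℕ) : Lab :=
  if h : ∃ i, InClosed (m i) (a i) (b i) x y then
    square (m h.choose) (u h.choose) (a h.choose + b h.choose) (x - a h.choose) (y - b h.choose)
  else emptyFilling x y

variable {a b m u}

/-- With parity `a i + b i`, the chessboard around the small square is the restriction of the large
one. Since `hin` keeps its margin below the diagonal, both fillings are plain there and agree. -/
theorem mergeFilling_of_inMargin
    (hsep : ∀ i i', i ≠ i' → ∀ x y, InMargin (m i) (a i) (b i) x y →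
      ¬ InMargin (m i') (a i') (b i') x y)
    (hin : ∀ i, b i + m i + 1 < a i) {i : ι} {x y : ℕ} (h : InMargin (m i) (a i) (b i) x y) :
    mergeFilling a b m u x y = square (m i) (u i) (a i + b i) (x - a i) (y - b i) := by
  obtain ⟨h1, h2, h3, h4⟩ := h
  unfold mergeFilling
  split_ifs with hex
  · have hi : hex.choose = i := by
      by_contra hne
      obtain ⟨k1, k2, k3, k4⟩ := hex.choose_spec
      exact hsep _ _ hne x y ⟨by lia, by lia, by lia, by lia⟩ ⟨h1, h2, h3, h4⟩
    rw [hi]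
  · have hno : ¬ InClosed (m i) (a i) (b i) x y := fun h => hex ⟨i, h⟩
    have hlt := hin i
    rw [square, if_pos (by unfold InClosed at hno; lia), emptyFilling, if_neg (by lia),
      if_neg (by lia)]
    refine Prod.ext rfl ?_
    change decide _ = decide _
    rw [show x - a i + (y - b i) + (a i + b i) = x + y + 0 by lia]

/-- Separated framed squares that lie below the diagonal of a larger framed square extend to an
admissible filling of it. -/
theorem exists_valid_extension {M : ℕ} (hM : 3 ≤ M) (hv : ∀ i, Valid (m i) (u i))
    (hin : ∀ i, 2 ≤ b i ∧ b i + m i + 1 < a i ∧ a i + m i + 1 < M)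
    (hsep : ∀ i i', i ≠ i' → ∀ x y, InMargin (m i) (a i) (b i) x y →
      ¬ InMargin (m i') (a i') (b i') x y) :
    ∃ U : ℕ → ℕ → Lab, Valid M U ∧ ∀ i x y, 1 < x → x < m i → 1 < y → y < m i →
      U (a i + x) (b i + y) = u i x y := by
  have key : ∀ {i x y}, InMargin (m i) (a i) (b i) x y →
      mergeFilling a b m u x y = square (m i) (u i) (a i + b i) (x - a i) (y - b i) :=
    mergeFilling_of_inMargin hsep fun i => (hin i).2.1
  refine ⟨mergeFilling a b m u, ⟨hM, fun p _ x _ y _ => ?_⟩, fun i x y h1 h2 h3 h4 => ?_⟩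
  · have hbig : ∀ {i x y}, InMargin (m i) (a i) (b i) x y →
        square M (mergeFilling a b m u) p x y =
          square (m i) (u i) (a i + b i) (x - a i) (y - b i) := fun {i x y} h => by
      rw [← key h]
      obtain ⟨h1, h2, h3, h4⟩ := h
      have := hin i
      rw [square, if_neg (by lia), if_neg (by lia)]
    have hbase : ∀ {x y}, (∀ i, ¬ InClosed (m i) (a i) (b i) x y) →
        square M (mergeFilling a b m u) p x y = square M emptyFilling p x y := fun {x y} h => by
      have : mergeFilling a b m u x y = emptyFilling x y :=
        dif_neg fun ⟨i, hi⟩ => h i hi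
      simp only [square, this]
    -- The two points of a local constraint lie either both in the margin of one small square or
    -- both outside all small squares. So each constraint is inherited from that square or from the
    -- empty filling.
    have step : ∀ dx ≤ 1, ∀ dy ≤ 1,
        (∃ i, InMargin (m i) (a i) (b i) x y ∧ InMargin (m i) (a i) (b i) (x + dx) (y + dy)) ∨
        ((∀ i, ¬ InClosed (m i) (a i) (b i) x y) ∧
          ∀ i, ¬ InClosed (m i) (a i) (b i) (x + dx) (y + dy)) := by
      intro dx hdx dy hdy
      by_contra hcon
      push Not at hcon
      obtain ⟨hc1, hc2⟩ := hcon
      unfold InMargin at hc1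
      unfold InClosed at hc2
      by_cases h : ∃ i, a i + 1 ≤ x ∧ x ≤ a i + m i ∧ b i + 1 ≤ y ∧ y ≤ b i + m i
      · obtain ⟨i, h⟩ := h
        exact hc1 i ⟨by lia, by lia, by lia, by lia⟩ ⟨by lia, by lia, by lia, by lia⟩
      · obtain ⟨i, h⟩ := hc2 fun i hi => h ⟨i, hi⟩
        exact hc1 i ⟨by lia, by lia, by lia, by lia⟩ ⟨by lia, by lia, by lia, by lia⟩
    refine ⟨?_, ?_, ?_⟩
    · rcases step 1 le_rfl 0 zero_le_one with ⟨i, h1, h2⟩ | ⟨h1, h2⟩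
      · have h2' : InMargin (m i) (a i) (b i) (x + 1) y := h2
        have := ((hv i).relAt (a i + b i) (x - a i) (y - b i)).1
        rw [hbig h1, hbig h2', Nat.sub_add_comm h1.1]
        exact this
      · rw [hbase h1, hbase (x := x + 1) (y := y) h2]
        exact ((valid_emptyFilling hM).relAt p x y).1
    · rcases step 0 zero_le_one 1 le_rfl with ⟨i, h1, h2⟩ | ⟨h1, h2⟩
      · have h2' : InMargin (m i) (a i) (b i) x (y + 1) := h2
        have := ((hv i).relAt (a i + b i) (x - a i) (y - b i)).2.1
        rw [hbig h1, hbig h2', Nat.sub_add_comm h1.2.2.1]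
        exact this
      · rw [hbase h1, hbase (x := x) (y := y + 1) h2]
        exact ((valid_emptyFilling hM).relAt p x y).2.1
    · rcases step 1 le_rfl 1 le_rfl with ⟨i, h1, h2⟩ | ⟨h1, h2⟩
      · have := ((hv i).relAt (a i + b i) (x - a i) (y - b i)).2.2
        rw [hbig h1, hbig h2, Nat.sub_add_comm h1.1, Nat.sub_add_comm h1.2.2.1]
        exact this
      · rw [hbase h1, hbase h2]
        exact ((valid_emptyFilling hM).relAt p x y).2.2
  · rw [key (i := i) ⟨by lia, by lia, by lia, by lia⟩, Nat.add_sub_cancel_left,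
      Nat.add_sub_cancel_left, square, if_neg (by lia), if_neg (by lia)]

end merge

end FramedSquares

/-! ### Families of framed squares in a free action -/

namespace FramedSquares

/-- A framed square in a `ℤ²`-action: a base point, the size of the square and its filling. -/
@[ext]
structure Placed (X : Type) where
  base : X
  size : ℕ
  fill : ℕ → ℕ → Lab

instance : Inhabited Tile := ⟨Tile.plain⟩

variable {X : Type} [AddAction (ℤ × ℤ) X]

/-- Translation by a vector with natural coordinates. -/
def trans (i j : ℕ) (x : X) : X := ((i : ℤ), (j : ℤ)) +ᵥ x

theorem trans_trans (i j k l : ℕ) (x : X) : trans i j (trans k l x) = trans (i + k) (j + l) x := by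
  simp only [trans, vadd_vadd, Prod.mk_add_mk, Nat.cast_add]

theorem trans_zero (x : X) : trans 0 0 x = x := by
  simp only [trans, Nat.cast_zero]
  exact zero_vadd _ x

theorem vadd_left_cancel_of_free {Γ X : Type} [AddGroup Γ] [AddAction Γ X] (h : IsFreeAction Γ X)
    {v w : Γ} {x : X} (hx : v +ᵥ x = w +ᵥ x) : v = w := by
  by_contra hne
  refine h (-w + v) (fun h0 => hne (neg_add_eq_zero.1 h0).symm) x ?_
  rw [add_vadd, hx, neg_vadd_vadd]

theorem trans_inj (h : IsFreeAction (ℤ × ℤ) X) {i j k l : ℕ} {x : X}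
    (hx : trans i j x = trans k l x) : i = k ∧ j = l := by
  simpa using vadd_left_cancel_of_free h hx

namespace Placed

/-- The label `l` is prescribed at the point `y` by a square whose interior contains `y`. -/
def Labels (P : Placed X) (y : X) (l : Lab) : Prop :=
  ∃ i j, 1 < i ∧ i < P.size ∧ 1 < j ∧ j < P.size ∧ y = trans i j P.base ∧ l = P.fill i j

/-- The point `y` is in the interior of the square. -/
def Covers (P : Placed X) (y : X) : Prop := ∃ l, P.Labels y l

/-- The first square is contained in the interior of the second one, and the labels agree. -/
def Nest (P Q : Placed X) : Prop :=
  ∃ a b, 1 ≤ a ∧ 1 ≤ b ∧ a + P.size + 1 ≤ Q.size ∧ b + P.size + 1 ≤ Q.size ∧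
    P.base = trans a b Q.base ∧
    ∀ i j, 1 < i → i < P.size → 1 < j → j < P.size → P.fill i j = Q.fill (a + i) (b + j)

/-- Two squares are neither overlapping nor adjacent. -/
def Sep (P Q : Placed X) : Prop :=
  ∀ i ≤ P.size + 1, ∀ j ≤ P.size + 1, ∀ k ≤ Q.size + 1, ∀ l ≤ Q.size + 1,
    trans i j P.base ≠ trans k l Q.base

/-- Two squares are equal, separated or nested. -/
def Compat (P Q : Placed X) : Prop := P = Q ∨ P.Sep Q ∨ P.Nest Q ∨ Q.Nest P

theorem Sep.symm {P Q : Placed X} (h : P.Sep Q) : Q.Sep P :=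
  fun i hi j hj k hk l hl heq => h k hk l hl i hi j hj heq.symm

theorem Compat.symm {P Q : Placed X} (h : P.Compat Q) : Q.Compat P :=
  h.elim (fun h => Or.inl h.symm) fun h =>
    h.elim (fun h => Or.inr (Or.inl h.symm)) fun h => Or.inr (Or.inr h.symm)

theorem Nest.trans {P Q R : Placed X} (h : P.Nest Q) (h' : Q.Nest R) : P.Nest R := by
  obtain ⟨a, b, h1, h2, h3, h4, h5, h6⟩ := h
  obtain ⟨a', b', k1, k2, k3, k4, k5, k6⟩ := h'
  refine ⟨a + a', b + b', by lia, by lia, by lia, by lia, by rw [h5, k5, trans_trans],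
    fun i j hi hi' hj hj' => ?_⟩
  rw [h6 i j hi hi' hj hj', k6 _ _ (by lia) (by lia) (by lia) (by lia)]
  congr 1 <;> ring

theorem Nest.sep {P Q R : Placed X} (h : P.Nest Q) (h' : Q.Sep R) : P.Sep R := by
  obtain ⟨a, b, h1, h2, h3, h4, h5, h6⟩ := h
  intro i hi j hj k hk l hl heq
  rw [h5, trans_trans] at heq
  exact h' _ (by lia) _ (by lia) k hk l hl heq

theorem Nest.labels {P Q : Placed X} (h : P.Nest Q) {y : X} {l : Lab} (hl : P.Labels y l) :
    Q.Labels y l := by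
  obtain ⟨a, b, h1, h2, h3, h4, h5, h6⟩ := h
  obtain ⟨i, j, k1, k2, k3, k4, k5, k6⟩ := hl
  refine ⟨i + a, j + b, by lia, by lia, by lia, by lia, by rw [k5, h5, trans_trans], ?_⟩
  rw [k6, h6 i j k1 k2 k3 k4, add_comm, add_comm b]

theorem Labels.unique (hfree : IsFreeAction (ℤ × ℤ) X) {P : Placed X} {y : X} {l l' : Lab}
    (h : P.Labels y l) (h' : P.Labels y l') : l = l' := by
  obtain ⟨i, j, k1, k2, k3, k4, k5, k6⟩ := h
  obtain ⟨i', j', h1, h2, h3, h4, h5, h6⟩ := h'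
  obtain ⟨rfl, rfl⟩ := trans_inj hfree (k5.symm.trans h5)
  rw [k6, h6]

/-- Compatible squares covering adjacent points: one of them covers both. -/
theorem Compat.common {P Q : Placed X} (h : P.Compat Q) {y : X} {dx dy : ℕ} {l l' : Lab}
    (hdx : dx ≤ 1) (hdy : dy ≤ 1) (hP : P.Labels y l) (hQ : Q.Labels (FramedSquares.trans dx dy y) l') :
    (P.Labels y l ∧ P.Labels (FramedSquares.trans dx dy y) l') ∨
      (Q.Labels y l ∧ Q.Labels (FramedSquares.trans dx dy y) l') := by
  rcases h with rfl | h | h | h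
  · exact Or.inl ⟨hP, hQ⟩
  · exfalso
    obtain ⟨i, j, k1, k2, k3, k4, k5, k6⟩ := hP
    obtain ⟨i', j', h1, h2, h3, h4, h5, h6⟩ := hQ
    refine h (dx + i) (by lia) (dy + j) (by lia) i' (by lia) j' (by lia) ?_
    rw [← h5, k5, trans_trans]
  · exact Or.inr ⟨h.labels hP, hQ⟩
  · exact Or.inl ⟨hP, h.labels hQ⟩

end Placed

/-- Freeness makes the coordinates within the square unique. Both points are interior, so the outer
parity has no influence and `0` serves. -/
theorem Placed.labels_eq_square (hfree : IsFreeAction (ℤ × ℤ) X) {P : Placed X}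
    {y : X} {dx dy : ℕ} {l l' : Lab} (h : P.Labels y l)
    (h' : P.Labels (trans dx dy y) l') : ∃ i j, l = square P.size P.fill 0 i j ∧
      l' = square P.size P.fill 0 (i + dx) (j + dy) := by
  obtain ⟨i, j, k1, k2, k3, k4, k5, k6⟩ := h
  obtain ⟨i', j', h1, h2, h3, h4, h5, h6⟩ := h'
  rw [k5, trans_trans] at h5
  obtain ⟨rfl, rfl⟩ := trans_inj hfree h5
  refine ⟨i, j, ?_, ?_⟩
  · rw [square, if_neg (by lia), if_neg (by lia), k6]
  · rw [square, if_neg (by lia), if_neg (by lia), h6, add_comm, add_comm dy]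

/-- A compatible family of admissible framed squares defines labels, which satisfy the local
constraints. -/
theorem exists_labelling (hfree : IsFreeAction (ℤ × ℤ) X) {S : Set (Placed X)}
    (hv : ∀ P ∈ S, Valid P.size P.fill) (hS : ∀ P ∈ S, ∀ Q ∈ S, P.Compat Q) :
    ∃ f : X → Lab, (∀ P ∈ S, ∀ y l, P.Labels y l → f y = l) ∧
      ∀ x, (∀ v : ℤ × ℤ, ∃ P ∈ S, P.Covers (v +ᵥ x)) → IsTilingAt f x := by
  classical
  -- The case of equal points in `Placed.Compat.common`: one of two overlapping squares prescribes
  -- both labels.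
  have huniq : ∀ P ∈ S, ∀ Q ∈ S, ∀ y l l', P.Labels y l → Q.Labels y l' → l = l' := by
    intro P hP Q hQ y l l' h h'
    rw [← trans_zero y] at h'
    rcases (hS P hP Q hQ).common zero_le_one zero_le_one h h' with ⟨h1, h2⟩ | ⟨h1, h2⟩ <;>
    · rw [trans_zero] at h2
      exact h1.unique hfree h2
  refine ⟨fun y => if h : ∃ l, ∃ P ∈ S, P.Labels y l then h.choose else default,
    fun P hP y l hl => ?_, fun x hx => ?_⟩
  · have h : ∃ l, ∃ P ∈ S, P.Labels y l := ⟨l, P, hP, hl⟩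
    beta_reduce
    rw [dif_pos h]
    obtain ⟨Q, hQ, hQ'⟩ := h.choose_spec
    exact huniq Q hQ P hP y _ _ hQ' hl
  · have hlab : ∀ v : ℤ × ℤ, ∃ P ∈ S, P.Labels (v +ᵥ x)
        (if h : ∃ l, ∃ P ∈ S, P.Labels (v +ᵥ x) l then h.choose else default) := fun v => by
      obtain ⟨P, hP, l, hl⟩ := hx v
      have h : ∃ l, ∃ P ∈ S, P.Labels (v +ᵥ x) l := ⟨l, P, hP, hl⟩
      rw [dif_pos h]
      exact h.choose_spec
    -- One square covers both points of the constraint, so the constraint holds because that square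
    -- is admissible.
    have hrel : ∀ dx ≤ 1, ∀ dy ≤ 1, ∃ P ∈ S, ∃ i j,
        (if h : ∃ l, ∃ P ∈ S, P.Labels x l then h.choose else default) =
          square P.size P.fill 0 i j ∧
        (if h : ∃ l, ∃ P ∈ S, P.Labels (trans dx dy x) l then h.choose else default) =
          square P.size P.fill 0 (i + dx) (j + dy) := by
      intro dx hdx dy hdy
      obtain ⟨P, hP, h⟩ := hlab 0
      rw [zero_vadd] at h
      obtain ⟨Q, hQ, h'⟩ := hlab ((dx : ℤ), (dy : ℤ))
      rcases (hS P hP Q hQ).common hdx hdy h h' with ⟨h1, h2⟩ | ⟨h1, h2⟩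
      · exact ⟨P, hP, Placed.labels_eq_square hfree h1 h2⟩
      · exact ⟨Q, hQ, Placed.labels_eq_square hfree h1 h2⟩
    refine ⟨?_, ?_, ?_⟩
    · obtain ⟨P, hP, i, j, h1, h2⟩ := hrel 1 le_rfl 0 zero_le_one
      have := ((hv P hP).relAt 0 i j).1
      rw [← h1] at this
      exact Eq.mp (congrArg _ h2.symm) this
    · obtain ⟨P, hP, i, j, h1, h2⟩ := hrel 0 zero_le_one 1 le_rfl
      have := ((hv P hP).relAt 0 i j).2.1
      rw [← h1] at this
      exact Eq.mp (congrArg _ h2.symm) this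
    · obtain ⟨P, hP, i, j, h1, h2⟩ := hrel 1 le_rfl 1 le_rfl
      have := ((hv P hP).relAt 0 i j).2.2
      rw [← h1] at this
      exact Eq.mp (congrArg _ h2.symm) this

end FramedSquares

/-! ### Computability tools -/

namespace FramedSquares

/-! Closure properties of computable functions and predicates. -/

attribute [fun_prop] Computable

section computable

variable {α β γ : Type} [Primcodable α] [Primcodable β] [Primcodable γ]

@[fun_prop]
theorem computable_id : Computable fun x : α => x := Computable.id

@[fun_prop]
theorem computable_const (b : β) : Computable fun _ : α => b := Computable.const b

@[fun_prop]
theorem computable_comp {f : β → γ} {g : α → β} (hf : Computable f) (hg : Computable g) :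
    Computable fun x => f (g x) := hf.comp hg

@[fun_prop]
theorem computable_fst {f : α → β × γ} (h : Computable f) : Computable fun x => (f x).1 :=
  Computable.fst.comp h

@[fun_prop]
theorem computable_snd {f : α → β × γ} (h : Computable f) : Computable fun x => (f x).2 :=
  Computable.snd.comp h

@[fun_prop]
theorem computable_mk {f : α → β} {g : α → γ} (hf : Computable f) (hg : Computable g) :
    Computable fun x => (f x, g x) := hf.pair hg

@[fun_prop]
theorem computable_add {f g : α → ℕ} (hf : Computable f) (hg : Computable g) :
    Computable fun x => f x + g x := Primrec.nat_add.to_comp.comp hf hg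

@[fun_prop]
theorem computable_mul {f g : α → ℕ} (hf : Computable f) (hg : Computable g) :
    Computable fun x => f x * g x := Primrec.nat_mul.to_comp.comp hf hg

@[fun_prop]
theorem computable_mod {f g : α → ℕ} (hf : Computable f) (hg : Computable g) :
    Computable fun x => f x % g x := Primrec.nat_mod.to_comp.comp hf hg

@[fun_prop]
theorem computable_natPair {f g : α → ℕ} (hf : Computable f) (hg : Computable g) :
    Computable fun x => Nat.pair (f x) (g x) := Primrec₂.natPair.to_comp.comp hf hg

@[fun_prop]
theorem computable_unpair {f : α → ℕ} (hf : Computable f) :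
    Computable fun x => Nat.unpair (f x) := Computable.unpair.comp hf

theorem computable_iterate {T : ℕ → ℕ} (hT : Computable T) {f g : α → ℕ} (hf : Computable f)
    (hg : Computable g) : Computable fun x => T^[f x] (g x) := by
  refine (Computable.nat_rec (h := fun _ y => T y.2) hf hg ?_).of_eq fun x => ?_
  · exact hT.comp (Computable.snd.comp Computable.snd)
  · induction f x with
    | zero => rfl
    | succ k ih => rw [Function.iterate_succ_apply', ← ih]

theorem computable_dom_finite [Finite α] (f : α → β) : Computable f := (Primrec.dom_finite f).to_comp

theorem computablePred_comp {p : β → Prop} (hp : ComputablePred p) {f : α → β}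
    (hf : Computable f) : ComputablePred fun x => p (f x) := by
  classical
  exact (hp.decide.comp hf).computablePred

theorem computablePred_and {p q : α → Prop} (hp : ComputablePred p) (hq : ComputablePred q) :
    ComputablePred fun x => p x ∧ q x := by
  classical
  exact ((Primrec.and.to_comp.comp hp.decide hq.decide).of_eq
    fun x => (Bool.decide_and _ _).symm).computablePred

theorem computablePred_or {p q : α → Prop} (hp : ComputablePred p) (hq : ComputablePred q) :
    ComputablePred fun x => p x ∨ q x :=
  (computablePred_and hp.not hq.not).not.of_eq fun x => by tauto

theorem computablePred_imp {p q : α → Prop} (hp : ComputablePred p) (hq : ComputablePred q) :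
    ComputablePred fun x => p x → q x :=
  (computablePred_or hp.not hq).of_eq fun x => by tauto

theorem computablePred_eq {f g : α → ℕ} (hf : Computable f) (hg : Computable g) :
    ComputablePred fun x => f x = g x := by
  classical
  exact (Primrec.eq.decide.to_comp.comp hf hg).computablePred

theorem computablePred_lt {f g : α → ℕ} (hf : Computable f) (hg : Computable g) :
    ComputablePred fun x => f x < g x := by
  classical
  exact (Primrec.nat_lt.decide.to_comp.comp hf hg).computablePred

theorem computablePred_le {f g : α → ℕ} (hf : Computable f) (hg : Computable g) :
    ComputablePred fun x => f x ≤ g x := by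
  classical
  exact (Primrec.nat_le.decide.to_comp.comp hf hg).computablePred

theorem computablePred_forall_lt {p : α → ℕ → Prop} (hp : ComputablePred fun y : α × ℕ => p y.1 y.2)
    {f : α → ℕ} (hf : Computable f) : ComputablePred fun x => ∀ i < f x, p x i := by
  classical
  refine ComputablePred.of_eq (p := fun x => (Nat.rec true
    (fun i b => b && decide (p x i)) (f x) : Bool) = true) ?_ fun x => ?_
  · refine Computable.computablePred ?_
    simp only [Bool.decide_eq_true]
    refine Computable.nat_rec (h := fun x y => y.2 && decide (p x y.1)) hf (Computable.const true) ?_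
    exact Primrec.and.to_comp.comp (Computable.snd.comp Computable.snd)
      (hp.decide.comp (Computable.fst.pair (Computable.fst.comp Computable.snd)))
  · induction f x with
    | zero => simp
    | succ k ih =>
      simp only [Bool.and_eq_true, decide_eq_true_eq, Nat.lt_succ_iff_lt_or_eq, or_imp, forall_and,
        forall_eq, ih]

theorem computablePred_exists_lt {p : α → ℕ → Prop} (hp : ComputablePred fun y : α × ℕ => p y.1 y.2)
    {f : α → ℕ} (hf : Computable f) : ComputablePred fun x => ∃ i < f x, p x i :=
  (computablePred_forall_lt (p := fun x i => ¬ p x i) hp.not hf).not.of_eq fun x => by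
    push Not; rfl

theorem computable_ite {c : α → Prop} [DecidablePred c] {f g : α → β} (hc : ComputablePred c)
    (hf : Computable f) (hg : Computable g) : Computable fun x => if c x then f x else g x :=
  (hc.decide.cond hf hg).of_eq fun x => by rw [Bool.cond_decide]

end computable

noncomputable instance : Primcodable Tile := Primcodable.ofEquiv _ (Fintype.equivFin Tile)

/-- The labels as numbers. -/
noncomputable def decodeLab (k : ℕ) : Lab := (Encodable.decode k : Option Lab).getD default

@[fun_prop]
theorem computable_decodeLab : Computable decodeLab :=
  Computable.option_getD Computable.decode (Computable.const _)

theorem decodeLab_encode (l : Lab) : decodeLab (Encodable.encode l) = l := by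
  rw [decodeLab, Encodable.encodek]
  rfl

section

variable {α : Type} [Primcodable α]

/-- There are finitely many labels, so any relation between them is computable. -/
theorem computablePred_lab (R : Lab → Lab → Prop) {f g : α → Lab} (hf : Computable f)
    (hg : Computable g) : ComputablePred fun x => R (f x) (g x) := by
  classical
  exact ((computable_dom_finite fun y : Lab × Lab => decide (R y.1 y.2)).comp
    (hf.pair hg)).computablePred

theorem computable_chess {p i j : α → ℕ} (hp : Computable p) (hi : Computable i)
    (hj : Computable j) : Computable fun x => chess (p x) (i x) (j x) := by
  unfold chess
  exact (computablePred_eq (by fun_prop) (by fun_prop)).decide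

theorem computable_frameTile {m i j : α → ℕ} (hm : Computable m) (hi : Computable i)
    (hj : Computable j) : Computable fun x => frameTile (m x) (i x) (j x) := by
  unfold frameTile
  have h1 : ∀ {f g : α → ℕ}, Computable f → Computable g → ComputablePred fun x => f x = g x :=
    computablePred_eq
  have hc : ∀ n : ℕ, Computable fun _ : α => n := Computable.const
  have ht : ∀ t : Tile, Computable fun _ : α => t := Computable.const
  exact computable_ite (h1 hi (hc 1)) (computable_ite (h1 hj (hc 1)) (ht _)
    (computable_ite (h1 hj hm) (ht _) (ht _))) (computable_ite (h1 hi hm)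
    (computable_ite (h1 hj (hc 1)) (ht _) (computable_ite (h1 hj hm) (ht _) (ht _)))
    (computable_ite (h1 hj (hc 1)) (ht _) (ht _)))

theorem computable_square {u : α → ℕ → ℕ → Lab}
    (hu : Computable fun x : α × ℕ × ℕ => u x.1 x.2.1 x.2.2) {m p i j : α → ℕ} (hm : Computable m)
    (hp : Computable p) (hi : Computable i) (hj : Computable j) :
    Computable fun x => square (m x) (u x) (p x) (i x) (j x) := by
  unfold square
  have hc : ∀ n : ℕ, Computable fun _ : α => n := Computable.const
  have hch := computable_chess hp hi hj
  refine computable_ite (computablePred_or (computablePred_lt hi (hc 1))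
    (computablePred_or (computablePred_lt hj (hc 1)) (computablePred_or (computablePred_lt hm hi)
    (computablePred_lt hm hj)))) ((Computable.const _).pair hch)
    (computable_ite (computablePred_or (computablePred_eq hi (hc 1))
    (computablePred_or (computablePred_eq hj (hc 1)) (computablePred_or (computablePred_eq hi hm)
    (computablePred_eq hj hm)))) ((computable_frameTile hm hi hj).pair hch) ?_)
  exact hu.comp (Computable.id.pair (hi.pair hj))

theorem computablePred_valid {u : α → ℕ → ℕ → Lab}
    (hu : Computable fun x : α × ℕ × ℕ => u x.1 x.2.1 x.2.2) {m : α → ℕ} (hm : Computable m) :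
    ComputablePred fun x => Valid (m x) (u x) := by
  have hsq : ∀ dx dy, Computable fun x : ((α × ℕ) × ℕ) × ℕ =>
      square (m x.1.1.1) (u x.1.1.1) x.1.1.2 (x.1.2 + dx) (x.2 + dy) := fun dx dy =>
    computable_square (u := fun x : ((α × ℕ) × ℕ) × ℕ => u x.1.1.1)
      (m := fun x => m x.1.1.1) (p := fun x => x.1.1.2) (i := fun x => x.1.2 + dx)
      (j := fun x => x.2 + dy)
      (hu.comp (g := fun x : (((α × ℕ) × ℕ) × ℕ) × ℕ × ℕ => (x.1.1.1.1, x.2.1, x.2.2))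
        (by fun_prop)) (by fun_prop) (by fun_prop) (by fun_prop) (by fun_prop)
  unfold Valid
  refine computablePred_and (computablePred_le (by fun_prop) hm) ?_
  refine computablePred_forall_lt ?_ (by fun_prop)
  refine computablePred_forall_lt ?_ (by fun_prop)
  refine computablePred_forall_lt ?_ (by fun_prop)
  exact computablePred_and (computablePred_lab HRel (hsq 0 0) (hsq 1 0)) (computablePred_and
    (computablePred_lab VRel (hsq 0 0) (hsq 0 1)) (computablePred_lab DRel (hsq 0 0) (hsq 1 1)))

end

end FramedSquares

/-! ### Enclosing a finite family by larger squares -/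

namespace FramedSquares

/-- A finite set is covered by boxes around the points of a subset whose points are far from each
other, compared with the size of the boxes. -/
theorem exists_separated_cover {X : Type} [AddAction (ℤ × ℤ) X] (T : Finset X) (Φ : ℕ → ℕ) :
    ∃ C ⊆ T, ∃ R : ℕ,
      (∀ t ∈ T, ∃ c ∈ C, ∃ v : ℤ × ℤ, |v.1| ≤ R ∧ |v.2| ≤ R ∧ t = v +ᵥ c) ∧
      ∀ c ∈ C, ∀ d ∈ C, ∀ v : ℤ × ℤ, |v.1| ≤ Φ R → |v.2| ≤ Φ R → c = v +ᵥ d → c = d := by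
  classical
  -- Induction on the number of centres, starting from all of `T` with radius `0`. If two centres
  -- are closer than `Φ R` allows, one is dropped and the radius grows by `Φ R`.
  suffices ∀ (k : ℕ) (C : Finset X) (R : ℕ), C.card = k → C ⊆ T →
      (∀ t ∈ T, ∃ c ∈ C, ∃ v : ℤ × ℤ, |v.1| ≤ R ∧ |v.2| ≤ R ∧ t = v +ᵥ c) →
      ∃ C ⊆ T, ∃ R : ℕ,
        (∀ t ∈ T, ∃ c ∈ C, ∃ v : ℤ × ℤ, |v.1| ≤ R ∧ |v.2| ≤ R ∧ t = v +ᵥ c) ∧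
        ∀ c ∈ C, ∀ d ∈ C, ∀ v : ℤ × ℤ, |v.1| ≤ Φ R → |v.2| ≤ Φ R → c = v +ᵥ d → c = d from
    this _ T 0 rfl subset_rfl fun t ht => ⟨t, ht, 0, by simp, by simp, by rw [zero_vadd]⟩
  intro k
  induction k with
  | zero =>
    intro C R hC hCT hcov
    obtain rfl := Finset.card_eq_zero.1 hC
    exact ⟨∅, hCT, R, hcov, by simp⟩
  | succ k ih =>
    intro C R hC hCT hcov
    by_cases hsep : ∀ c ∈ C, ∀ d ∈ C, ∀ v : ℤ × ℤ, |v.1| ≤ Φ R → |v.2| ≤ Φ R → c = v +ᵥ d → c = d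
    · exact ⟨C, hCT, R, hcov, hsep⟩
    · push Not at hsep
      obtain ⟨c, hc, d, hd, v, hv1, hv2, rfl, hne⟩ := hsep
      refine ih (C.erase (v +ᵥ d)) (R + Φ R) (by rw [Finset.card_erase_of_mem hc, hC]; rfl)
        ((Finset.erase_subset _ _).trans hCT) fun t ht => ?_
      obtain ⟨c', hc', w, hw1, hw2, rfl⟩ := hcov t ht
      by_cases h : c' = v +ᵥ d
      · refine ⟨d, Finset.mem_erase.2 ⟨hne.symm, hd⟩, w + v, ?_, ?_, by rw [h, vadd_vadd]⟩
        · push_cast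
          exact (abs_add_le _ _).trans (add_le_add hw1 hv1)
        · push_cast
          exact (abs_add_le _ _).trans (add_le_add hw2 hv2)
      · exact ⟨c', Finset.mem_erase.2 ⟨h, hc'⟩, w, hw1.trans (by push_cast; lia),
          hw2.trans (by push_cast; lia), rfl⟩

variable {X : Type} [AddAction (ℤ × ℤ) X]

/-- Separated framed squares can be put into a larger one. -/
theorem exists_nest {ι : Type} {P : ι → Placed X} (hv : ∀ i, Valid (P i).size (P i).fill)
    (hsep : ∀ i j, i ≠ j → (P i).Sep (P j)) {M : ℕ} (hM : 3 ≤ M) (y : X)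
    (hin : ∀ i, ∃ a b, (P i).base = trans a b y ∧ 2 ≤ b ∧ b + (P i).size + 1 < a ∧
      a + (P i).size + 1 < M) :
    ∃ U, Valid M U ∧ ∀ i, (P i).Nest ⟨y, M, U⟩ := by
  choose a b h1 h2 h3 h4 using hin
  obtain ⟨U, hU, hag⟩ := exists_valid_extension (a := a) (b := b) hM hv
    (fun i => ⟨h2 i, h3 i, h4 i⟩) (fun i i' hne x y' hx hx' => by
      obtain ⟨k1, k2, k3, k4⟩ := hx
      obtain ⟨l1, l2, l3, l4⟩ := hx'
      refine hsep i i' hne (x - a i) (by lia) (y' - b i) (by lia) (x - a i') (by lia)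
        (y' - b i') (by lia) ?_
      rw [h1, h1, trans_trans, trans_trans, Nat.sub_add_cancel k1, Nat.sub_add_cancel k3,
        Nat.sub_add_cancel l1, Nat.sub_add_cancel l3])
  refine ⟨U, hU, fun i => ⟨a i, b i, ?_, ?_, ?_, ?_, h1 i, fun x y hx hx' hy hy' => ?_⟩⟩
  · have := h3 i; lia
  · have := h2 i; lia
  · have := h4 i
    change _ ≤ M
    lia
  · have := h3 i
    have := h4 i
    change _ ≤ M
    lia
  · exact (hag i x y hx hx' hy hy').symm

/-- Finitely many separated framed squares of the same size and a point can be put into larger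
framed squares with the same properties. -/
theorem exists_next_family {ι : Type} [Finite ι] {P : ι → Placed X} {m : ℕ}
    (hm : ∀ i, (P i).size = m) (hv : ∀ i, Valid (P i).size (P i).fill)
    (hsep : ∀ i j, i ≠ j → (P i).Sep (P j)) (x : X) :
    ∃ (M N : ℕ) (Q : Fin N → Placed X), (∀ i, (Q i).size = M) ∧
      (∀ i, Valid (Q i).size (Q i).fill) ∧ (∀ i j, i ≠ j → (Q i).Sep (Q j)) ∧
      (∀ i, ∃ j, (P i).Nest (Q j)) ∧ ∃ j, (Q j).Covers x := by
  classical
  have := Fintype.ofFinite ι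
  -- The new squares have size `4 * R + 2 * m + 20`. Centres must differ by more than this size plus
  -- one, since `Placed.Sep` includes the margins.
  obtain ⟨C, -, R, hcov, hC⟩ := exists_separated_cover
    (insert x (Finset.univ.image fun i => (P i).base)) (fun R => 4 * R + 2 * m + 21)
  choose! c hcC w hw1 hw2 hw using hcov
  have hx := Finset.mem_insert_self x (Finset.univ.image fun i => (P i).base)
  have hP : ∀ i, (P i).base ∈ insert x (Finset.univ.image fun i => (P i).base) := fun i =>
    Finset.mem_insert_of_mem (Finset.mem_image_of_mem _ (Finset.mem_univ i))
  -- The centre gets coordinates `(3 * R + m + 10, R + 2)` in its square. A point within `R` of it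
  -- has second coordinate at least `2`, and an old square based there stays below the diagonal and
  -- inside the frame.
  let base : X → X := fun t => ((-(3 * R + m + 10 : ℤ), -(R + 2 : ℤ)) : ℤ × ℤ) +ᵥ t
  have hpos : ∀ t ∈ insert x (Finset.univ.image fun i => (P i).base), ∃ a b : ℕ,
      t = trans a b (base (c t)) ∧ (a : ℤ) = (w t).1 + (3 * R + m + 10) ∧
        (b : ℤ) = (w t).2 + (R + 2) := fun t ht => by
    have h1 := abs_le.1 (hw1 t ht)
    have h2 := abs_le.1 (hw2 t ht)
    obtain ⟨a, ha⟩ := Int.eq_ofNat_of_zero_le (a := (w t).1 + (3 * R + m + 10)) (by lia)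
    obtain ⟨b, hb⟩ := Int.eq_ofNat_of_zero_le (a := (w t).2 + (R + 2)) (by lia)
    refine ⟨a, b, ?_, ha.symm, hb.symm⟩
    rw [trans, ← ha, ← hb, vadd_vadd]
    conv_lhs => rw [hw t ht]
    congr 1
    ext <;> simp <;> ring
  have hex : ∀ t : X, ∃ U, Valid (4 * R + 2 * m + 20) U ∧
      ∀ i, c (P i).base = t → (P i).Nest ⟨base t, 4 * R + 2 * m + 20, U⟩ := fun t => by
    obtain ⟨U, hU, hn⟩ := exists_nest (P := fun i : {i // c (P i).base = t} => P i)
      (fun i => hv i) (fun i j hij => hsep i j fun h => hij (Subtype.ext h))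
      (M := 4 * R + 2 * m + 20) (by lia) (base t) fun i => by
        obtain ⟨a, b, h1, h2, h3⟩ := hpos _ (hP i)
        have k1 := abs_le.1 (hw1 _ (hP i))
        have k2 := abs_le.1 (hw2 _ (hP i))
        rw [i.2] at h1
        have hs := hm i
        exact ⟨a, b, h1, by lia, by lia, by lia⟩
    exact ⟨U, hU, fun i hi => hn ⟨i, hi⟩⟩
  choose U hU hnest using hex
  let e := C.equivFin.symm
  let Q : X → Placed X := fun t => ⟨base t, 4 * R + 2 * m + 20, U t⟩
  refine ⟨4 * R + 2 * m + 20, C.card, fun k => Q (e k), fun _ => rfl, fun _ => hU _,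
    fun k l hkl i hi j hj i' hi' j' hj' heq => hkl ?_, fun i => ?_, ?_⟩
  · refine e.injective (Subtype.ext (hC _ (e k).2 _ (e l).2
      ((i' : ℤ) - i, (j' : ℤ) - j) ?_ ?_ ?_))
    · change i ≤ 4 * R + 2 * m + 20 + 1 at hi
      change i' ≤ 4 * R + 2 * m + 20 + 1 at hi'
      rw [abs_le]
      push_cast
      constructor <;> lia
    · change j ≤ 4 * R + 2 * m + 20 + 1 at hj
      change j' ≤ 4 * R + 2 * m + 20 + 1 at hj'
      rw [abs_le]
      push_cast
      constructor <;> lia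
    · change trans i j (base _) = trans i' j' (base _) at heq
      simp only [trans, base, vadd_vadd] at heq
      replace heq := eq_neg_vadd_iff.2 heq
      rw [heq, vadd_vadd]
      congr 1
      ext <;> simp <;> ring
  · refine ⟨e.symm ⟨_, hcC _ (hP i)⟩, ?_⟩
    beta_reduce
    rw [Equiv.apply_symm_apply]
    exact hnest _ i rfl
  · refine ⟨e.symm ⟨_, hcC _ hx⟩, ?_⟩
    beta_reduce
    rw [Equiv.apply_symm_apply]
    obtain ⟨a, b, h1, h2, h3⟩ := hpos _ hx
    have k1 := abs_le.1 (hw1 _ hx)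
    have k2 := abs_le.1 (hw2 _ hx)
    have hs : (Q (c x)).size = 4 * R + 2 * m + 20 := rfl
    exact ⟨_, a, b, by lia, by lia, by lia, by lia, h1, rfl⟩

end FramedSquares

/-! ### Coding finite families by numbers -/

namespace FramedSquares

/-! A finite family of placed squares of the same size is coded by a natural number. -/

/-- The entry at index `k` of the list with code `c`. -/
def entry (c k : ℕ) : ℕ := (Denumerable.ofNat (List ℕ) c).getD k 0

theorem exists_entry_eq (F : ℕ → ℕ) (L : ℕ) : ∃ c, ∀ k < L, entry c k = F k := by
  refine ⟨Encodable.encode ((List.range L).map F), fun k hk => ?_⟩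
  rw [entry, Denumerable.ofNat_encode, List.getD_eq_getElem?_getD]
  simp [hk]

/-- The size of the coded squares. -/
def codeSize (c : ℕ) : ℕ := entry c 0

/-- The number of coded squares. -/
def codeNum (c : ℕ) : ℕ := entry c 1

/-- The base point of a coded square. -/
def codeBase (c i : ℕ) : ℕ := entry c (2 + 2 * i)

/-- The filling of a coded square. -/
noncomputable def codeFill (c i a b : ℕ) : Lab :=
  decodeLab (entry c (3 + 2 * Nat.pair i (Nat.pair a b)))

theorem exists_code (m N : ℕ) (t : ℕ → ℕ) (u : ℕ → ℕ → ℕ → Lab) :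
    ∃ c, codeSize c = m ∧ codeNum c = N ∧ (∀ i < N, codeBase c i = t i) ∧
      ∀ i < N, ∀ a < m, ∀ b < m, codeFill c i a b = u i a b := by
  let F : ℕ → ℕ := fun k => if k = 0 then m else if k = 1 then N else
    if k % 2 = 0 then t ((k - 2) / 2) else
      Encodable.encode (u (Nat.unpair ((k - 3) / 2)).1 (Nat.unpair (Nat.unpair ((k - 3) / 2)).2).1
        (Nat.unpair (Nat.unpair ((k - 3) / 2)).2).2)
  -- The list is long enough for every base point with index below `N` and, by monotonicity of
  -- `Nat.pair`, for every entry of a filling with arguments below the bounds.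
  obtain ⟨c, hc⟩ := exists_entry_eq F (4 + 2 * N + 2 * Nat.pair N (Nat.pair m m))
  refine ⟨c, ?_, ?_, fun i hi => ?_, fun i hi a ha b hb => ?_⟩
  · rw [codeSize, hc _ (by lia)]
    rfl
  · rw [codeNum, hc _ (by lia)]
    rfl
  · rw [codeBase, hc _ (by lia)]
    simp only [F]
    rw [if_neg (by lia), if_neg (by lia), if_pos (by lia)]
    congr 1
    lia
  · have h : Nat.pair i (Nat.pair a b) < Nat.pair N (Nat.pair m m) :=
      (Nat.pair_lt_pair_left _ hi).trans (Nat.pair_lt_pair_right _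
        ((Nat.pair_lt_pair_left _ ha).trans (Nat.pair_lt_pair_right _ hb)))
    rw [codeFill, hc _ (by lia)]
    simp only [F]
    rw [if_neg (by lia), if_neg (by lia), if_neg (by lia), decodeLab_encode,
      show (3 + 2 * Nat.pair i (Nat.pair a b) - 3) / 2 = Nat.pair i (Nat.pair a b) by lia]
    simp only [Nat.unpair_pair]

section computable

variable {α : Type} [Primcodable α] {f g h k : α → ℕ}

@[fun_prop]
theorem computable_entry (hf : Computable f) (hg : Computable g) :
    Computable fun x => entry (f x) (g x) := by
  unfold entry
  simp only [List.getD_eq_getElem?_getD]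
  exact Computable.option_getD (Computable.list_getElem?.comp
    ((Computable.ofNat (List ℕ)).comp hf) hg) (Computable.const 0)

@[fun_prop]
theorem computable_codeSize (hf : Computable f) : Computable fun x => codeSize (f x) := by
  unfold codeSize; fun_prop

@[fun_prop]
theorem computable_codeNum (hf : Computable f) : Computable fun x => codeNum (f x) := by
  unfold codeNum; fun_prop

@[fun_prop]
theorem computable_codeBase (hf : Computable f) (hg : Computable g) :
    Computable fun x => codeBase (f x) (g x) := by
  unfold codeBase; fun_prop

@[fun_prop]
theorem computable_codeFill (hf : Computable f) (hg : Computable g) (hh : Computable h)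
    (hk : Computable k) : Computable fun x => codeFill (f x) (g x) (h x) (k x) := by
  unfold codeFill; fun_prop

end computable

section

variable (T₁ T₂ : ℕ → ℕ)

/-- Translation in terms of codes. -/
def codeTrans (a b x : ℕ) : ℕ := T₁^[a] (T₂^[b] x)

/-- Separation in terms of codes. -/
def CodeSep (c i j : ℕ) : Prop :=
  ∀ a < codeSize c + 2, ∀ b < codeSize c + 2, ∀ k < codeSize c + 2, ∀ l < codeSize c + 2,
    ¬ codeTrans T₁ T₂ a b (codeBase c i) = codeTrans T₁ T₂ k l (codeBase c j)

/-- Nesting in terms of codes. -/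
def CodeNest (c i c' j : ℕ) : Prop :=
  ∃ a < codeSize c' + 1, ∃ b < codeSize c' + 1, (1 ≤ a ∧ 1 ≤ b ∧ a + codeSize c + 1 ≤ codeSize c' ∧
    b + codeSize c + 1 ≤ codeSize c' ∧ codeBase c i = codeTrans T₁ T₂ a b (codeBase c' j)) ∧
    ∀ k < codeSize c, ∀ l < codeSize c, 1 < k → 1 < l →
      codeFill c i k l = codeFill c' j (a + k) (b + l)

/-- The point `x` has coordinates `(k, l)` in the interior of the square `j`. -/
def CodePos (c j k l x : ℕ) : Prop :=
  (j < codeNum c ∧ k < codeSize c ∧ l < codeSize c) ∧ 1 < k ∧ 1 < l ∧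
    x = codeTrans T₁ T₂ k l (codeBase c j)

/-- Admissible codes. -/
def CodeGood (X : Set ℕ) (c : ℕ) : Prop :=
  ∀ i < codeNum c, codeBase c i ∈ X ∧ Valid (codeSize c) (codeFill c i) ∧
    ∀ j < codeNum c, i = j ∨ CodeSep T₁ T₂ c i j

/-- `c'` is an admissible code of squares that cover `x` and the squares coded by `c`. -/
def CodeStep (X : Set ℕ) (c x c' : ℕ) : Prop :=
  CodeGood T₁ T₂ X c' ∧ (∀ i < codeNum c, ∃ j < codeNum c', CodeNest T₁ T₂ c i c' j) ∧
    (x ∈ X → ∃ j < codeNum c', ∃ k < codeSize c', ∃ l < codeSize c', CodePos T₁ T₂ c' j k l x)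

variable {T₁ T₂} {α : Type} [Primcodable α]

theorem computable_codeTrans (h₁ : Computable T₁) (h₂ : Computable T₂) {f g h : α → ℕ}
    (hf : Computable f) (hg : Computable g) (hh : Computable h) :
    Computable fun x => codeTrans T₁ T₂ (f x) (g x) (h x) :=
  computable_iterate h₁ hf (computable_iterate h₂ hg hh)

theorem computablePred_codeSep (h₁ : Computable T₁) (h₂ : Computable T₂) {f g h : α → ℕ}
    (hf : Computable f) (hg : Computable g) (hh : Computable h) :
    ComputablePred fun x => CodeSep T₁ T₂ (f x) (g x) (h x) := by
  unfold CodeSep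
  refine computablePred_forall_lt ?_ (by fun_prop)
  refine computablePred_forall_lt ?_ (by fun_prop)
  refine computablePred_forall_lt ?_ (by fun_prop)
  refine computablePred_forall_lt ?_ (by fun_prop)
  exact (computablePred_eq (computable_codeTrans h₁ h₂ (by fun_prop) (by fun_prop) (by fun_prop))
    (computable_codeTrans h₁ h₂ (by fun_prop) (by fun_prop) (by fun_prop))).not

theorem computablePred_codeNest (h₁ : Computable T₁) (h₂ : Computable T₂) {f g f' g' : α → ℕ}
    (hf : Computable f) (hg : Computable g) (hf' : Computable f') (hg' : Computable g') :
    ComputablePred fun x => CodeNest T₁ T₂ (f x) (g x) (f' x) (g' x) := by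
  unfold CodeNest
  refine computablePred_exists_lt ?_ (by fun_prop)
  refine computablePred_exists_lt ?_ (by fun_prop)
  refine computablePred_and ?_ ?_
  · refine computablePred_and (computablePred_le (by fun_prop) (by fun_prop)) ?_
    refine computablePred_and (computablePred_le (by fun_prop) (by fun_prop)) ?_
    refine computablePred_and (computablePred_le (by fun_prop) (by fun_prop)) ?_
    refine computablePred_and (computablePred_le (by fun_prop) (by fun_prop)) ?_
    exact computablePred_eq (by fun_prop)
      (computable_codeTrans h₁ h₂ (by fun_prop) (by fun_prop) (by fun_prop))
  · refine computablePred_forall_lt ?_ (by fun_prop)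
    refine computablePred_forall_lt ?_ (by fun_prop)
    refine computablePred_imp (computablePred_lt (by fun_prop) (by fun_prop)) ?_
    refine computablePred_imp (computablePred_lt (by fun_prop) (by fun_prop)) ?_
    exact computablePred_lab (· = ·) (by fun_prop) (by fun_prop)

theorem computablePred_codePos (h₁ : Computable T₁) (h₂ : Computable T₂) {f g h k x : α → ℕ}
    (hf : Computable f) (hg : Computable g) (hh : Computable h) (hk : Computable k)
    (hx : Computable x) :
    ComputablePred fun y => CodePos T₁ T₂ (f y) (g y) (h y) (k y) (x y) := by
  unfold CodePos
  refine computablePred_and (computablePred_and (computablePred_lt (by fun_prop) (by fun_prop))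
    (computablePred_and (computablePred_lt (by fun_prop) (by fun_prop))
      (computablePred_lt (by fun_prop) (by fun_prop)))) ?_
  refine computablePred_and (computablePred_lt (by fun_prop) (by fun_prop)) ?_
  refine computablePred_and (computablePred_lt (by fun_prop) (by fun_prop)) ?_
  exact computablePred_eq (by fun_prop)
    (computable_codeTrans h₁ h₂ (by fun_prop) (by fun_prop) (by fun_prop))

variable {X : Set ℕ}

theorem computablePred_codeGood (hX : ComputablePred fun m : ℕ => m ∈ X) (h₁ : Computable T₁)
    (h₂ : Computable T₂) {f : α → ℕ} (hf : Computable f) :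
    ComputablePred fun x => CodeGood T₁ T₂ X (f x) := by
  unfold CodeGood
  refine computablePred_forall_lt ?_ (by fun_prop)
  refine computablePred_and (computablePred_comp hX (by fun_prop)) ?_
  refine computablePred_and (computablePred_valid ?_ (by fun_prop)) ?_
  · fun_prop
  · refine computablePred_forall_lt ?_ (by fun_prop)
    exact computablePred_or (computablePred_eq (by fun_prop) (by fun_prop))
      (computablePred_codeSep h₁ h₂ (by fun_prop) (by fun_prop) (by fun_prop))

theorem computablePred_codeStep (hX : ComputablePred fun m : ℕ => m ∈ X) (h₁ : Computable T₁)
    (h₂ : Computable T₂) {f g h : α → ℕ} (hf : Computable f) (hg : Computable g)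
    (hh : Computable h) : ComputablePred fun x => CodeStep T₁ T₂ X (f x) (g x) (h x) := by
  unfold CodeStep
  refine computablePred_and (computablePred_codeGood hX h₁ h₂ hh) (computablePred_and ?_ ?_)
  · refine computablePred_forall_lt ?_ (by fun_prop)
    refine computablePred_exists_lt ?_ (by fun_prop)
    exact computablePred_codeNest h₁ h₂ (by fun_prop) (by fun_prop) (by fun_prop) (by fun_prop)
  · refine computablePred_imp (computablePred_comp hX (by fun_prop)) ?_
    refine computablePred_exists_lt ?_ (by fun_prop)
    refine computablePred_exists_lt ?_ (by fun_prop)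
    refine computablePred_exists_lt ?_ (by fun_prop)
    exact computablePred_codePos h₁ h₂ (by fun_prop) (by fun_prop) (by fun_prop) (by fun_prop)
      (by fun_prop)

end

end FramedSquares

/-! ### The computable construction -/

namespace FramedSquares

/-- A code stores a filling only up to the size of its square; admissibility reads no more. -/
theorem valid_congr {m : ℕ} {u v : ℕ → ℕ → Lab} (h : ∀ i < m, ∀ j < m, u i j = v i j)
    (hu : Valid m u) : Valid m v := by
  have : square m v = square m u := by
    funext p i j
    unfold square
    split_ifs
    · rfl
    · rfl
    · exact (h i (by lia) j (by lia)).symm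
  rw [Valid, this]
  exact hu

variable {X : Set ℕ} [AddAction (ℤ × ℤ) X] {T₁ T₂ : ℕ → ℕ}

theorem codeTrans_eq (h₁ : ∀ x : X, T₁ x = (((1, 0) : ℤ × ℤ) +ᵥ x : X))
    (h₂ : ∀ x : X, T₂ x = (((0, 1) : ℤ × ℤ) +ᵥ x : X)) (a b : ℕ) (x : X) :
    codeTrans T₁ T₂ a b x = (trans a b x : X) := by
  induction a with
  | zero =>
    induction b with
    | zero => rw [trans_zero]; rfl
    | succ b ih =>
      change T₂^[b + 1] x = _
      rw [Function.iterate_succ_apply', show T₂^[b] x = (trans 0 b x : X) from ih, h₂, trans,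
        vadd_vadd]
      congr 2
      ext <;> simp [add_comm]
  | succ a ih =>
    rw [codeTrans, Function.iterate_succ_apply', ← codeTrans, ih, h₁, trans, vadd_vadd]
    congr 2
    ext <;> simp [add_comm]

/-- The placed square with a given code. -/
noncomputable def codePlaced (c i : ℕ) (h : codeBase c i ∈ X) : Placed X :=
  ⟨⟨codeBase c i, h⟩, codeSize c, codeFill c i⟩

theorem codeSep_iff (h₁ : ∀ x : X, T₁ x = (((1, 0) : ℤ × ℤ) +ᵥ x : X))
    (h₂ : ∀ x : X, T₂ x = (((0, 1) : ℤ × ℤ) +ᵥ x : X)) {c i j : ℕ} (hi : codeBase c i ∈ X)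
    (hj : codeBase c j ∈ X) :
    CodeSep T₁ T₂ c i j ↔ (codePlaced c i hi).Sep (codePlaced c j hj) := by
  have key : ∀ a b i (hi : codeBase c i ∈ X), codeTrans T₁ T₂ a b (codeBase c i) =
      trans a b (codePlaced c i hi).base := fun a b i hi =>
    codeTrans_eq h₁ h₂ a b ⟨codeBase c i, hi⟩
  simp only [CodeSep, Placed.Sep, key _ _ i hi, key _ _ j hj, ne_eq, Subtype.ext_iff]
  have hs : ∀ k, k < codeSize c + 2 ↔ k ≤ codeSize c + 1 := fun k => Nat.lt_succ_iff
  simp only [hs]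
  rfl

theorem codeNest_iff (h₁ : ∀ x : X, T₁ x = (((1, 0) : ℤ × ℤ) +ᵥ x : X))
    (h₂ : ∀ x : X, T₂ x = (((0, 1) : ℤ × ℤ) +ᵥ x : X)) {c i c' j : ℕ} (hi : codeBase c i ∈ X)
    (hj : codeBase c' j ∈ X) :
    CodeNest T₁ T₂ c i c' j ↔ (codePlaced c i hi).Nest (codePlaced c' j hj) := by
  have key : ∀ a b, codeTrans T₁ T₂ a b (codeBase c' j) =
      trans a b (codePlaced c' j hj).base := fun a b =>
    codeTrans_eq h₁ h₂ a b ⟨codeBase c' j, hj⟩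
  constructor
  · rintro ⟨a, -, b, -, ⟨k1, k2, k3, k4, k5⟩, k6⟩
    refine ⟨a, b, k1, k2, k3, k4, Subtype.ext (k5.trans (key a b)), fun k l hk hk' hl hl' => ?_⟩
    exact k6 k hk' l hl' hk hl
  · rintro ⟨a, b, k1, k2, k3, k4, k5, k6⟩
    refine ⟨a, ?_, b, ?_, ⟨k1, k2, k3, k4, (congrArg Subtype.val k5).trans (key a b).symm⟩,
      fun k hk l hl hk' hl' => k6 k l hk' hk hl' hl⟩
    · change _ ≤ codeSize c' at k3
      lia
    · change _ ≤ codeSize c' at k4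
      lia

theorem CodePos.labels (h₁ : ∀ x : X, T₁ x = (((1, 0) : ℤ × ℤ) +ᵥ x : X))
    (h₂ : ∀ x : X, T₂ x = (((0, 1) : ℤ × ℤ) +ᵥ x : X)) {c j k l : ℕ} {x : X}
    (hj : codeBase c j ∈ X) (h : CodePos T₁ T₂ c j k l x) :
    (codePlaced c j hj).Labels x (codeFill c j k l) := by
  obtain ⟨⟨-, hk, hl⟩, hk', hl', hx⟩ := h
  exact ⟨k, l, hk', hk, hl', hl,
    Subtype.ext (hx.trans (codeTrans_eq h₁ h₂ k l ⟨codeBase c j, hj⟩)), rfl⟩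

/-- Guarantees that the search for the next family terminates: `exists_next_family` yields a family,
and `exists_code` a code for it. -/
theorem exists_codeStep (h₁ : ∀ x : X, T₁ x = (((1, 0) : ℤ × ℤ) +ᵥ x : X))
    (h₂ : ∀ x : X, T₂ x = (((0, 1) : ℤ × ℤ) +ᵥ x : X)) [Nonempty X] {c : ℕ}
    (hc : CodeGood T₁ T₂ X c) (x : ℕ) : ∃ c', CodeStep T₁ T₂ X c x c' := by
  classical
  -- A number outside `X` imposes no covering condition, so any point of `X` may stand in for it.
  let z : X := if h : x ∈ X then ⟨x, h⟩ else Classical.arbitrary X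
  have hz : x ∈ X → (z : ℕ) = x := fun h => by simp only [z, dif_pos h]
  obtain ⟨M, N, Q, hM, hv, hsep, hnest, j₀, l, k₁, k₂, hk₁, hk₁', hk₂, hk₂', hzl, -⟩ :=
    exists_next_family (P := fun i : Fin (codeNum c) => codePlaced c i (hc i i.2).1)
    (fun _ => rfl) (fun i => (hc i i.2).2.1)
    (fun i j hij => (codeSep_iff h₁ h₂ _ _).1 (((hc i i.2).2.2 j j.2).resolve_left
      fun h => hij (Fin.ext h))) z
  obtain ⟨c', hc1, hc2, hc3, hc4⟩ := exists_code M N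
    (fun i => if h : i < N then ((Q ⟨i, h⟩).base : ℕ) else 0)
    (fun i => if h : i < N then (Q ⟨i, h⟩).fill else fun _ _ => default)
  replace hc3 : ∀ i : Fin N, codeBase c' i = (Q i).base := fun i => by
    rw [hc3 i i.2, dif_pos i.2]
  replace hc4 : ∀ i : Fin N, ∀ a < M, ∀ b < M, codeFill c' i a b = (Q i).fill a b :=
    fun i a ha b hb => by rw [hc4 i i.2 a ha b hb, dif_pos i.2]
  have hX : ∀ i : Fin N, codeBase c' i ∈ X := fun i => by rw [hc3]; exact Subtype.coe_prop _
  have hbase : ∀ i : Fin N, (codePlaced c' i (hX i)).base = (Q i).base :=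
    fun i => Subtype.ext (hc3 i)
  refine ⟨c', ?_, ?_, fun hx => ?_⟩
  · intro i hi
    rw [hc2] at hi
    refine ⟨hX ⟨i, hi⟩, ?_, fun j hj => ?_⟩
    · refine valid_congr (u := (Q ⟨i, hi⟩).fill) ?_ ?_
      · rw [hc1]
        exact fun a ha b hb => (hc4 ⟨i, hi⟩ a ha b hb).symm
      · rw [hc1, ← hM ⟨i, hi⟩]
        exact hv _
    · rw [hc2] at hj
      refine or_iff_not_imp_left.2 fun hij => (codeSep_iff h₁ h₂ (hX ⟨i, hi⟩) (hX ⟨j, hj⟩)).2 ?_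
      have := hsep ⟨i, hi⟩ ⟨j, hj⟩ fun h => hij (Fin.ext_iff.1 h)
      unfold Placed.Sep at this ⊢
      rw [hM, hM, ← hbase, ← hbase, ← hc1] at this
      exact this
  · intro i hi
    obtain ⟨j, a, b, k1, k2, k3, k4, k5, k6⟩ := hnest ⟨i, hi⟩
    rw [hM] at k3 k4
    refine ⟨j, hc2 ▸ j.2, (codeNest_iff h₁ h₂ (hc i hi).1 (hX j)).2 ⟨a, b, k1, k2, ?_, ?_, ?_,
      fun k l hk hk' hl hl' => ?_⟩⟩
    · exact k3.trans hc1.ge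
    · exact k4.trans hc1.ge
    · rw [hbase]
      exact k5
    · refine (k6 k l hk hk' hl hl').trans (hc4 j _ ?_ _ ?_).symm <;> lia
  · rw [hM] at hk₁' hk₂'
    refine ⟨j₀, hc2 ▸ j₀.2, k₁, hc1 ▸ hk₁', k₂, hc1 ▸ hk₂',
      ⟨hc2 ▸ j₀.2, hc1 ▸ hk₁', hc1 ▸ hk₂'⟩, hk₁, hk₂, ?_⟩
    rw [← hz hx, hzl, ← hbase]
    exact (codeTrans_eq h₁ h₂ k₁ k₂ _).symm

/-- Computable free actions of `ℤ²` have computable tilings. -/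
theorem exists_computable_tiling (hfree : IsFreeAction (ℤ × ℤ) X)
    (hX : ComputablePred fun m : ℕ => m ∈ X) (hT₁ : Computable T₁) (hT₂ : Computable T₂)
    (h₁ : ∀ x : X, T₁ x = (((1, 0) : ℤ × ℤ) +ᵥ x : X))
    (h₂ : ∀ x : X, T₂ x = (((0, 1) : ℤ × ℤ) +ᵥ x : X)) :
    ∃ f : X → Lab, IsComputableLabeling f ∧ ∀ x, IsTilingAt f x := by
  classical
  rcases isEmpty_or_nonempty X with hE | hE
  · exact ⟨fun _ => default, ⟨⟨Encodable.encode, Encodable.encode_injective⟩, fun _ => 0,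
      Computable.const 0, fun x => (IsEmpty.false x).elim⟩, fun x => (IsEmpty.false x).elim⟩
  -- Inadmissible codes are answered at once, which makes the search total. The sequence `σ` never
  -- meets them.
  have hnext : ∀ p : ℕ × ℕ, ∃ c', ¬ CodeGood T₁ T₂ X p.1 ∨ CodeStep T₁ T₂ X p.1 p.2 c' := fun p => by
    by_cases hp : CodeGood T₁ T₂ X p.1
    · exact (exists_codeStep h₁ h₂ hp p.2).imp fun _ h => Or.inr h
    · exact ⟨0, Or.inl hp⟩
  have hcomp : Computable fun p => Nat.find (hnext p) := Computable.find (computablePred_or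
    (computablePred_codeGood hX hT₁ hT₂ (by fun_prop)).not
    (computablePred_codeStep hX hT₁ hT₂ (by fun_prop) (by fun_prop) (by fun_prop))) hnext
  obtain ⟨c₀, -, hc₀, -, -⟩ := exists_code 0 0 0 (fun _ _ _ => default)
  -- The step from `s` to `s + 1` takes care of the point `s`; hence `x` is covered at stage `x +
  -- 1`.
  let σ : ℕ → ℕ := fun s => Nat.rec c₀ (fun s c => Nat.find (hnext (c, s))) s
  have hσ : Computable σ := Computable.nat_rec (h := fun _ y => Nat.find (hnext (y.2, y.1)))
    Computable.id (Computable.const c₀)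
    (hcomp.comp ((Computable.snd.comp Computable.snd).pair (Computable.fst.comp Computable.snd)))
  have hgood : ∀ s, CodeGood T₁ T₂ X (σ s) := fun s => by
    induction s with
    | zero =>
      intro i hi
      change i < codeNum c₀ at hi
      lia
    | succ s ih => exact ((Nat.find_spec (hnext (σ s, s))).resolve_left (not_not.2 ih)).1
  have hstep : ∀ s, CodeStep T₁ T₂ X (σ s) s (σ (s + 1)) := fun s =>
    (Nat.find_spec (hnext (σ s, s))).resolve_left (not_not.2 (hgood s))
  let F : ℕ → Set (Placed X) := fun s =>
    {P | ∃ i, ∃ hi : i < codeNum (σ s), P = codePlaced (σ s) i (hgood s i hi).1}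
  have hFsep : ∀ s, ∀ P ∈ F s, ∀ Q ∈ F s, P = Q ∨ P.Sep Q := by
    rintro s P ⟨i, hi, rfl⟩ Q ⟨j, hj, rfl⟩
    rcases (hgood s i hi).2.2 j hj with rfl | h
    · exact Or.inl rfl
    · exact Or.inr ((codeSep_iff h₁ h₂ _ _).1 h)
  have hFnest : ∀ s k, ∀ P ∈ F s, ∃ Q ∈ F (s + k), P = Q ∨ P.Nest Q := by
    intro s k P hP
    induction k with
    | zero => exact ⟨P, hP, Or.inl rfl⟩
    | succ k ih =>
      obtain ⟨Q, ⟨i, hi, rfl⟩, hPQ⟩ := ih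
      obtain ⟨j, hj, hn⟩ := (hstep (s + k)).2.1 i hi
      rw [codeNest_iff h₁ h₂ (hgood _ i hi).1 (hgood (s + k + 1) j hj).1] at hn
      refine ⟨_, ⟨j, hj, rfl⟩, Or.inr ?_⟩
      rcases hPQ with rfl | hPQ
      · exact hn
      · exact hPQ.trans hn
  -- An earlier square is equal to or nested in some square of the later family, which is equal to
  -- or separated from `Q`.
  have hcompat : ∀ s k, ∀ P ∈ F s, ∀ Q ∈ F (s + k), P.Compat Q := by
    intro s k P hP Q hQ
    obtain ⟨P', hP', hPP'⟩ := hFnest s k P hP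
    rcases hFsep _ P' hP' Q hQ with rfl | h
    · rcases hPP' with rfl | hn
      · exact Or.inl rfl
      · exact Or.inr (Or.inr (Or.inl hn))
    · rcases hPP' with rfl | hn
      · exact Or.inr (Or.inl h)
      · exact Or.inr (Or.inl (hn.sep h))
  obtain ⟨f, hf1, hf2⟩ := exists_labelling hfree (S := ⋃ s, F s)
    (fun P hP => by
      obtain ⟨s, i, hi, rfl⟩ := Set.mem_iUnion.1 hP
      exact (hgood s i hi).2.1)
    (fun P hP Q hQ => by
      obtain ⟨s, hs⟩ := Set.mem_iUnion.1 hP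
      obtain ⟨t, ht⟩ := Set.mem_iUnion.1 hQ
      rcases le_total s t with h | h
      · obtain ⟨k, rfl⟩ := Nat.exists_eq_add_of_le h
        exact hcompat s k P hs Q ht
      · obtain ⟨k, rfl⟩ := Nat.exists_eq_add_of_le h
        exact (hcompat t k Q ht P hs).symm)
  -- The labelling `f` comes from choice, but its value at `x` is already stored in the code at
  -- stage `x + 1`. Searching for the coordinates of `x` there computes it.
  have hpos : ∀ x, ∃ n, x ∉ X ∨ CodePos T₁ T₂ (σ (x + 1)) (Nat.unpair n).1
      (Nat.unpair (Nat.unpair n).2).1 (Nat.unpair (Nat.unpair n).2).2 x := fun x => by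
    by_cases hx : x ∈ X
    · obtain ⟨j, -, k, -, l, -, h⟩ := (hstep x).2.2 hx
      refine ⟨Nat.pair j (Nat.pair k l), Or.inr ?_⟩
      simpa only [Nat.unpair_pair] using h
    · exact ⟨0, Or.inl hx⟩
  have hposc : Computable fun x => Nat.find (hpos x) := Computable.find (computablePred_or
    (computablePred_comp hX (by fun_prop)).not
    (computablePred_codePos hT₁ hT₂ (by fun_prop) (by fun_prop) (by fun_prop) (by fun_prop)
      (by fun_prop))) hpos
  have hspec : ∀ x : X, CodePos T₁ T₂ (σ (x + 1)) (Nat.unpair (Nat.find (hpos x))).1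
      (Nat.unpair (Nat.unpair (Nat.find (hpos x))).2).1
      (Nat.unpair (Nat.unpair (Nat.find (hpos x))).2).2 x := fun x =>
    (Nat.find_spec (hpos x)).resolve_left (not_not.2 x.2)
  have hlab : ∀ x : X, ∃ P ∈ ⋃ s, F s, P.Labels x (codeFill (σ (x + 1))
      (Nat.unpair (Nat.find (hpos x))).1 (Nat.unpair (Nat.unpair (Nat.find (hpos x))).2).1
      (Nat.unpair (Nat.unpair (Nat.find (hpos x))).2).2) := fun x =>
    ⟨_, Set.mem_iUnion.2 ⟨x + 1, _, (hspec x).1.1, rfl⟩, (hspec x).labels h₁ h₂ _⟩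
  refine ⟨f, ⟨⟨Encodable.encode, Encodable.encode_injective⟩, fun x =>
    Encodable.encode (codeFill (σ (x + 1)) (Nat.unpair (Nat.find (hpos x))).1
      (Nat.unpair (Nat.unpair (Nat.find (hpos x))).2).1
      (Nat.unpair (Nat.unpair (Nat.find (hpos x))).2).2), Computable.encode.comp (by fun_prop),
      fun x => ?_⟩, fun x => hf2 x fun v => ?_⟩
  · obtain ⟨P, hP, h⟩ := hlab x
    rw [hf1 P hP x _ h]
    rfl
  · obtain ⟨P, hP, h⟩ := hlab (v +ᵥ x)
    exact ⟨P, hP, _, h⟩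

end FramedSquares

/-! ### Membership in `COMPUTABLE` -/

namespace FramedSquares

variable {Γ : Type} [AddGroup Γ] {e : ℤ × ℤ →+ Γ}

theorem isFreeAction_compHom (he : Function.Injective e) {X : Type} [AddAction Γ X]
    (h : IsFreeAction Γ X) :
    @IsFreeAction (ℤ × ℤ) X _ (AddAction.compHom X e) :=
  fun v hv x => h (e v) (fun h0 => hv (he (h0.trans e.map_zero.symm))) x

theorem tilingLCL_mem_COMPUTABLE (he : Function.Injective e) : tilingLCL e ∈ COMPUTABLE Γ := by
  intro X _ hX hcomp hfree
  let _ : AddAction (ℤ × ℤ) X := AddAction.compHom X e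
  obtain ⟨T₁, hT₁, h₁⟩ := hcomp (e (1, 0))
  obtain ⟨T₂, hT₂, h₂⟩ := hcomp (e (0, 1))
  obtain ⟨f, hf, ht⟩ := exists_computable_tiling (isFreeAction_compHom he hfree) hX hT₁ hT₂ h₁ h₂
  exact ⟨f, hf, (isSolution_tilingLCL_iff e f).2 ht⟩

end FramedSquares

/-! ### Squares within one orbit -/

namespace FramedSquares

namespace Placed

variable {X : Type} [AddAction (ℤ × ℤ) X]

/-- The image in the orbit of `x` of a square in the plane. -/
def inOrbit (P : Placed (ℤ × ℤ)) (x : X) : Placed X := ⟨P.base +ᵥ x, P.size, P.fill⟩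

theorem trans_vadd (i j : ℕ) (v : ℤ × ℤ) (x : X) :
    FramedSquares.trans i j (v +ᵥ x) = FramedSquares.trans i j v +ᵥ x := by
  simp only [FramedSquares.trans, vadd_vadd, vadd_eq_add]

theorem Nest.inOrbit {P Q : Placed (ℤ × ℤ)} (h : P.Nest Q) (x : X) :
    (P.inOrbit x).Nest (Q.inOrbit x) := by
  obtain ⟨a, b, h1, h2, h3, h4, h5, h6⟩ := h
  refine ⟨a, b, h1, h2, h3, h4, ?_, h6⟩
  change P.base +ᵥ x = _
  rw [h5, ← trans_vadd]
  rfl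

theorem compat_of_inOrbit (hfree : IsFreeAction (ℤ × ℤ) X) {P Q : Placed (ℤ × ℤ)} {x : X}
    (h : (P.inOrbit x).Compat (Q.inOrbit x)) : P.Compat Q := by
  have hn : ∀ {P Q : Placed (ℤ × ℤ)}, (P.inOrbit x).Nest (Q.inOrbit x) → P.Nest Q := by
    rintro P Q ⟨a, b, h1, h2, h3, h4, h5, h6⟩
    refine ⟨a, b, h1, h2, h3, h4, vadd_left_cancel_of_free hfree (x := x) ?_, h6⟩
    rw [← trans_vadd]
    exact h5
  rcases h with h | h | h | h
  · refine Or.inl (Placed.ext (vadd_left_cancel_of_free hfree (x := x) (congrArg base h)) ?_ ?_)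
    · exact (congrArg size h :)
    · exact (congrArg fill h :)
  · refine Or.inr (Or.inl fun i hi j hj k hk l hl heq => h i hi j hj k hk l hl ?_)
    change FramedSquares.trans i j (P.base +ᵥ x) = FramedSquares.trans k l (Q.base +ᵥ x)
    rw [trans_vadd, heq, ← trans_vadd]
  · exact Or.inr (Or.inr (Or.inl (hn h)))
  · exact Or.inr (Or.inr (Or.inr (hn h)))

theorem Nest.size_lt {P Q : Placed X} (h : P.Nest Q) : P.size < Q.size := by
  obtain ⟨a, b, h1, h2, h3, h4, h5, h6⟩ := h
  lia

end Placed

/-- Finitely many compatible framed squares in the plane can be put into a larger one, which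
covers the origin. -/
theorem exists_enclosing {H : Set (Placed (ℤ × ℤ))} (hH : H.Finite)
    (hv : ∀ P ∈ H, Valid P.size P.fill) (hc : ∀ P ∈ H, ∀ Q ∈ H, P.Compat Q) :
    ∃ Q : Placed (ℤ × ℤ), Valid Q.size Q.fill ∧ Q.Covers 0 ∧ ∀ P ∈ H, P.Nest Q := by
  obtain ⟨R, hR⟩ : ∃ R : ℕ, ∀ P ∈ H, |P.base.1| ≤ R ∧ |P.base.2| ≤ R ∧ P.size ≤ R := by
    obtain ⟨R, hR⟩ := (hH.image fun P => P.base.1.natAbs + P.base.2.natAbs + P.size).bddAbove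
    refine ⟨R, fun P hP => ?_⟩
    have := hR (Set.mem_image_of_mem _ hP)
    beta_reduce at this
    rw [abs_le, abs_le]
    lia
  -- Only squares not nested in another one are inserted; compatibility separates them pairwise. The
  -- origin gets coordinates `(4 * R + 10, R + 2)`, which places every square of the family below
  -- the diagonal and within the size `6 * R + 20`.
  obtain ⟨U, hU, hn⟩ := exists_nest
    (P := fun i : {P : Placed (ℤ × ℤ) // P ∈ H ∧ ∀ Q ∈ H, ¬ P.Nest Q} => i.1)
    (fun i => hv i i.2.1)
    (fun i j hij => by
      rcases hc i i.2.1 j j.2.1 with h | h | h | h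
      · exact absurd (Subtype.ext h) hij
      · exact h
      · exact absurd h (i.2.2 j j.2.1)
      · exact absurd h (j.2.2 i i.2.1))
    (M := 6 * R + 20) (by lia) (-((4 * R + 10 : ℕ) : ℤ), -((R + 2 : ℕ) : ℤ)) (fun i => by
      obtain ⟨h1, h2, h3⟩ := hR i i.2.1
      rw [abs_le] at h1 h2
      obtain ⟨a, ha⟩ := Int.eq_ofNat_of_zero_le (a := i.1.base.1 + (4 * R + 10)) (by lia)
      obtain ⟨b, hb⟩ := Int.eq_ofNat_of_zero_le (a := i.1.base.2 + (R + 2)) (by lia)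
      refine ⟨a, b, ?_, by lia, by lia, by lia⟩
      simp only [trans, vadd_eq_add, Prod.mk_add_mk]
      ext
      · change i.1.base.1 = a + -((4 * R + 10 : ℕ) : ℤ)
        lia
      · change i.1.base.2 = b + -((R + 2 : ℕ) : ℤ)
        lia)
  refine ⟨⟨(-((4 * R + 10 : ℕ) : ℤ), -((R + 2 : ℕ) : ℤ)), 6 * R + 20, U⟩, hU, ⟨_, 4 * R + 10, R + 2, by lia, ?_, by lia, ?_, ?_, rfl⟩, fun P hP => ?_⟩
  · change _ < 6 * R + 20
    lia
  · change _ < 6 * R + 20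
    lia
  · simp only [trans, vadd_eq_add, Prod.mk_add_mk, add_neg_cancel, Prod.mk_zero_zero]
  -- The other squares are handled through a largest square containing them: nesting increases size,
  -- so that one is among the inserted squares.
  · obtain ⟨Q, ⟨hQ, hPQ⟩, hmax⟩ := Set.exists_max_image {Q | Q ∈ H ∧ (P = Q ∨ P.Nest Q)}
      Placed.size (hH.subset fun Q hQ => hQ.1) ⟨P, hP, Or.inl rfl⟩
    have hQn := hn ⟨Q, hQ, fun Q' hQ' hn' => by
      refine absurd (hmax Q' ⟨hQ', Or.inr ?_⟩) (not_le.2 hn'.size_lt)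
      rcases hPQ with rfl | h
      · exact hn'
      · exact h.trans hn'⟩
    rcases hPQ with rfl | h
    · exact hQn
    · exact h.trans hQn

end FramedSquares

/-! ### Tame families in the shift -/

namespace FramedSquares

/-- Otherwise the translates of `δ` by multiples of `γ` would be infinitely many elements of `A`. -/
theorem eq_zero_of_finite_of_add_mem {Γ : Type} [AddCommGroup Γ] [IsAddTorsionFree Γ] {A : Set Γ}
    (hA : A.Finite) {δ γ : Γ} (hδ : δ ∈ A) (h : ∀ δ ∈ A, δ + γ ∈ A) : γ = 0 := by
  by_contra hγ
  have hmem : ∀ k : ℕ, δ + k • γ ∈ A := fun k => by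
    induction k with
    | zero => simpa using hδ
    | succ k ih =>
      rw [succ_nsmul, ← add_assoc]
      exact h _ ih
  refine Set.infinite_of_injective_forall_mem (f := fun k : ℕ => δ + k • γ) (fun k l hkl => ?_)
    hmem hA
  have h : ((k : ℤ) - l) • γ = 0 := by
    rw [sub_smul, natCast_zsmul, natCast_zsmul, add_left_cancel hkl, sub_self]
  rw [IsAddTorsionFree.zsmul_eq_zero_iff_left hγ] at h
  lia

/-- A basic neighbourhood restricts finitely many coordinates. The point is extended by `0`, with a
single `1` outside to make the support nonempty; a finite nonempty support admits no period. -/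
theorem exists_finite_support_mem {Γ : Type} [AddCommGroup Γ] [IsAddTorsionFree Γ] [Infinite Γ]
    {U : Set (FreePart (Fin 2) Γ)}    (hU : IsOpen U) (hne : U.Nonempty) : ∃ z ∈ U, (Function.support z.1).Finite ∧ (Function.support z.1).Nonempty := by
  classical
  obtain ⟨x, hx⟩ := hne
  obtain ⟨V, hV, rfl⟩ := isOpen_induced_iff.1 hU
  obtain ⟨I, u, hu, hIV⟩ := isOpen_pi_iff.1 hV x.1 hx
  obtain ⟨γ, hγ⟩ := Infinite.exists_notMem_finset I
  let z : Γ → Fin 2 := fun δ => if δ ∈ I then x.1 δ else if δ = γ then 1 else 0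
  have hsupp : (Function.support z).Finite := by
    refine (insert γ I).finite_toSet.subset fun δ hδ => ?_
    rw [Function.mem_support] at hδ
    simp only [z] at hδ
    rw [Finset.mem_coe, Finset.mem_insert]
    by_contra hcon
    push Not at hcon
    rw [if_neg hcon.2, if_neg hcon.1] at hδ
    exact hδ rfl
  have hzγ : γ ∈ Function.support z := by
    rw [Function.mem_support]
    rw [show z γ = 1 from (if_neg hγ).trans (if_pos rfl)]
    decide
  refine ⟨⟨z, fun α hα h => hα ?_⟩, hIV fun δ hδ => ?_, hsupp, γ, hzγ⟩
  · refine neg_eq_zero.1 (eq_zero_of_finite_of_add_mem hsupp hzγ fun δ hδ => ?_)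
    have := congrFun h (δ + -α)
    rw [shift, neg_add_cancel_right] at this
    rwa [Function.mem_support, ← this]
  · have : z δ = x.1 δ := if_pos hδ
    change z δ ∈ u δ
    rw [this]
    exact (hu δ hδ).2

variable {Γ : Type} [AddCommGroup Γ] [AddAction (ℤ × ℤ) (FreePart (Fin 2) Γ)]

/-- Families of framed squares in the free part of the shift that are built in finitely many
steps: the squares are described by a finite part of the points, and only finitely many of them
are in the orbit of a point with finite support. -/
structure IsTame (S : Set (Placed (FreePart (Fin 2) Γ))) : Prop where
  valid : ∀ P ∈ S, Valid P.size P.fill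
  compat : ∀ P ∈ S, ∀ Q ∈ S, P.Compat Q
  bounded : ∃ N, ∀ P ∈ S, P.size ≤ N
  isLocal : ∃ K : Finset Γ, ∀ x y : FreePart (Fin 2) Γ, (∀ δ ∈ K, x.1 δ = y.1 δ) →
    ∀ m u, ⟨x, m, u⟩ ∈ S → ⟨y, m, u⟩ ∈ S
  finite_hits : ∀ z : FreePart (Fin 2) Γ, (Function.support z.1).Finite →
    {P : Placed (ℤ × ℤ) | P.inOrbit z ∈ S}.Finite

theorem isTame_empty : IsTame (∅ : Set (Placed (FreePart (Fin 2) Γ))) where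
  valid := by simp
  compat := by simp
  bounded := by simp
  isLocal := by simp
  finite_hits := by simp

/-- Choose `z ∈ U` of finite support and enclose the finitely many squares in its orbit by one
square `Q` around `z`. A copy of `Q` is then placed at every `y` that agrees with `z` on a large
finite set `K'`. Locality makes the old squares near `y` the same as those near `z`, and the finite
support of `z` keeps different copies apart. -/
theorem IsTame.exists_extension [IsAddTorsionFree Γ] [Infinite Γ] {e : ℤ × ℤ →+ Γ}
    (he : Function.Injective e)
    (hact : ∀ (v : ℤ × ℤ) (x : FreePart (Fin 2) Γ) δ, (v +ᵥ x).1 δ = x.1 (δ + e v))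
    (hfree : IsFreeAction (ℤ × ℤ) (FreePart (Fin 2) Γ))
    {S : Set (Placed (FreePart (Fin 2) Γ))} (hS : IsTame S) {U : Set (FreePart (Fin 2) Γ)}
    (hU : IsOpen U) (hne : U.Nonempty) :
    ∃ S', S ⊆ S' ∧ IsTame S' ∧ ∃ y ∈ U, ∃ P ∈ S', P.Covers y := by
  classical
  obtain ⟨z, hzU, hz, δ₀, hδ₀⟩ := exists_finite_support_mem hU hne
  obtain ⟨N, hN⟩ := hS.bounded
  obtain ⟨K, hK⟩ := hS.isLocal
  obtain ⟨Q, hQv, hQ0, hQ⟩ := exists_enclosing (hS.finite_hits z hz) (fun P hP => hS.valid _ hP)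
    fun P hP P' hP' => Placed.compat_of_inOrbit hfree (hS.compat _ hP _ hP')
  -- All displacements between base points of squares that touch, for sizes up to `N` and `Q.size`.
  let W : Finset (ℤ × ℤ) := ((Finset.range (N + Q.size + 2)) ×ˢ (Finset.range (N + Q.size + 2)) ×ˢ
    (Finset.range (N + Q.size + 2)) ×ˢ (Finset.range (N + Q.size + 2))).image
      fun p => ((p.2.2.1 : ℤ) - p.1, (p.2.2.2 : ℤ) - p.2.1)
  have hW : ∀ i ≤ N + Q.size + 1, ∀ j ≤ N + Q.size + 1, ∀ k ≤ N + Q.size + 1,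
      ∀ l ≤ N + Q.size + 1, ((k : ℤ) - i, (l : ℤ) - j) ∈ W := fun i hi j hj k hk l hl =>
    Finset.mem_image.2 ⟨(i, j, k, l), by simp only [Finset.mem_product, Finset.mem_range]; lia, rfl⟩
  have htrans : ∀ {i j k l : ℕ} {x y : FreePart (Fin 2) Γ}, trans i j x = trans k l y →
      x = ((k : ℤ) - i, (l : ℤ) - j) +ᵥ y := fun {i j k l x y} h => by
    rw [eq_neg_vadd_iff.2 h, trans, vadd_vadd]
    congr 1
    ext <;> simp <;> ring
  -- The support of `z` and its translates by `W` separate distinct copies of `Q`. The translates of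
  -- `K` transfer old squares near `y` to the orbit of `z`.
  let K' : Finset Γ := hz.toFinset ∪ ((W ×ˢ hz.toFinset).image fun p => p.2 + e p.1) ∪
    ((W ×ˢ K).image fun p => p.2 + e (p.1 + Q.base))
  have hK'z : ∀ δ, z.1 δ ≠ 0 → δ ∈ K' := fun δ hδ =>
    Finset.mem_union_left _ (Finset.mem_union_left _ (hz.mem_toFinset.2 hδ))
  have hK'W : ∀ w ∈ W, ∀ δ, z.1 δ ≠ 0 → δ + e w ∈ K' := fun w hw δ hδ =>
    Finset.mem_union_left _ (Finset.mem_union_right _ (Finset.mem_image.2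
      ⟨(w, δ), Finset.mem_product.2 ⟨hw, hz.mem_toFinset.2 hδ⟩, rfl⟩))
  have hK'K : ∀ w ∈ W, ∀ δ ∈ K, δ + e (w + Q.base) ∈ K' := fun w hw δ hδ =>
    Finset.mem_union_right _ (Finset.mem_image.2 ⟨(w, δ), Finset.mem_product.2 ⟨hw, hδ⟩, rfl⟩)
  -- An old square touching the copy at `y` corresponds by locality to an old square in the orbit of
  -- `z`, which is nested in `Q`.
  have hold : ∀ P ∈ S, ∀ y : FreePart (Fin 2) Γ, (∀ δ ∈ K', y.1 δ = z.1 δ) →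
      P.Compat (Q.inOrbit y) := by
    intro P hP y hy
    by_cases hsep : P.Sep (Q.inOrbit y)
    · exact Or.inr (Or.inl hsep)
    unfold Placed.Sep at hsep
    push Not at hsep
    obtain ⟨i, hi, j, hj, k, hk, l, hl, h⟩ := hsep
    have hPN := hN P hP
    change k ≤ Q.size + 1 at hk
    change l ≤ Q.size + 1 at hl
    have hw := hW i (by lia) j (by lia) k (by lia) l (by lia)
    have hbase := htrans h
    set w : ℤ × ℤ := ((k : ℤ) - i, (l : ℤ) - j)
    change P.base = w +ᵥ (Q.base +ᵥ y) at hbase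
    rw [vadd_vadd] at hbase
    have hPS : (⟨w + Q.base, P.size, P.fill⟩ : Placed (ℤ × ℤ)).inOrbit z ∈ S := by
      refine hK P.base _ (fun δ hδ => ?_) _ _ hP
      rw [hbase, hact, hact]
      exact hy _ (hK'K w hw δ hδ)
    have hn := (hQ _ hPS).inOrbit y
    have hPe : P = (⟨w + Q.base, P.size, P.fill⟩ : Placed (ℤ × ℤ)).inOrbit y :=
      Placed.ext hbase rfl rfl
    rw [hPe]
    exact Or.inr (Or.inr (Or.inl hn))
  -- If two copies touch, then `y` is a translate of `y'` by some `w ∈ W`. As both look like `z` on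
  -- `K'`, the support of `z` is mapped into itself by `e w`, hence `w = 0`.
  have hnew : ∀ y y' : FreePart (Fin 2) Γ, (∀ δ ∈ K', y.1 δ = z.1 δ) →
      (∀ δ ∈ K', y'.1 δ = z.1 δ) → (Q.inOrbit y).Compat (Q.inOrbit y') := by
    intro y y' hy hy'
    by_cases hsep : (Q.inOrbit y).Sep (Q.inOrbit y')
    · exact Or.inr (Or.inl hsep)
    unfold Placed.Sep at hsep
    push Not at hsep
    obtain ⟨i, hi, j, hj, k, hk, l, hl, h⟩ := hsep
    change i ≤ Q.size + 1 at hi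
    change j ≤ Q.size + 1 at hj
    change k ≤ Q.size + 1 at hk
    change l ≤ Q.size + 1 at hl
    have hw := hW i (by lia) j (by lia) k (by lia) l (by lia)
    have hbase := htrans h
    set w : ℤ × ℤ := ((k : ℤ) - i, (l : ℤ) - j)
    change Q.base +ᵥ y = w +ᵥ (Q.base +ᵥ y') at hbase
    rw [vadd_vadd, add_comm, ← vadd_vadd, vadd_left_cancel_iff] at hbase
    have hew : e w = 0 := by
      refine eq_zero_of_finite_of_add_mem hz hδ₀ fun δ hδ => ?_
      rw [Function.mem_support] at hδ ⊢
      rw [← hy' _ (hK'W w hw δ hδ), ← hact, ← hbase, hy _ (hK'z δ hδ)]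
      exact hδ
    have hw0 : w = 0 := he (hew.trans e.map_zero.symm)
    rw [hw0, zero_vadd] at hbase
    exact Or.inl (by rw [hbase])
  refine ⟨S ∪ {P | ∃ y : FreePart (Fin 2) Γ, (∀ δ ∈ K', y.1 δ = z.1 δ) ∧ P = Q.inOrbit y},
    Set.subset_union_left, ⟨?_, ?_, ?_, ?_, ?_⟩, z, hzU, Q.inOrbit z,
    Or.inr ⟨z, fun _ _ => rfl, rfl⟩, ?_⟩
  · rintro P (hP | ⟨y, hy, rfl⟩)
    · exact hS.valid P hP
    · exact hQv
  · rintro P (hP | ⟨y, hy, rfl⟩) P' (hP' | ⟨y', hy', rfl⟩)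
    · exact hS.compat P hP P' hP'
    · exact hold P hP y' hy'
    · exact (hold P' hP' y hy).symm
    · exact hnew y y' hy hy'
  · refine ⟨N + Q.size, ?_⟩
    rintro P (hP | ⟨y, hy, rfl⟩)
    · exact (hN P hP).trans (Nat.le_add_right _ _)
    · exact Nat.le_add_left _ _
  · refine ⟨K ∪ K'.image fun δ => δ - e Q.base, fun x x' hx m u h => ?_⟩
    rcases h with h | ⟨y, hy, h⟩
    · exact Or.inl (hK x x' (fun δ hδ => hx δ (Finset.mem_union_left _ hδ)) m u h)
    · obtain ⟨rfl, rfl, rfl⟩ := Placed.mk.inj h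
      refine Or.inr ⟨-Q.base +ᵥ x', fun δ hδ => ?_, Placed.ext (vadd_neg_vadd _ _).symm rfl rfl⟩
      rw [hact, map_neg, ← sub_eq_add_neg,
        ← hx _ (Finset.mem_union_right _ (Finset.mem_image_of_mem _ hδ)), hact, sub_add_cancel]
      exact hy δ hδ
  -- A copy of `Q` in the orbit of `z'` forces `z'` to be nonzero at the translate of `δ₀` belonging
  -- to it, which leaves finitely many positions.
  · intro z' hz'
    refine ((hS.finite_hits z' hz').union ((hz'.preimage
      (f := fun v : ℤ × ℤ => δ₀ + e (v - Q.base)) ?_).image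
        fun v => (⟨v, Q.size, Q.fill⟩ : Placed (ℤ × ℤ)))).subset ?_
    · intro v _ v' _ h
      exact sub_left_injective (he (add_left_cancel h))
    · rintro P (hP | ⟨y, hy, h⟩)
      · exact Or.inl hP
      · refine Or.inr ⟨P.base, ?_, ?_⟩
        · have hb : P.base +ᵥ z' = Q.base +ᵥ y := (congrArg Placed.base h :)
          change z'.1 (δ₀ + e (P.base - Q.base)) ≠ 0
          rw [sub_eq_add_neg, add_comm P.base, map_add, ← add_assoc, ← hact, hb, ← hact,
            neg_vadd_vadd, hy _ (hK'z _ hδ₀)]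
          exact hδ₀
        · exact Placed.ext rfl (congrArg Placed.size h :).symm (congrArg Placed.fill h :).symm
  · obtain ⟨l, i, j, h1, h2, h3, h4, h5, h6⟩ := hQ0
    refine ⟨l, i, j, h1, h2, h3, h4, ?_, h6⟩
    change z = trans i j (Q.base +ᵥ z)
    rw [Placed.trans_vadd, ← h5, zero_vadd]

end FramedSquares

/-! ### The Baire measurable tiling -/

namespace FramedSquares

/-- A representative of each orbit is chosen and the parity of the first coordinate relative to it
is used. No regularity is needed, because this is applied only on a meagre set. -/
theorem exists_alternating {X : Type} [AddAction (ℤ × ℤ) X] (hfree : IsFreeAction (ℤ × ℤ) X) :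
    ∃ c : X → Bool, ∀ x, c x ≠ c (((1, 0) : ℤ × ℤ) +ᵥ x) := by
  let r : X → X := fun x =>
    (Quotient.mk (AddAction.orbitRel (ℤ × ℤ) X) x).out
  have hr : ∀ x, ∃ v : ℤ × ℤ, v +ᵥ r x = x := fun x =>
    (AddAction.orbitRel (ℤ × ℤ) X).symm (Quotient.mk_out x)
  have hrv : ∀ (v : ℤ × ℤ) x, r (v +ᵥ x) = r x := fun v x =>
    congrArg Quotient.out (Quotient.sound ⟨v, rfl⟩)
  choose v hv using hr
  have hv1 : ∀ x, v (((1, 0) : ℤ × ℤ) +ᵥ x) = (1, 0) + v x := fun x => by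
    refine vadd_left_cancel_of_free hfree (x := r x) ?_
    rw [← hrv (1, 0) x, hv, hrv, ← vadd_vadd, hv]
  refine ⟨fun x => decide ((v x).1 % 2 = 0), fun x => ?_⟩
  beta_reduce
  rw [hv1, Ne, decide_eq_decide, Prod.fst_add]
  lia

section

variable {Γ : Type} [AddCommGroup Γ] [AddAction (ℤ × ℤ) (FreePart (Fin 2) Γ)]

/-- Being the base of a given square is a condition on finitely many coordinates, hence open; the
set of points with label `l` is a union of translates of such sets. -/
theorem IsTame.isOpen_labels {S : Set (Placed (FreePart (Fin 2) Γ))} (hS : IsTame S)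
    [ContinuousConstVAdd (ℤ × ℤ) (FreePart (Fin 2) Γ)] (l : Lab) :
    IsOpen {y | ∃ P ∈ S, P.Labels y l} := by
  obtain ⟨K, hK⟩ := hS.isLocal
  have hbase : ∀ m u, IsOpen {x : FreePart (Fin 2) Γ | (⟨x, m, u⟩ : Placed _) ∈ S} := fun m u => by
    rw [isOpen_iff_mem_nhds]
    intro x hx
    have hcyl : ∀ᶠ y : FreePart (Fin 2) Γ in nhds x, ∀ δ ∈ K, x.1 δ = y.1 δ := by
      rw [Filter.eventually_all_finset]
      intro δ _
      have hc : Continuous fun y : FreePart (Fin 2) Γ => y.1 δ :=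
        (continuous_apply δ).comp continuous_subtype_val
      filter_upwards [((isOpen_discrete {x.1 δ}).preimage hc).mem_nhds (x := x) rfl] with y hy
      exact (Set.mem_singleton_iff.1 hy).symm
    filter_upwards [hcyl] with y hy
    exact hK x y hy m u hx
  have : {y | ∃ P ∈ S, P.Labels y l} = ⋃ (m : ℕ) (u : ℕ → ℕ → Lab) (i : ℕ) (j : ℕ)
      (_ : (1 < i ∧ i < m ∧ 1 < j ∧ j < m) ∧ l = u i j),
      (fun y => (-((i : ℤ), (j : ℤ)) : ℤ × ℤ) +ᵥ y) ⁻¹' {x | (⟨x, m, u⟩ : Placed _) ∈ S} := by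
    ext y
    simp only [Set.mem_ofPred_eq, Set.mem_iUnion, Set.mem_preimage, exists_prop]
    constructor
    · rintro ⟨⟨x, m, u⟩, hP, i, j, h1, h2, h3, h4, h5, h6⟩
      refine ⟨m, u, i, j, ⟨⟨h1, h2, h3, h4⟩, h6⟩, ?_⟩
      rw [h5, trans, neg_vadd_vadd]
      exact hP
    · rintro ⟨m, u, i, j, ⟨⟨h1, h2, h3, h4⟩, h6⟩, hP⟩
      exact ⟨_, hP, i, j, h1, h2, h3, h4, (vadd_neg_vadd _ _).symm, h6⟩
  rw [this]
  exact isOpen_iUnion fun m => isOpen_iUnion fun u => isOpen_iUnion fun i => isOpen_iUnion fun j =>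
    isOpen_iUnion fun _ => (hbase m u).preimage (continuous_const_vadd _)

/-- There is a compatible family of framed squares that covers an open dense set. -/
theorem exists_dense_family [Countable Γ] [IsAddTorsionFree Γ] [Infinite Γ] {e : ℤ × ℤ →+ Γ}
    (he : Function.Injective e)
    (hact : ∀ (v : ℤ × ℤ) (x : FreePart (Fin 2) Γ) δ, (v +ᵥ x).1 δ = x.1 (δ + e v))
    (hfree : IsFreeAction (ℤ × ℤ) (FreePart (Fin 2) Γ)) :
    ∃ T : ℕ → Set (Placed (FreePart (Fin 2) Γ)), Monotone T ∧ (∀ k, IsTame (T k)) ∧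
      Dense {y | ∃ P ∈ ⋃ k, T k, P.Covers y} := by
  obtain ⟨b, hb, -, hbasis⟩ := TopologicalSpace.exists_countable_basis (FreePart (Fin 2) Γ)
  obtain ⟨g, hg⟩ := Set.countable_iff_exists_subset_range.1 hb
  have hstep : ∀ (k : ℕ) (S : {S : Set (Placed (FreePart (Fin 2) Γ)) // IsTame S}),
      ∃ S' : {S : Set (Placed (FreePart (Fin 2) Γ)) // IsTame S}, S.1 ⊆ S'.1 ∧
        (IsOpen (g k) → (g k).Nonempty → ∃ y ∈ g k, ∃ P ∈ S'.1, P.Covers y) := by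
    intro k S
    by_cases h : IsOpen (g k) ∧ (g k).Nonempty
    · obtain ⟨S', h1, h2, h3⟩ := S.2.exists_extension he hact hfree h.1 h.2
      exact ⟨⟨S', h2⟩, h1, fun _ _ => h3⟩
    · exact ⟨S, subset_rfl, fun h1 h2 => absurd ⟨h1, h2⟩ h⟩
  choose next hnext1 hnext2 using hstep
  let T : ℕ → {S : Set (Placed (FreePart (Fin 2) Γ)) // IsTame S} :=
    fun k => Nat.rec ⟨∅, isTame_empty⟩ next k
  refine ⟨fun k => (T k).1, monotone_nat_of_le_succ fun k => hnext1 k (T k), fun k => (T k).2,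
    hbasis.dense_iff.2 fun o ho hne => ?_⟩
  obtain ⟨k, rfl⟩ := hg ho
  obtain ⟨y, hy, P, hP, hPy⟩ := hnext2 k (T k) (hbasis.isOpen ho) hne
  exact ⟨y, hy, P, Set.mem_iUnion.2 ⟨k + 1, hP⟩, hPy⟩

/-- The free part of the shift has Baire measurable tilings. -/
theorem exists_baireMeasurable_tiling [Countable Γ] [IsAddTorsionFree Γ] [Infinite Γ]
    {e : ℤ × ℤ →+ Γ} (he : Function.Injective e)
    (hact : ∀ (v : ℤ × ℤ) (x : FreePart (Fin 2) Γ) δ, (v +ᵥ x).1 δ = x.1 (δ + e v))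
    (hfree : IsFreeAction (ℤ × ℤ) (FreePart (Fin 2) Γ)) :
    ∃ f : FreePart (Fin 2) Γ → Lab, IsBaireMeasurableLabeling f ∧ ∀ x, IsTilingAt f x := by
  classical
  have : ContinuousConstVAdd (ℤ × ℤ) (FreePart (Fin 2) Γ) := ⟨fun v =>
    Continuous.subtype_mk (p := (· ∈ FreePart (Fin 2) Γ)) (f := fun x : FreePart (Fin 2) Γ => (v +ᵥ x).1)
      (continuous_pi fun δ => by
        simp only [hact]
        exact (continuous_apply _).comp continuous_subtype_val) fun x : FreePart (Fin 2) Γ => (v +ᵥ x).2⟩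
  obtain ⟨T, hmono, hT, hdense⟩ := exists_dense_family he hact hfree
  set S := ⋃ k, T k
  obtain ⟨f, hf1, hf2⟩ := exists_labelling hfree (S := S)
    (fun P hP => by
      obtain ⟨k, hk⟩ := Set.mem_iUnion.1 hP
      exact (hT k).valid P hk)
    (fun P hP Q hQ => by
      obtain ⟨k, hk⟩ := Set.mem_iUnion.1 hP
      obtain ⟨l, hl⟩ := Set.mem_iUnion.1 hQ
      exact (hT (max k l)).compat P (hmono (le_max_left k l) hk) Q (hmono (le_max_right k l) hl))
  have hlab : ∀ l, IsOpen {y | ∃ P ∈ S, P.Labels y l} := fun l => by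
    have : {y | ∃ P ∈ S, P.Labels y l} = ⋃ k, {y | ∃ P ∈ T k, P.Labels y l} := by
      ext y
      simp only [S, Set.mem_iUnion, Set.mem_ofPred_eq]
      tauto
    rw [this]
    exact isOpen_iUnion fun k => (hT k).isOpen_labels l
  have hopen : IsOpen {y | ∃ P ∈ S, P.Covers y} := by
    have : {y | ∃ P ∈ S, P.Covers y} = ⋃ l, {y | ∃ P ∈ S, P.Labels y l} := by
      ext y
      simp only [Placed.Covers, Set.mem_iUnion, Set.mem_ofPred_eq]
      tauto
    rw [this]
    exact isOpen_iUnion hlab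
  -- The points whose whole plane is covered. This set is invariant, so the two labellings never
  -- meet in a local constraint, and it is comeagre as a countable intersection of translates of a
  -- dense open set.
  let G : Set (FreePart (Fin 2) Γ) := {x | ∀ v : ℤ × ℤ, ∃ P ∈ S, P.Covers (v +ᵥ x)}
  have hG : ∀ᶠ x in residual _, x ∈ G := by
    refine eventually_countable_forall.2 fun v => ?_
    exact residual_of_dense_open (hopen.preimage (continuous_const_vadd v))
      (hdense.preimage (isOpenMap_vadd v))
  have hGv : ∀ v x, v +ᵥ x ∈ G ↔ x ∈ G := fun v x => by
    refine ⟨fun h w => ?_, fun h w => ?_⟩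
    · have := h (w - v)
      rwa [vadd_vadd, sub_add_cancel] at this
    · rw [vadd_vadd]
      exact h _
  obtain ⟨c, hc⟩ := exists_alternating hfree
  refine ⟨fun x => if x ∈ G then f x else (Tile.plain, c x), fun l => ?_, fun x => ?_⟩
  -- On `G` the label `l` is used exactly at the points of an open set, so its preimage differs from
  -- that set by a meagre set.
  · refine (hlab l).baireMeasurableSet.congr (Filter.eventuallyEq_set.2 ?_)
    filter_upwards [hG] with x hx
    simp only [Set.mem_preimage, if_pos hx, Set.mem_singleton_iff]
    refine ⟨fun ⟨P, hP, h⟩ => hf1 P hP x l h, fun h => ?_⟩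
    obtain ⟨P, hP, l', h'⟩ := hx 0
    rw [zero_vadd] at h'
    rw [← h, hf1 P hP x l' h']
    exact ⟨P, hP, h'⟩
  · by_cases hx : x ∈ G
    · simp only [IsTilingAt, hGv, if_pos hx]
      exact hf2 x hx
    · simp only [IsTilingAt, hGv, if_neg hx]
      exact ⟨hRel_plain (hc x), vRel_plain, dRel_plain⟩

end

theorem tilingLCL_mem_BaireSHIFT {Γ : Type} [AddCommGroup Γ] [Countable Γ] [IsAddTorsionFree Γ]
    {e : ℤ × ℤ →+ Γ} (he : Function.Injective e) : tilingLCL e ∈ BaireSHIFT Γ := by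
  let _ : AddAction (ℤ × ℤ) (FreePart (Fin 2) Γ) := AddAction.compHom _ e
  have : Infinite Γ := Infinite.of_injective e he
  obtain ⟨f, hf, ht⟩ := exists_baireMeasurable_tiling he (fun _ _ _ => rfl)
    (isFreeAction_compHom he fun γ hγ x h => x.2 γ hγ (congrArg Subtype.val h))
  exact ⟨f, hf, (isSolution_tilingLCL_iff e f).2 ht⟩

end FramedSquares

theorem theorem1p13 (n : ℕ) (hn : 2 ≤ n) :
    (∃ P : LCL (Fin n → ℤ),
      P ∉ FIID (Fin n → ℤ) ∧ P ∈ BaireSHIFT (Fin n → ℤ) ∧ P ∈ COMPUTABLE (Fin n → ℤ)) ∧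
    ¬ (COMPUTABLE (Fin n → ℤ) ⊆ MEASURE (Fin n → ℤ)) := by
  have hinj := FramedSquares.planeHom_injective hn
  have hF := FramedSquares.tilingLCL_notMem_FIID hinj
  have hC := FramedSquares.tilingLCL_mem_COMPUTABLE hinj
  exact ⟨⟨_, hF, FramedSquares.tilingLCL_mem_BaireSHIFT hinj, hC⟩,
    fun h => FramedSquares.notMem_MEASURE_of_notMem_FIID hF (h hC)⟩
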